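/- Let $p,T\ge 1$ be integers, $\theta=(a_1,\dots,a_p)\in\mathbb R^p$, $b,\sigma:\mathbb R\to\mathbb R$, and assume the following. 1. $e_n=s_n+\eta_n$ ($n\in\mathbb Z$), where $(s_n)$ is a deterministic $T$-periodic real sequence and $(\eta_n)$ is a bounded i.i.d. sequence with mean $0$. 2. $(\varepsilon_n)_{n\in\mathbb Z}$ is a bounded i.i.d. sequence with mean $0$ and variance $1$. 3. The polynomial $z^p-\sum_{j=1}^p a_jz^{p-j}$ has no zero in $\{z\in\mathbb C:|z|\ge1\}$. 4. The sequences $(\varepsilon_n)$ and $(\eta_n)$ are independent. 5. $\eta_1$ has support $[-m_\eta,m_\eta]$ and a density $f$ which is continuous and positive on this interval; $\varepsilon_1$ has support $[-m_\varepsilon,m_\varepsilon]$ and a density $g$ which is $C^1$ and positive on this interval. 6. With $\mathcal E=\bigcup_{j=1}^T[s_j-m_\eta,s_j+m_\eta]$, the function $b$ is $\gamma$-Hölder on $\mathcal E$ and $\sigma^2$ is $\gamma'$-Hölder on $\mathcal E$, where $\gamma,\gamma'\in(0,1]$, and $\inf_{\mathcal E}\sigma>0$. 7. The kernel $K:\mathbb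 R\to\mathbb R$ is Lipschitz and integrable, $\int K=1$, $\int|u|^\gamma|K(u)|\,du<\infty$, and for every closed half-line $H\subset\mathbb R$ one has $\int_HK\ge0$, with $\int_HK>0$ if $0\in H$. (The condition on half-lines holds for instance if $K$ is nonnegative and symmetric.) 8. The real sequence $(h_n)$ satisfies $h_n\sim n^{\beta_1}(\ln n)^{\beta_2}$ as $n\to\infty$, where $-1<\beta_1<0$ and $\beta_2\in\mathbb R$. Let $X_n=\sum_{j\ge0}g_j\bigl(b(e_{n-j})+\sigma(e_{n-j})\varepsilon_{n-j}\bigr)$, $n\in\mathbb Z$, where $\sum_{j\ge0}g_jz^j=(1-a_1z-\dots-a_pz^p)^{-1}$; this is the periodically correlated solution of $X_n=\sum_{j=1}^pa_jX_{n-j}+b(e_n)+\sigma(e_n)\varepsilon_n$. Put $\phi_l={}^t(X_{l-1},\dots,X_{l-p})$, $\Sigma_n=\sum_{l=p+1}^n\phi_l{}^t\phi_l$ and $K_n(x)=K(x/h_n)$. Fix $\hat\theta_n^{(1)}=\hat\theta^{(1)}\in\mathbb R^p$ and define $$\hat b_n^{(k)}(x)=\frac{\sum_{l=p+1}^n(X_l-{}^t\phi_l\hat\theta_n^{(k)})K_n(x-e_l)}{\sum_{l=p+1}^nK_n(x-e_l)}\quad(k\ge1),\qquad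 \hat\theta_n^{(k)}=\Sigma_n^{-1}\sum_{l=p+1}^n\phi_l\bigl(X_l-\hat b_n^{(k-1)}(e_l)\bigr)\quad(k\ge2),$$ $$\hat\sigma^2_{n,k}(x)=\frac{\sum_{l=p+1}^{n-1}\bigl(X_l-{}^t\phi_l\hat\theta_n^{(k)}-\hat b_n^{(k-1)}(e_l)\bigr)^2K_n(x-e_l)}{\sum_{l=p+1}^{n-1}K_n(x-e_l)}\quad(k\ge2).$$ Then there is a (deterministic) $\beta\in(0,1)$ such that, almost surely, there are a finite constant $C$ and an integer $N$ (both may depend on the outcome, but not on $n$, $k$) such that for all $n\ge N$ the matrix $\Sigma_n$ is invertible, the denominators above do not vanish for any $x\in\mathcal E$, and $$\|\hat\theta_n^{(k)}-\theta\|_2\le C\Bigl(\sqrt{\tfrac{\ln n}{nh_n}}+h_n^{\gamma}+\beta^k\Bigr),\qquad \sup_{x\in\mathcal E}|\hat b_n^{(k)}(x)-b(x)|\le C\Bigl(\sqrt{\tfrac{\ln n}{nh_n}}+h_n^{\gamma}+\beta^k\Bigr)\qquad\text{for all }k\ge1,$$ $$\sup_{x\in\mathcal E}|\hat\sigma^2_{n,k}(x)-\sigma^2(x)|\le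 C\Bigl(\sqrt{\tfrac{\ln n}{nh_n}}+h_n^{\min\{\gamma,\gamma'\}}+\beta^k\Bigr)\qquad\text{for all }k\ge2.$$ -/

import Mathlib

open MeasureTheory ProbabilityTheory Filter Asymptotics
open scoped NNReal Matrix

namespace PartiallyLinear

noncomputable section

/-- The coefficients `g_j` of the power series `1 / (1 - a_1 z - ... - a_p z^p)`;
the entry `a i` stands for `a_{i+1}`. -/
def maCoeff {p : ℕ} (a : Fin p → ℝ) (j : ℕ) : ℝ :=
  PowerSeries.coeff j
    (1 - ∑ i : Fin p, PowerSeries.C (a i) * (PowerSeries.X : PowerSeries ℝ) ^ ((i : ℕ) + 1))⁻¹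

/-- The path `X_n = ∑_{j ≥ 0} g_j (b(e_{n-j}) + σ(e_{n-j}) ε_{n-j})` built from the paths of
the exogenous sequence `e` and of the noise `ε`. -/
def maSolution {p : ℕ} (a : Fin p → ℝ) (b σ : ℝ → ℝ) (e ε : ℤ → ℝ) (n : ℤ) : ℝ :=
  ∑' j : ℕ, maCoeff a j * (b (e (n - j)) + σ (e (n - j)) * ε (n - j))

/-- The union of the supports of `e_1, ..., e_T`. -/
def inputSupport (T : ℕ) (s : ℤ → ℝ) (m : ℝ) : Set ℝ :=
  ⋃ j ∈ Set.Icc (1 : ℤ) T, Set.Icc (s j - m) (s j + m)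

/-- `f` is a density of the random variable `Y`, the support of `Y` is `[-m, m]`, and `f` is
positive there. -/
structure HasDensityOn {Ω : Type*} [MeasurableSpace Ω] (P : Measure Ω) (Y : Ω → ℝ)
    (f : ℝ → ℝ) (m : ℝ) : Prop where
  map_eq : P.map Y = volume.withDensity (fun x => ENNReal.ofReal (f x))
  pos : ∀ x ∈ Set.Icc (-m) m, 0 < f x
  eq_zero : ∀ x ∉ Set.Icc (-m) m, f x = 0

/-- A bounded sequence of independent, identically distributed, centered random variables. -/
structure BoundedWhiteNoise {Ω : Type*} [MeasurableSpace Ω] (P : Measure Ω)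
    (Y : ℤ → Ω → ℝ) : Prop where
  measurable : ∀ n, Measurable (Y n)
  indep : iIndepFun Y P
  ident : ∀ n, IdentDistrib (Y n) (Y 1) P P
  bounded : ∃ B : ℝ, ∀ n, ∀ᵐ ω ∂P, |Y n ω| ≤ B
  centered : ∀ n, ∫ ω, Y n ω ∂P = 0

/-- The kernel conditions. The half-line conditions hold for every nonnegative symmetric `K`. -/
structure IsKernel (K : ℝ → ℝ) (γ : ℝ≥0) : Prop where
  lipschitz : ∃ L : ℝ≥0, LipschitzWith L K
  integrable : Integrable K
  integral_eq_one : ∫ u, K u = 1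
  moment : Integrable (fun u => |u| ^ (γ : ℝ) * |K u|)
  left_nonneg : ∀ c : ℝ, 0 ≤ ∫ u in Set.Iic c, K u
  right_nonneg : ∀ c : ℝ, 0 ≤ ∫ u in Set.Ici c, K u
  left_pos : ∀ c : ℝ, 0 ≤ c → 0 < ∫ u in Set.Iic c, K u
  right_pos : ∀ c : ℝ, c ≤ 0 → 0 < ∫ u in Set.Ici c, K u

/-- The regressor `φ_l = (X_{l-1}, ..., X_{l-p})`. -/
def regressor (p : ℕ) (X : ℤ → ℝ) (l : ℕ) : Fin p → ℝ :=
  fun i => X ((l : ℤ) - ((i : ℕ) + 1 : ℤ))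

/-- `Σ_n = ∑_{l=p+1}^n φ_l φ_lᵀ`. -/
def gram (p : ℕ) (X : ℤ → ℝ) (n : ℕ) : Matrix (Fin p) (Fin p) ℝ :=
  ∑ l ∈ Finset.Icc (p + 1) n, Matrix.vecMulVec (regressor p X l) (regressor p X l)

/-- `∑_{l=p+1}^N K((x - e_l) / h)`. -/
def kernelMass (p : ℕ) (K : ℝ → ℝ) (h : ℝ) (e : ℤ → ℝ) (N : ℕ) (x : ℝ) : ℝ :=
  ∑ l ∈ Finset.Icc (p + 1) N, K ((x - e l) / h)

/-- The kernel regression of `y_l` on `e_l`, `p + 1 ≤ l ≤ N`, at the point `x`. -/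
def kernelRegression (p : ℕ) (K : ℝ → ℝ) (h : ℝ) (e : ℤ → ℝ) (N : ℕ) (y : ℕ → ℝ) (x : ℝ) : ℝ :=
  (∑ l ∈ Finset.Icc (p + 1) N, y l * K ((x - e l) / h)) / kernelMass p K h e N x

/-- The kernel estimator of `b` based on the partial residuals for the value `θ`. -/
def bOf {p : ℕ} (K : ℝ → ℝ) (h : ℝ) (X e : ℤ → ℝ) (n : ℕ) (θ : Fin p → ℝ) (x : ℝ) : ℝ :=
  kernelRegression p K h e n (fun l => X l - regressor p X l ⬝ᵥ θ) x

/-- The least squares estimator of `θ` based on the partial residuals for the function `b`. -/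
def thetaOf (p : ℕ) (X e : ℤ → ℝ) (n : ℕ) (b : ℝ → ℝ) : Fin p → ℝ :=
  (gram p X n)⁻¹ *ᵥ ∑ l ∈ Finset.Icc (p + 1) n, (X l - b (e l)) • regressor p X l

/-- The backfitting iterates `θ̂_n^{(k)}`, `k ≥ 1`, started at `θ̂^{(1)} = θ₁`
(the value at `k = 0` is a convention and is not used). -/
def thetaHat {p : ℕ} (K : ℝ → ℝ) (h : ℝ) (X e : ℤ → ℝ) (n : ℕ) (θ₁ : Fin p → ℝ) :
    ℕ → Fin p → ℝ
  | 0 => θ₁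
  | 1 => θ₁
  | k + 2 => thetaOf p X e n (bOf K h X e n (thetaHat K h X e n θ₁ (k + 1)))

/-- The backfitting iterates `b̂_n^{(k)}`, `k ≥ 1`. -/
def bHat {p : ℕ} (K : ℝ → ℝ) (h : ℝ) (X e : ℤ → ℝ) (n : ℕ) (θ₁ : Fin p → ℝ) (k : ℕ) :
    ℝ → ℝ :=
  bOf K h X e n (thetaHat K h X e n θ₁ k)

/-- The variance estimator `σ̂²_{n,k}`, `k ≥ 2`, based on `θ̂_n^{(k)}` and `b̂_n^{(k-1)}`. -/
def sigmaSqHat {p : ℕ} (K : ℝ → ℝ) (h : ℝ) (X e : ℤ → ℝ) (n : ℕ) (θ₁ : Fin p → ℝ) (k : ℕ)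
    (x : ℝ) : ℝ :=
  kernelRegression p K h e (n - 1)
    (fun l => (X l - regressor p X l ⬝ᵥ thetaHat K h X e n θ₁ k
      - bHat K h X e n θ₁ (k - 1) (e l)) ^ 2) x

end

end PartiallyLinear

open MeasureTheory ProbabilityTheory Filter Asymptotics
open scoped NNReal Matrix

/-! Write N_l = σ(e_l) ε_l and D_k = θ̂^(k) - a. Kernel regression is linear in its responses, so
b̂^(k) - b is the error of the oracle regression of b(e_l) + N_l, minus D_k applied to the kernel
regressions of the lags (`bOf_sub_eq`). Inserted in the least squares step, this gives an affine
recursion Σ_n D_{k+1} = H_n D_k + error, where H_n sums φ_l times the transposed regression of φ at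
e_l (`average_thetaOf_sub`). It remains to show that for large n the recursion contracts, with a
factor independent of n and k, and that the error divided by n has the order √(ln n / (n h_n)) +
h_n^γ.

Contraction. The regressor φ_l depends on the past and is independent of e_l, so e_l carries
information on φ_l only through the season l mod T. Hence H_n / n tends to a matrix Q built from the
seasonal means μ_r of the regressor and the densities of the e_r (`ae_tendsto_backfitting`). The
form Q is positive semidefinite (`two_mul_limitForm_le`) and, by Cauchy–Schwarz, at most the Gram
form T⁻¹ ∑ μ_r μ_rᵗ of the means (`limitForm_self_le`). The matrix Σ_n / n exceeds the latter by at
least δ times the identity, because the regressor contains recent innovations whose variance is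
bounded below (`ae_gram_lower_bound`). So Q + δ ≤ Σ_n / n ≤ Λ, and in the norm of Σ_n / n one step
contracts squared errors by the factor 1 - δ/(2Λ), up to the error term (`gramForm_thetaOf_le`).
Since δ and Λ are deterministic, so is β, the square root of this factor.

Error. Sums of bounded noise with predictable weights satisfy a Bernstein bound; a union over
polynomially many indices and Borel–Cantelli make it almost sure (`ae_eventually_abs_sum_le`), and
the Lipschitz property of K makes it uniform in x (`ae_uniform_kernel_sum`). A kernel factor has
second moment of order h_n, whence the stochastic rate; the Hölder condition gives the bias. The
denominators are at least of order n h_n on the whole support: near an edge part of the kernel mass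
is lost, and the half-line conditions ensure that enough is left (`exists_mixture_lower_bound`,
`ae_kernelMass_lower_bound`).

The probabilistic facts hold along almost every path for large n; `path_rates` is the deterministic
conclusion along one path. Truncating the noises and cutting b and σ off outside the support makes
all bounds hold everywhere and almost surely changes nothing. -/

namespace PartiallyLinear

/-! ### The coefficients of the causal moving average -/

open PowerSeries in
/-- The denominator of the generating series of `maCoeff`. -/
noncomputable def arSeries {p : ℕ} (a : Fin p → ℝ) : PowerSeries ℝ :=
  1 - ∑ i : Fin p, C (a i) * (X : PowerSeries ℝ) ^ ((i : ℕ) + 1)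

lemma arSeries_mul_inv {p : ℕ} (a : Fin p → ℝ) : arSeries a * (arSeries a)⁻¹ = 1 := by
  apply PowerSeries.mul_inv_cancel
  simp [arSeries]

/-- Compare the coefficients of z^j in the product of the autoregressive series and its inverse. The
autoregressive equation needs nothing else about the coefficients than this and summability. -/
lemma maCoeff_recursion {p : ℕ} (a : Fin p → ℝ) (j : ℕ) :
    maCoeff a j - ∑ i : Fin p, (if (i : ℕ) + 1 ≤ j then a i * maCoeff a (j - (i + 1)) else 0)
      = if j = 0 then 1 else 0 := by
  have h := congrArg (PowerSeries.coeff j) (arSeries_mul_inv a)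
  rw [PowerSeries.coeff_one, arSeries, sub_mul, one_mul, Finset.sum_mul, map_sub, map_sum] at h
  rw [← h]
  congr 1
  refine Finset.sum_congr rfl fun i _ => ?_
  rw [mul_assoc, PowerSeries.coeff_C_mul, PowerSeries.coeff_X_pow_mul', mul_ite, mul_zero]
  rfl

lemma maCoeff_zero {p : ℕ} (a : Fin p → ℝ) : maCoeff a 0 = 1 := by
  simpa using maCoeff_recursion a 0

/-- A product of factors `1 - α X` with `|α| < 1` has an inverse with summable coefficients. -/
lemma exists_summable_inverse (S : Multiset ℂ) (hS : ∀ α ∈ S, ‖α‖ < 1) :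
    ∃ G : PowerSeries ℂ, Summable (fun n => ‖PowerSeries.coeff n G‖) ∧
      G * (S.map fun α => 1 - PowerSeries.C α * (PowerSeries.X : PowerSeries ℂ)).prod = 1 := by
  induction S using Multiset.induction_on with
  | empty =>
    refine ⟨1, ?_, by simp⟩
    refine summable_of_ne_finset_zero (s := {0}) fun n hn => ?_
    simp only [Finset.mem_singleton] at hn
    simp [PowerSeries.coeff_one, hn]
  | cons α S ih =>
    obtain ⟨G, hG, hG1⟩ := ih fun β hβ => hS β (Multiset.mem_cons_of_mem hβ)
    have hα : ‖α‖ < 1 := hS α (Multiset.mem_cons_self α S)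
    -- The geometric series inverts one factor, and Cauchy products preserve absolute summability;
    -- this is the induction step.
    have hgeom : PowerSeries.mk (fun n => α ^ n) *
        (1 - PowerSeries.C α * (PowerSeries.X : PowerSeries ℂ)) = 1 := by
      ext n
      rw [mul_sub, mul_one, mul_left_comm, map_sub, PowerSeries.coeff_mk,
        PowerSeries.coeff_C_mul, PowerSeries.coeff_one]
      cases n with
      | zero => simp
      | succ n =>
        rw [PowerSeries.coeff_succ_mul_X, PowerSeries.coeff_mk, pow_succ', sub_self,
          if_neg n.succ_ne_zero]
    refine ⟨G * PowerSeries.mk (fun n => α ^ n), ?_, ?_⟩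
    · have hpow : Summable fun n : ℕ => ‖α ^ n‖ := by
        simp only [norm_pow]
        exact summable_geometric_of_lt_one (norm_nonneg α) hα
      refine (summable_norm_sum_mul_antidiagonal_of_summable_norm hG hpow).congr fun n => ?_
      rw [PowerSeries.coeff_mul]
      simp only [PowerSeries.coeff_mk]
    · rw [Multiset.map_cons, Multiset.prod_cons]
      rw [← mul_assoc, mul_assoc G, hgeom, mul_one, hG1]

/-- The characteristic polynomial `z^p - ∑ a_j z^{p-j}`. -/
noncomputable def arPoly {p : ℕ} (a : Fin p → ℝ) : Polynomial ℂ :=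
  Polynomial.X ^ p - ∑ j : Fin p, Polynomial.C (a j : ℂ) * Polynomial.X ^ (p - ((j : ℕ) + 1))

lemma arPoly_monic {p : ℕ} (a : Fin p → ℝ) : (arPoly a).Monic ∧ (arPoly a).natDegree = p := by
  have hd : (∑ j : Fin p, Polynomial.C (a j : ℂ) * Polynomial.X ^ (p - ((j : ℕ) + 1))).degree
      < (p : WithBot ℕ) := by
    refine (Polynomial.degree_sum_le _ _).trans_lt ?_
    refine (Finset.sup_lt_iff (WithBot.bot_lt_coe p)).2 fun j _ => ?_
    refine (Polynomial.degree_C_mul_X_pow_le _ _).trans_lt ?_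
    have : p - ((j : ℕ) + 1) < p := by have := j.2; omega
    exact WithBot.coe_lt_coe.2 this
  constructor
  · exact Polynomial.monic_X_pow_sub hd
  · apply Polynomial.natDegree_eq_of_degree_eq_some
    rw [arPoly, Polynomial.degree_sub_eq_left_of_degree_lt, Polynomial.degree_X_pow]
    rwa [Polynomial.degree_X_pow]

/-- Stability is stated for the zeros of z^p - ∑ a_j z^(p-j), whereas `maCoeff` comes from the
series with the coefficients in the opposite order. The degree of `arPoly` is p even if the last a_j
vanish, so the reversal is exact. -/
lemma arPoly_reverse {p : ℕ} (a : Fin p → ℝ) :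
    ((arPoly a).reverse : PowerSeries ℂ) = PowerSeries.map (algebraMap ℝ ℂ) (arSeries a) := by
  have h : (arPoly a).reverse =
      1 - ∑ j : Fin p, Polynomial.C (a j : ℂ) * Polynomial.X ^ ((j : ℕ) + 1) := by
    rw [Polynomial.reverse, (arPoly_monic a).2, arPoly, Polynomial.reflect_sub]
    have hs : ∀ s : Finset (Fin p), Polynomial.reflect p
        (∑ j ∈ s, Polynomial.C (a j : ℂ) * Polynomial.X ^ (p - ((j : ℕ) + 1)))
        = ∑ j ∈ s, Polynomial.C (a j : ℂ) * Polynomial.X ^ ((j : ℕ) + 1) := by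
      intro s
      induction s using Finset.induction_on with
      | empty => simp
      | insert j s hj ih =>
        rw [Finset.sum_insert hj, Finset.sum_insert hj, Polynomial.reflect_add, ih,
          Polynomial.reflect_C_mul_X_pow, Polynomial.revAt_le (by omega)]
        congr 3
        have := j.2
        omega
    rw [hs]
    congr 1
    simp
  rw [h, arSeries]
  have hcoe : ∀ q : Polynomial ℂ, (q : PowerSeries ℂ) =
      Polynomial.coeToPowerSeries.ringHom q := fun q => rfl
  rw [hcoe]
  simp [map_sub, map_sum, map_mul, map_pow]

/-- Over ℂ the characteristic polynomial is a product of factors X - α with |α| < 1, so its reversal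
is the product of the 1 - α X, which `exists_summable_inverse` inverts. Inverses of power series
being unique, its coefficients are the `maCoeff`. -/
theorem summable_abs_maCoeff {p : ℕ} (a : Fin p → ℝ)
    (hstab : ∀ z : ℂ, 1 ≤ ‖z‖ →
      z ^ p - ∑ j : Fin p, (a j : ℂ) * z ^ (p - ((j : ℕ) + 1)) ≠ 0) :
    Summable fun j => |maCoeff a j| := by
  set q := arPoly a with hq
  have hprod : q = (q.roots.map fun α => Polynomial.X - Polynomial.C α).prod := by
    have h1 := (IsAlgClosed.splits q).eq_prod_roots
    rwa [(arPoly_monic a).1.leadingCoeff, map_one, one_mul] at h1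
  have hroots : ∀ α ∈ q.roots, ‖α‖ < 1 := by
    intro α hα
    by_contra hlt
    refine hstab α (not_lt.1 hlt) ?_
    have := (Polynomial.mem_roots'.1 hα).2
    simpa [Polynomial.IsRoot, hq, arPoly, Polynomial.eval_finsetSum] using this
  have hrev : ∀ S : Multiset ℂ,
      (((S.map fun α => Polynomial.X - Polynomial.C α).prod.reverse : Polynomial ℂ) :
        PowerSeries ℂ)
      = (S.map fun α => 1 - PowerSeries.C α * (PowerSeries.X : PowerSeries ℂ)).prod := by
    intro S
    induction S using Multiset.induction_on with
    | empty =>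
      have : Polynomial.reverse (1 : Polynomial ℂ) = 1 := by
        simpa using Polynomial.reverse_C (1 : ℂ)
      simp [this]
    | cons α S ih =>
      rw [Multiset.map_cons, Multiset.prod_cons, Polynomial.reverse_mul_of_domain,
        Polynomial.coe_mul, ih, Multiset.map_cons, Multiset.prod_cons]
      congr 1
      have : (Polynomial.X - Polynomial.C α).reverse
          = 1 - Polynomial.C α * Polynomial.X := by
        rw [Polynomial.reverse, Polynomial.natDegree_X_sub_C, Polynomial.reflect_sub,
          Polynomial.reflect_C]
        simp
      rw [this]
      simp [Polynomial.coe_sub]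
  obtain ⟨G, hG, hG1⟩ := exists_summable_inverse q.roots hroots
  have hmap : PowerSeries.map (algebraMap ℝ ℂ) (arSeries a)
      = (q.roots.map fun α => 1 - PowerSeries.C α * (PowerSeries.X : PowerSeries ℂ)).prod := by
    rw [← arPoly_reverse, ← hrev, ← hprod]
  have hinv : PowerSeries.map (algebraMap ℝ ℂ) (arSeries a)⁻¹ = G := by
    have h1 := congrArg (PowerSeries.map (algebraMap ℝ ℂ)) (arSeries_mul_inv a)
    rw [map_mul, map_one, hmap] at h1
    calc _ = G * (q.roots.map fun α =>
          1 - PowerSeries.C α * (PowerSeries.X : PowerSeries ℂ)).prod *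
            PowerSeries.map (algebraMap ℝ ℂ) (arSeries a)⁻¹ := by rw [hG1, one_mul]
      _ = G := by rw [mul_assoc, h1, mul_one]
  refine hG.congr fun j => ?_
  rw [← hinv, PowerSeries.coeff_map]
  simp [maCoeff, arSeries]

/-! ### The autoregressive equation -/

/-- The causal moving average of the sequence `u` with coefficients `g`. -/
noncomputable def causalFilter (g : ℕ → ℝ) (u : ℤ → ℝ) (n : ℤ) : ℝ :=
  ∑' j : ℕ, g j * u (n - j)

lemma summable_filter {g : ℕ → ℝ} (hg : Summable fun j => |g j|) {u : ℤ → ℝ} {c : ℝ}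
    (hu : ∀ n, |u n| ≤ c) (n : ℤ) : Summable fun j : ℕ => g j * u (n - j) := by
  refine Summable.of_norm_bounded (hg.mul_right c) fun j => ?_
  rw [Real.norm_eq_abs, abs_mul]
  exact mul_le_mul_of_nonneg_left (hu _) (abs_nonneg _)

lemma abs_causalFilter_le {g : ℕ → ℝ} (hg : Summable fun j => |g j|) {u : ℤ → ℝ} {c : ℝ}
    (hu : ∀ n, |u n| ≤ c) (n : ℤ) : |causalFilter g u n| ≤ (∑' j, |g j|) * c := by
  rw [← tsum_mul_right, ← Real.norm_eq_abs]
  refine tsum_of_norm_bounded (hg.mul_right c).hasSum fun j => ?_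
  rw [Real.norm_eq_abs, abs_mul]
  exact mul_le_mul_of_nonneg_left (hu _) (abs_nonneg _)

/-- Collect the filters at n and at its p lags into one series: by `maCoeff_recursion` the
coefficient of u (n - j) is 1 for j = 0 and 0 otherwise. -/
theorem causalFilter_maCoeff_eq {p : ℕ} (a : Fin p → ℝ) (hg : Summable fun j => |maCoeff a j|)
    {u : ℤ → ℝ} {c : ℝ} (hu : ∀ n, |u n| ≤ c) (n : ℤ) :
    causalFilter (maCoeff a) u n
      = ∑ i : Fin p, a i * causalFilter (maCoeff a) u (n - ((i : ℕ) + 1 : ℤ)) + u n := by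
  have hshift : ∀ i : Fin p,
      HasSum (fun j : ℕ => (if (i : ℕ) + 1 ≤ j then a i * maCoeff a (j - (i + 1)) else 0)
        * u (n - j)) (a i * causalFilter (maCoeff a) u (n - ((i : ℕ) + 1 : ℤ))) := by
    intro i
    have h0 : HasSum (fun j : ℕ => maCoeff a j * u (n - ((i : ℕ) + 1 : ℤ) - j))
        (causalFilter (maCoeff a) u (n - ((i : ℕ) + 1 : ℤ))) :=
      (summable_filter hg hu _).hasSum
    -- The first i + 1 terms vanish because of the `if`; the others are the lagged filter,
    -- reindexed.
    rw [← hasSum_nat_add_iff' ((i : ℕ) + 1)]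
    rw [Finset.sum_eq_zero, sub_zero]
    · refine (h0.mul_left (a i)).congr_fun ?_
      intro j
      rw [if_pos (by omega), show j + ((i : ℕ) + 1) - (i + 1) = j by omega]
      push_cast
      rw [show n - ((j : ℤ) + ((i : ℕ) + 1 : ℤ)) = n - ((i : ℕ) + 1 : ℤ) - j by ring]
      ring
    · intro j hj
      rw [if_neg (by simpa using hj), zero_mul]
  have h1 : HasSum (fun j : ℕ => maCoeff a j * u (n - j)) (causalFilter (maCoeff a) u n) :=
    (summable_filter hg hu n).hasSum
  have h2 := h1.sub (hasSum_sum fun i (_ : i ∈ Finset.univ) => hshift i)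
  have h3 : HasSum (fun j : ℕ => (if j = 0 then (1 : ℝ) else 0) * u (n - j)) (u n) := by
    have := hasSum_ite_eq (0 : ℕ) (u n)
    refine this.congr_fun ?_
    intro j
    by_cases hj : j = 0
    · simp [hj]
    · simp [hj]
  have h4 := h2.unique (h3.congr_fun fun j => by
    rw [← maCoeff_recursion a j, sub_mul, Finset.sum_mul])
  linarith


/-! ### Concentration of predictably weighted sums -/

/-- The variables `ξ l` are centered, bounded by `c`, of variance at most `v` and independent of
the past `𝒢 l`; the weights `φ l` are `𝒢 l`-measurable and bounded by `d`. -/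
structure PredictablyWeighted {Ω : Type*} [m0 : MeasurableSpace Ω] (P : Measure Ω)
    (𝒢 : ℕ → MeasurableSpace Ω) (φ ξ : ℕ → Ω → ℝ) (d c v : ℝ) : Prop where
  mono : Monotone 𝒢
  le : ∀ l, 𝒢 l ≤ m0
  weight_measurable : ∀ l, Measurable[𝒢 l] (φ l)
  weight_bound : ∀ l ω, |φ l ω| ≤ d
  noise_measurable : ∀ l, Measurable[𝒢 (l + 1)] (ξ l)
  noise_indep : ∀ l, Indep (MeasurableSpace.comap (ξ l) inferInstance) (𝒢 l) P
  noise_bound : ∀ l ω, |ξ l ω| ≤ c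
  noise_mean : ∀ l, ∫ ω, ξ l ω ∂P = 0
  noise_var : ∀ l, ∫ ω, ξ l ω ^ 2 ∂P ≤ v

lemma integrable_of_abs_le {Ω : Type*} [MeasurableSpace Ω] {P : Measure Ω} [IsFiniteMeasure P]
    {f : Ω → ℝ} (hf : Measurable f) {c : ℝ} (hc : ∀ ω, |f ω| ≤ c) : Integrable f P :=
  Integrable.of_bound hf.aestronglyMeasurable c (ae_of_all _ hc)

section Concentration

variable {Ω : Type*} [m0 : MeasurableSpace Ω] {P : Measure Ω}
  {𝒢 : ℕ → MeasurableSpace Ω} {φ ξ : ℕ → Ω → ℝ} {d c v : ℝ}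

namespace PredictablyWeighted

lemma measurable_partialSum (H : PredictablyWeighted P 𝒢 φ ξ d c v) (i j : ℕ) :
    Measurable[𝒢 j] fun ω => ∑ l ∈ Finset.Ico i j, φ l ω * ξ l ω := by
  refine Finset.measurable_sum _ fun l hl => ?_
  have hlj : l < j := (Finset.mem_Ico.1 hl).2
  exact ((H.weight_measurable l).mono (H.mono hlj.le) le_rfl).mul
    ((H.noise_measurable l).mono (H.mono hlj) le_rfl)

lemma abs_partialSum_le (H : PredictablyWeighted P 𝒢 φ ξ d c v) (i j : ℕ) (ω : Ω) :
    |∑ l ∈ Finset.Ico i j, φ l ω * ξ l ω| ≤ ∑ _l ∈ Finset.Ico i j, d * c := by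
  refine (Finset.abs_sum_le_sum_abs _ _).trans (Finset.sum_le_sum fun l _ => ?_)
  rw [abs_mul]
  exact mul_le_mul (H.weight_bound l ω) (H.noise_bound l ω) (abs_nonneg _)
    ((abs_nonneg _).trans (H.weight_bound l ω))

/-- With F the identity or the square, this replaces conditioning on the past. -/
lemma integral_mul_noise (H : PredictablyWeighted P 𝒢 φ ξ d c v) (l : ℕ) {Y : Ω → ℝ}
    (hY : Measurable[𝒢 l] Y) {F : ℝ → ℝ} (hF : Measurable F) :
    ∫ ω, Y ω * F (ξ l ω) ∂P = (∫ ω, Y ω ∂P) * ∫ ω, F (ξ l ω) ∂P := by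
  have hξ : Measurable (ξ l) := (H.noise_measurable l).mono (H.le _) le_rfl
  refine IndepFun.integral_fun_mul_eq_mul_integral (X := Y) (Y := fun ω => F (ξ l ω)) ?_
    (hY.mono (H.le l) le_rfl).aestronglyMeasurable (hF.comp hξ).aestronglyMeasurable
  have h1 : IndepFun Y (ξ l) P :=
    (indep_of_indep_of_le_right (H.noise_indep l) hY.comap_le).symm
  exact h1.comp measurable_id hF

/-- Bernstein's argument: exp x ≤ 1 + x + x² for |x| ≤ 1; the linear term has mean zero because ξ is
independent of the past, and the quadratic one yields a factor 1 + t²d²v ≤ exp (t²d²v) per summand.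
Counting j instead of j - i summands is harmless. -/
theorem integral_exp_le [IsProbabilityMeasure P] (H : PredictablyWeighted P 𝒢 φ ξ d c v) {t : ℝ}
    (ht : |t| * (d * c) ≤ 1) (i j : ℕ) :
    ∫ ω, Real.exp (t * ∑ l ∈ Finset.Ico i j, φ l ω * ξ l ω) ∂P
      ≤ Real.exp (j * (t ^ 2 * (d ^ 2 * v))) := by
  have hv : 0 ≤ v := (integral_nonneg fun ω => sq_nonneg _).trans (H.noise_var 0)
  induction j with
  | zero => simp
  | succ j ih =>
    by_cases hij : i ≤ j
    swap
    · rw [Finset.Ico_eq_empty (by omega)]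
      simp only [Finset.sum_empty, mul_zero, Real.exp_zero, integral_const, probReal_univ,
        smul_eq_mul, mul_one]
      exact Real.one_le_exp (by positivity)
    set S : Ω → ℝ := fun ω => ∑ l ∈ Finset.Ico i j, φ l ω * ξ l ω with hS
    set Y : Ω → ℝ := fun ω => Real.exp (t * S ω) with hY
    have hSm : Measurable[𝒢 j] S := H.measurable_partialSum i j
    have hYm : Measurable[𝒢 j] Y := Real.measurable_exp.comp (hSm.const_mul t)
    have hφm := H.weight_measurable j
    have hξ : Measurable (ξ j) := (H.noise_measurable j).mono (H.le _) le_rfl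
    have hd : 0 ≤ d := (abs_nonneg _).trans (H.weight_bound 0 (Classical.choice
      (nonempty_of_isProbabilityMeasure P)))
    have hc : 0 ≤ c := (abs_nonneg _).trans (H.noise_bound 0 (Classical.choice
      (nonempty_of_isProbabilityMeasure P)))
    obtain ⟨D, hD⟩ : ∃ D, ∀ ω, |Y ω| ≤ D := by
      refine ⟨Real.exp (|t| * ∑ _l ∈ Finset.Ico i j, d * c), fun ω => ?_⟩
      rw [hY, Real.abs_exp]
      refine Real.exp_le_exp.2 ((le_abs_self _).trans ?_)
      rw [abs_mul]
      exact mul_le_mul_of_nonneg_left (H.abs_partialSum_le i j ω) (abs_nonneg _)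
    have hYpos : ∀ ω, 0 ≤ Y ω := fun ω => (Real.exp_pos _).le
    have hpt : ∀ ω, Real.exp (t * ∑ l ∈ Finset.Ico i (j + 1), φ l ω * ξ l ω)
        ≤ Y ω + t * (Y ω * φ j ω * ξ j ω) + (t ^ 2 * d ^ 2) * (Y ω * ξ j ω ^ 2) := by
      intro ω
      rw [Finset.sum_Ico_succ_top hij, mul_add, Real.exp_add]
      have h1 : |φ j ω * ξ j ω| ≤ d * c := by
        rw [abs_mul]
        exact mul_le_mul (H.weight_bound j ω) (H.noise_bound j ω) (abs_nonneg _) hd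
      have h2 : |t * (φ j ω * ξ j ω)| ≤ 1 := by
        rw [abs_mul]
        exact (mul_le_mul_of_nonneg_left h1 (abs_nonneg _)).trans ht
      have h3 := (abs_le.1 (Real.abs_exp_sub_one_sub_id_le h2)).2
      have h4 : φ j ω ^ 2 ≤ d ^ 2 := by
        rw [← sq_abs]
        exact pow_le_pow_left₀ (abs_nonneg _) (H.weight_bound j ω) 2
      have h5 : (t * (φ j ω * ξ j ω)) ^ 2 ≤ t ^ 2 * d ^ 2 * ξ j ω ^ 2 := by
        have : (t * (φ j ω * ξ j ω)) ^ 2 = t ^ 2 * φ j ω ^ 2 * ξ j ω ^ 2 := by ring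
        rw [this]
        gcongr
      calc Y ω * Real.exp (t * (φ j ω * ξ j ω))
          ≤ Y ω * (1 + t * (φ j ω * ξ j ω) + t ^ 2 * d ^ 2 * ξ j ω ^ 2) :=
            mul_le_mul_of_nonneg_left (by linarith) (hYpos ω)
        _ = _ := by ring
    have hYm0 : Measurable Y := hYm.mono (H.le j) le_rfl
    have hφm0 : Measurable (φ j) := hφm.mono (H.le j) le_rfl
    have hD0 : ∀ ω : Ω, 0 ≤ D := fun ω => (abs_nonneg _).trans (hD ω)
    have i1 : Integrable Y P := integrable_of_abs_le hYm0 hD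
    have i2 : Integrable (fun ω => Y ω * φ j ω * ξ j ω) P := by
      refine integrable_of_abs_le ((hYm0.mul hφm0).mul hξ) (c := D * d * c) fun ω => ?_
      rw [abs_mul, abs_mul]
      exact mul_le_mul (mul_le_mul (hD ω) (H.weight_bound j ω) (abs_nonneg _) (hD0 ω))
        (H.noise_bound j ω) (abs_nonneg _) (mul_nonneg (hD0 ω) hd)
    have i3 : Integrable (fun ω => Y ω * ξ j ω ^ 2) P := by
      refine integrable_of_abs_le (hYm0.mul (hξ.pow_const 2)) (c := D * c ^ 2) fun ω => ?_
      rw [abs_mul, abs_pow]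
      exact mul_le_mul (hD ω) (pow_le_pow_left₀ (abs_nonneg _) (H.noise_bound j ω) 2)
        (by positivity) (hD0 ω)
    have e2 : ∫ ω, Y ω * φ j ω * ξ j ω ∂P = 0 := by
      have := H.integral_mul_noise j (hYm.mul hφm) measurable_id
      simp only [id, H.noise_mean, mul_zero, Pi.mul_apply] at this
      exact this
    have e3 : ∫ ω, Y ω * ξ j ω ^ 2 ∂P ≤ (∫ ω, Y ω ∂P) * v := by
      rw [H.integral_mul_noise j hYm (F := fun x => x ^ 2) (measurable_id.pow_const 2)]
      exact mul_le_mul_of_nonneg_left (H.noise_var j) (integral_nonneg hYpos)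
    have i4 : Integrable (fun ω => Y ω + t * (Y ω * φ j ω * ξ j ω)) P := i1.add (i2.const_mul t)
    calc ∫ ω, Real.exp (t * ∑ l ∈ Finset.Ico i (j + 1), φ l ω * ξ l ω) ∂P
        ≤ ∫ ω, (Y ω + t * (Y ω * φ j ω * ξ j ω) + (t ^ 2 * d ^ 2) * (Y ω * ξ j ω ^ 2)) ∂P :=
          integral_mono_of_nonneg (ae_of_all _ fun ω => (Real.exp_pos _).le)
            (i4.add (i3.const_mul _)) (ae_of_all _ hpt)
      _ = ∫ ω, Y ω ∂P + t * ∫ ω, Y ω * φ j ω * ξ j ω ∂P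
          + (t ^ 2 * d ^ 2) * ∫ ω, Y ω * ξ j ω ^ 2 ∂P := by
          rw [integral_add i4 (i3.const_mul _),
            integral_add i1 (i2.const_mul t), integral_const_mul, integral_const_mul]
      _ ≤ (∫ ω, Y ω ∂P) * (1 + t ^ 2 * (d ^ 2 * v)) := by
          rw [e2]
          have := mul_le_mul_of_nonneg_left e3 (by positivity : 0 ≤ t ^ 2 * d ^ 2)
          nlinarith
      _ ≤ Real.exp (j * (t ^ 2 * (d ^ 2 * v))) * Real.exp (t ^ 2 * (d ^ 2 * v)) := by
          refine mul_le_mul ih ?_ (by positivity) (Real.exp_pos _).le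
          linarith [Real.add_one_le_exp (t ^ 2 * (d ^ 2 * v))]
      _ = _ := by rw [← Real.exp_add]; push_cast; ring_nf

/-- Chernoff's bound for both tails, with t left free. -/
theorem measure_le_abs [IsProbabilityMeasure P] (H : PredictablyWeighted P 𝒢 φ ξ d c v) {t : ℝ} (ht0 : 0 ≤ t)
    (ht : t * (d * c) ≤ 1) (i j : ℕ) (x : ℝ) :
    P.real {ω | x ≤ |∑ l ∈ Finset.Ico i j, φ l ω * ξ l ω|}
      ≤ 2 * Real.exp (-t * x + j * (t ^ 2 * (d ^ 2 * v))) := by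
  set S : Ω → ℝ := fun ω => ∑ l ∈ Finset.Ico i j, φ l ω * ξ l ω with hS
  have hSm : Measurable S := (H.measurable_partialSum i j).mono (H.le j) le_rfl
  have hint : ∀ t : ℝ, Integrable (fun ω => Real.exp (t * S ω)) P := by
    intro t
    refine integrable_of_abs_le (Real.measurable_exp.comp (hSm.const_mul t))
      (c := Real.exp (|t| * ∑ _l ∈ Finset.Ico i j, d * c)) fun ω => ?_
    rw [Real.abs_exp]
    refine Real.exp_le_exp.2 ((le_abs_self _).trans ?_)
    rw [abs_mul]
    exact mul_le_mul_of_nonneg_left (H.abs_partialSum_le i j ω) (abs_nonneg _)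
  have h1 : P.real {ω | x ≤ S ω} ≤ Real.exp (-t * x + j * (t ^ 2 * (d ^ 2 * v))) := by
    refine (measure_ge_le_exp_mul_mgf x ht0 (hint t)).trans ?_
    rw [Real.exp_add]
    refine mul_le_mul_of_nonneg_left ?_ (Real.exp_pos _).le
    exact H.integral_exp_le (by rwa [abs_of_nonneg ht0]) i j
  have h2 : P.real {ω | S ω ≤ -x} ≤ Real.exp (-t * x + j * (t ^ 2 * (d ^ 2 * v))) := by
    refine (measure_le_le_exp_mul_mgf (-x) (neg_nonpos.2 ht0) (hint (-t))).trans ?_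
    rw [Real.exp_add, show - -t * -x = -t * x by ring]
    refine mul_le_mul_of_nonneg_left ?_ (Real.exp_pos _).le
    have := H.integral_exp_le (t := -t) (by rwa [abs_neg, abs_of_nonneg ht0]) i j
    rwa [neg_sq] at this
  have hsub : {ω | x ≤ |S ω|} ⊆ {ω | x ≤ S ω} ∪ {ω | S ω ≤ -x} := by
    intro ω hω
    rcases le_abs.1 (show x ≤ |S ω| from hω) with h | h
    · exact Or.inl h
    · exact Or.inr (show S ω ≤ -x by linarith)
  calc _ ≤ P.real ({ω | x ≤ S ω} ∪ {ω | S ω ≤ -x}) := measureReal_mono hsub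
    _ ≤ _ := (measureReal_union_le _ _).trans (by linarith)

end PredictablyWeighted

/-- A sequence of finite families of predictably weighted sums of polynomial size is almost
surely bounded by the standard rate. -/
theorem ae_eventually_abs_sum_le [IsProbabilityMeasure P] {ι : Type*} (I : ℕ → Finset ι) (k : ℕ)
    (hI : ∀ᶠ n in atTop, (I n).card ≤ n ^ k) (q : ℕ → ℝ) (hq : ∀ᶠ n in atTop, 0 < q n)
    (hq0 : Tendsto (fun n : ℕ => Real.log n / (n * q n)) atTop (nhds 0))
    (φ ξ : ℕ → ι → ℕ → Ω → ℝ) (i₀ : ℕ) (m : ℕ → ι → ℕ)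
    (hm : ∀ n, ∀ i ∈ I n, m n i ≤ n + 1) (𝒢 : ℕ → MeasurableSpace Ω) (d c v : ℝ)
    (hv : 0 ≤ v)
    (H : ∀ᶠ n in atTop, ∀ i ∈ I n, PredictablyWeighted P 𝒢 (φ n i) (ξ n i) d c (v * q n)) :
    ∀ᵐ ω ∂P, ∀ᶠ n : ℕ in atTop, ∀ i ∈ I n,
      |∑ l ∈ Finset.Ico i₀ (m n i), φ n i l ω * ξ n i l ω|
        ≤ (2 * d ^ 2 * v + k + 2) * √(n * q n * Real.log n) := by
  -- Take t = √(ln n / (n q)), admissible for large n by `hq0`. Then t times the threshold is A ln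
  -- n, and the second order term is at most 2 d² v ln n since m n i ≤ 2 n. The surplus k + 2 pays
  -- for the union over n ^ k indices and leaves the summable n⁻².
  set A : ℝ := 2 * d ^ 2 * v + k + 2 with hA
  have hA0 : 0 < A := by positivity
  have hsmall : ∀ᶠ n : ℕ in atTop, √(Real.log n / (n * q n)) * (d * c) ≤ 1 := by
    have h1 : Tendsto (fun n : ℕ => √(Real.log n / (n * q n)) * (d * c)) atTop (nhds 0) := by
      simpa using (hq0.sqrt).mul_const (d * c)
    exact (h1.eventually (gt_mem_nhds one_pos)).mono fun n hn => hn.le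
  obtain ⟨N, hN⟩ := eventually_atTop.1
    (hI.and (hq.and (H.and (hsmall.and (eventually_ge_atTop 2)))))
  set bad : ℕ → Set Ω := fun n => {ω | N ≤ n ∧ ∃ i ∈ I n,
    A * √(n * q n * Real.log n) ≤ |∑ l ∈ Finset.Ico i₀ (m n i), φ n i l ω * ξ n i l ω|} with hbad
  have hP : ∀ n, P.real (bad n) ≤ 2 * (1 / (n : ℝ) ^ 2) := by
    intro n
    by_cases hn : N ≤ n
    swap
    · have : bad n = ∅ := by
        ext ω; simp [hbad, hn]
      rw [this]
      simp
    obtain ⟨hcard, hqn, Hn, hs, hn2⟩ := hN n hn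
    have hn0 : (0 : ℝ) < n := by
      have : 0 < n := by omega
      exact_mod_cast this
    have hlog : 0 < Real.log n := Real.log_pos (by exact_mod_cast (by omega : 1 < n))
    have heach : ∀ i ∈ I n, P.real {ω | A * √(n * q n * Real.log n)
        ≤ |∑ l ∈ Finset.Ico i₀ (m n i), φ n i l ω * ξ n i l ω|} ≤ 2 * (1 / (n : ℝ) ^ (k + 2)) := by
      intro i hi
      refine ((Hn i hi).measure_le_abs (Real.sqrt_nonneg _) hs i₀ (m n i) _).trans ?_
      have e1 : √(Real.log n / (n * q n)) * √(n * q n * Real.log n) = Real.log n := by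
        rw [← Real.sqrt_mul (by positivity)]
        rw [show Real.log n / (n * q n) * (n * q n * Real.log n) = Real.log n ^ 2 by
          field_simp]
        exact Real.sqrt_sq hlog.le
      have e2 : √(Real.log n / (n * q n)) ^ 2 = Real.log n / (n * q n) :=
        Real.sq_sqrt (by positivity)
      have e3 : (m n i : ℝ) ≤ 2 * n := by
        have h1 : m n i ≤ n + 1 := hm n i hi
        have h2 : m n i ≤ 2 * n := by omega
        exact_mod_cast h2
      have e4 : -√(Real.log n / (n * q n)) * (A * √(n * q n * Real.log n))
          + m n i * (√(Real.log n / (n * q n)) ^ 2 * (d ^ 2 * (v * q n)))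
          ≤ -((k + 2 : ℕ) * Real.log n) := by
        have h1 : m n i * (√(Real.log n / (n * q n)) ^ 2 * (d ^ 2 * (v * q n)))
            ≤ 2 * n * (Real.log n / (n * q n) * (d ^ 2 * (v * q n))) := by
          rw [e2]
          exact mul_le_mul_of_nonneg_right e3 (by positivity)
        have h2 : 2 * n * (Real.log n / (n * q n) * (d ^ 2 * (v * q n)))
            = 2 * d ^ 2 * v * Real.log n := by
          field_simp
        have h3 : -√(Real.log n / (n * q n)) * (A * √(n * q n * Real.log n))
            = -(A * Real.log n) := by
          linear_combination (-A) * e1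
        rw [h3]
        push_cast
        rw [hA]
        nlinarith
      have e5 : Real.exp (-((k + 2 : ℕ) * Real.log n)) = 1 / (n : ℝ) ^ (k + 2) := by
        rw [Real.exp_neg, Real.exp_nat_mul, Real.exp_log hn0, one_div]
      rw [← e5]
      exact mul_le_mul_of_nonneg_left (Real.exp_le_exp.2 e4) (by norm_num)
    have hsub : bad n ⊆ ⋃ i ∈ I n, {ω | A * √(n * q n * Real.log n)
        ≤ |∑ l ∈ Finset.Ico i₀ (m n i), φ n i l ω * ξ n i l ω|} := by
      rintro ω ⟨-, i, hi, h⟩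
      exact Set.mem_biUnion hi h
    calc P.real (bad n) ≤ P.real (⋃ i ∈ I n, {ω | A * √(n * q n * Real.log n)
          ≤ |∑ l ∈ Finset.Ico i₀ (m n i), φ n i l ω * ξ n i l ω|})  :=
          measureReal_mono hsub (measure_ne_top P _)
      _ ≤ ∑ i ∈ I n, P.real {ω | A * √(n * q n * Real.log n)
          ≤ |∑ l ∈ Finset.Ico i₀ (m n i), φ n i l ω * ξ n i l ω|} :=
          measureReal_biUnion_finset_le _ _
      _ ≤ (I n).card • (2 * (1 / (n : ℝ) ^ (k + 2))) := Finset.sum_le_card_nsmul _ _ _ heach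
      _ ≤ (n : ℝ) ^ k * (2 * (1 / (n : ℝ) ^ (k + 2))) := by
          rw [nsmul_eq_mul]
          exact mul_le_mul_of_nonneg_right (by exact_mod_cast hcard) (by positivity)
      _ = 2 * (1 / (n : ℝ) ^ 2) := by
          rw [pow_add]; field_simp
  have hsum : Summable fun n => P.real (bad n) :=
    Summable.of_nonneg_of_le (fun n => measureReal_nonneg) hP
      ((Real.summable_one_div_nat_pow.2 one_lt_two).mul_left 2)
  have hfin : ∑' n, P (bad n) ≠ ⊤ := by
    have h1 : ∀ n, P (bad n) = ENNReal.ofReal (P.real (bad n)) := fun n =>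
      (ofReal_measureReal (measure_ne_top P _)).symm
    simp_rw [h1]
    exact hsum.tsum_ofReal_ne_top
  filter_upwards [ae_eventually_notMem hfin] with ω hω
  filter_upwards [hω, eventually_ge_atTop N] with n hn hNn i hi
  by_contra hcon
  exact hn ⟨hNn, i, hi, (not_le.1 hcon).le⟩

end Concentration


/-! ### Kernels -/

lemma tendsto_integral_tail {k : ℝ → ℝ} (hk : Integrable k) :
    Tendsto (fun R : ℝ => ∫ u in {u : ℝ | R < |u|}, |k u|) atTop (nhds 0) := by
  have h := tendsto_setIntegral_of_antitone (μ := volume) (f := fun u => |k u|)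
    (s := fun R : ℝ => {u : ℝ | R < |u|}) (fun R => measurableSet_lt measurable_const
      measurable_norm) (fun R R' hR u hu => lt_of_le_of_lt hR hu) ⟨0, hk.abs.integrableOn⟩
  have hempty : ⋂ R : ℝ, {u : ℝ | R < |u|} = ∅ := by
    ext u
    simp only [Set.mem_iInter, Set.mem_ofPred_eq, Set.mem_empty_iff_false, iff_false, not_forall,
      not_lt]
    exact ⟨|u|, le_rfl⟩
  rwa [hempty, setIntegral_empty] at h

lemma abs_setIntegral_le_tail {k : ℝ → ℝ} (hk : Integrable k) {R : ℝ} {s : Set ℝ}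
    (hs : s ⊆ {u : ℝ | R < |u|}) :
    |∫ u in s, k u| ≤ ∫ u in {u : ℝ | R < |u|}, |k u| :=
  (abs_integral_le_integral_abs).trans
    (setIntegral_mono_set hk.abs.integrableOn (ae_of_all _ fun u => abs_nonneg _)
      hs.eventuallyLE)

/-- The half-line integral is continuous in c and tends to 1, so for c ≥ 0 it is either at least 1/2
or bounded below by its minimum over a compact interval. Uniformity in c matters because c will be
the distance to an edge divided by h. -/
lemma exists_pos_le_integral_Iic {k : ℝ → ℝ} (hk : Integrable k) (h1 : ∫ u, k u = 1)
    (hpos : ∀ c : ℝ, 0 ≤ c → 0 < ∫ u in Set.Iic c, k u) :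
    ∃ κ > 0, ∀ c : ℝ, 0 ≤ c → κ ≤ ∫ u in Set.Iic c, k u := by
  have hcont : Continuous fun c : ℝ => ∫ u in Set.Iic c, k u := by
    have h2 : (fun c : ℝ => ∫ u in Set.Iic c, k u)
        = fun c => (∫ u in (0 : ℝ)..c, k u) + ∫ u in Set.Iic (0 : ℝ), k u := by
      ext c
      rw [← intervalIntegral.integral_Iic_sub_Iic hk.integrableOn hk.integrableOn]
      ring
    rw [h2]
    exact (hk.continuous_primitive 0).add continuous_const
  have hlim : Tendsto (fun c : ℝ => ∫ u in Set.Iic c, k u) atTop (nhds 1) := by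
    rw [← h1]
    exact (aecover_Iic tendsto_id).integral_tendsto_of_countably_generated hk
  obtain ⟨R, hR⟩ := eventually_atTop.1
    (hlim.eventually (lt_mem_nhds (by norm_num : (1 / 2 : ℝ) < 1)))
  obtain ⟨c₀, hc₀, hmin⟩ := (isCompact_Icc (a := (0 : ℝ)) (b := max R 0)).exists_isMinOn
    ⟨0, by simp⟩ hcont.continuousOn
  refine ⟨min (1 / 2) (∫ u in Set.Iic c₀, k u), lt_min (by norm_num) (hpos c₀ hc₀.1),
    fun c hc => ?_⟩
  rcases le_total R c with h | h
  · exact (min_le_left _ _).trans (hR c h).le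
  · exact (min_le_right _ _).trans (hmin ⟨hc, h.trans (le_max_left _ _)⟩)

lemma exists_pos_le_integral_Ici {k : ℝ → ℝ} (hk : Integrable k) (h1 : ∫ u, k u = 1)
    (hpos : ∀ c : ℝ, c ≤ 0 → 0 < ∫ u in Set.Ici c, k u) :
    ∃ κ > 0, ∀ c : ℝ, c ≤ 0 → κ ≤ ∫ u in Set.Ici c, k u := by
  have hneg : ∀ c : ℝ, ∫ u in Set.Iic c, k (-u) = ∫ u in Set.Ici (-c), k u := fun c => by
    rw [integral_comp_neg_Iic, integral_Ici_eq_integral_Ioi]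
  obtain ⟨κ, hκ, h⟩ := exists_pos_le_integral_Iic (k := fun u => k (-u)) hk.comp_neg
    (by rw [integral_neg_eq_self k volume, h1]) fun c hc => by
      rw [hneg]; exact hpos _ (by linarith)
  refine ⟨κ, hκ, fun c hc => ?_⟩
  have := h (-c) (by linarith)
  rwa [hneg, neg_neg] at this

/-- Average |k x| ≤ |k y| + L over y in an interval of length one. -/
lemma abs_le_of_lipschitz_integrable {k : ℝ → ℝ} {L : ℝ≥0} (hL : LipschitzWith L k)
    (hk : Integrable k) (x : ℝ) : |k x| ≤ (∫ u, |k u|) + L := by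
  have h1 : ∀ y ∈ Set.Icc x (x + 1), |k x| ≤ |k y| + L := by
    intro y hy
    have h2 := hL.dist_le_mul x y
    rw [Real.dist_eq, Real.dist_eq] at h2
    have h3 : |x - y| ≤ 1 := by rw [abs_le]; constructor <;> linarith [hy.1, hy.2]
    have h4 : |k x| ≤ |k x - k y| + |k y| := by
      simpa using abs_add_le (k x - k y) (k y)
    nlinarith [L.2, abs_nonneg (x - y)]
  have hvol : volume.real (Set.Icc x (x + 1)) = 1 := by
    rw [Real.volume_real_Icc_of_le (by linarith)]; ring
  calc |k x| = ∫ _y in Set.Icc x (x + 1), |k x| := by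
        rw [setIntegral_const, hvol, one_smul]
    _ ≤ ∫ y in Set.Icc x (x + 1), (|k y| + L) := by
        refine setIntegral_mono_on (integrableOn_const (by simp)) ?_ measurableSet_Icc h1
        exact hk.abs.integrableOn.add (integrableOn_const (by simp))
    _ = (∫ y in Set.Icc x (x + 1), |k y|) + L := by
        rw [integral_add hk.abs.integrableOn (integrableOn_const (by simp)),
          setIntegral_const, hvol, one_smul]
    _ ≤ _ := by
        have := setIntegral_le_integral (s := Set.Icc x (x + 1)) hk.abs
          (ae_of_all _ fun u => abs_nonneg (k u))
        linarith

lemma integrable_sq_of_abs_le {k : ℝ → ℝ} (hk : Integrable k) {c : ℝ} (hc : ∀ x, |k x| ≤ c) :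
    Integrable fun u => k u ^ 2 := by
  have := hk.bdd_mul (f := k) hk.aestronglyMeasurable (ae_of_all _ hc)
  simpa [sq] using this

lemma integral_comp_sub_div (F : ℝ → ℝ) (x : ℝ) {h : ℝ} (hh : 0 < h) :
    ∫ y, F ((x - y) / h) = h * ∫ u, F u := by
  rw [integral_sub_left_eq_self (fun y => F (y / h)) volume x, Measure.integral_comp_div,
    abs_of_pos hh, smul_eq_mul]

/-! ### Densities on a compact interval and their smoothing -/

/-- `f` is a probability density that is continuous and positive on `[-m, m]` and vanishes
outside. -/
structure IsIntervalDensity (f : ℝ → ℝ) (m : ℝ) : Prop where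
  m_pos : 0 < m
  measurable : Measurable f
  pos : ∀ x ∈ Set.Icc (-m) m, 0 < f x
  eq_zero : ∀ x ∉ Set.Icc (-m) m, f x = 0
  continuousOn : ContinuousOn f (Set.Icc (-m) m)
  integral_eq_one : ∫ x, f x = 1

/-- The kernel smoothing `∫ k(u) f(y - h u) du` of `f` at the point `y`. -/
noncomputable def smoothing (k f : ℝ → ℝ) (h y : ℝ) : ℝ := ∫ u, k u * f (y - h * u)

namespace IsIntervalDensity

variable {f : ℝ → ℝ} {m : ℝ}

lemma nonneg (hf : IsIntervalDensity f m) (x : ℝ) : 0 ≤ f x := by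
  by_cases hx : x ∈ Set.Icc (-m) m
  · exact (hf.pos x hx).le
  · rw [hf.eq_zero x hx]

lemma exists_le (hf : IsIntervalDensity f m) : ∃ M > 0, ∀ x, f x ≤ M := by
  obtain ⟨C, hC⟩ := isCompact_Icc.exists_bound_of_continuousOn hf.continuousOn
  refine ⟨max C 1, by positivity, fun x => ?_⟩
  by_cases hx : x ∈ Set.Icc (-m) m
  · exact (le_abs_self _).trans ((hC x hx).trans (le_max_left _ _))
  · rw [hf.eq_zero x hx]; positivity

lemma integrable (hf : IsIntervalDensity f m) : Integrable f := by
  by_contra h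
  have := hf.integral_eq_one
  rw [integral_undef h] at this
  exact zero_ne_one this

/-- The restriction of `f` to `[-m, m]` is uniformly continuous: with `f̃` its extension by
constants, `f` is the product of `f̃` and an indicator function. -/
lemma exists_extension (hf : IsIntervalDensity f m) :
    ∃ F : ℝ → ℝ, UniformContinuous F ∧ (∀ x, F x ∈ f '' Set.Icc (-m) m) ∧
      ∀ x ∈ Set.Icc (-m) m, F x = f x := by
  have hle : -m ≤ m := by linarith [hf.m_pos]
  refine ⟨fun x => f (Set.projIcc (-m) m hle x), ?_, fun x => ?_, fun x hx => ?_⟩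
  · have h1 : UniformContinuous fun z : Set.Icc (-m) m => f z :=
      CompactSpace.uniformContinuous_of_continuous
        (continuousOn_iff_continuous_domRestrict.1 hf.continuousOn)
    exact h1.comp (LipschitzWith.projIcc hle).uniformContinuous
  · exact ⟨_, (Set.projIcc (-m) m hle x).2, rfl⟩
  · simp only [Set.projIcc_of_mem hle hx]

lemma integrable_mul_comp (hf : IsIntervalDensity f m) {k : ℝ → ℝ} (hk : Integrable k)
    (h y : ℝ) : Integrable fun u => k u * f (y - h * u) := by
  obtain ⟨M, hM, hfM⟩ := hf.exists_le
  have := hk.bdd_mul (f := fun u => f (y - h * u)) (c := M)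
    (hf.measurable.comp (by fun_prop)).aestronglyMeasurable
    (ae_of_all _ fun u => by
      rw [Real.norm_eq_abs, abs_of_nonneg (hf.nonneg _)]; exact hfM _)
  simpa [mul_comm] using this

lemma abs_smoothing_le (hf : IsIntervalDensity f m) {k : ℝ → ℝ} (hk : Integrable k) {M : ℝ}
    (hM : ∀ x, f x ≤ M) (h y : ℝ) : |smoothing k f h y| ≤ M * ∫ u, |k u| := by
  rw [← integral_const_mul]
  refine (abs_integral_le_integral_abs).trans ?_
  refine integral_mono (hf.integrable_mul_comp hk h y).abs (hk.abs.const_mul M) fun u => ?_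
  simp only [abs_mul, abs_of_nonneg (hf.nonneg _)]
  rw [mul_comm]
  exact mul_le_mul_of_nonneg_right (hM _) (abs_nonneg _)

lemma measurable_smoothing (hf : IsIntervalDensity f m) {k : ℝ → ℝ} (hk : Measurable k) (h : ℝ) :
    Measurable (smoothing k f h) := by
  refine (StronglyMeasurable.integral_prod_right (f := fun y u => k u * f (y - h * u))
    ?_).measurable
  apply Measurable.stronglyMeasurable
  exact (hk.comp measurable_snd).mul (hf.measurable.comp (by fun_prop))

lemma integral_comp_mul_density {k : ℝ → ℝ} (f : ℝ → ℝ) (x : ℝ) {h : ℝ} (hh : 0 < h) :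
    ∫ y, k ((x - y) / h) * f y = h * smoothing k f h x := by
  rw [smoothing, ← integral_comp_sub_div _ x hh]
  congr 1
  ext y
  rw [mul_div_cancel₀ _ hh.ne', sub_sub_cancel]

lemma integral_comp_mul_density_le (hf : IsIntervalDensity f m) {k : ℝ → ℝ} (hk : Integrable k)
    (hk0 : ∀ u, 0 ≤ k u) {M : ℝ} (hM : ∀ x, f x ≤ M) (x : ℝ) {h : ℝ} (hh : 0 < h) :
    ∫ y, k ((x - y) / h) * f y ≤ h * (M * ∫ u, k u) := by
  rw [integral_comp_mul_density f x hh]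
  refine mul_le_mul_of_nonneg_left ?_ hh.le
  have := hf.abs_smoothing_le hk hM h x
  simp only [abs_of_nonneg (hk0 _)] at this
  exact (le_abs_self _).trans this

/-- Away from the two edges f is continuous, and dominated convergence applies. At an edge f jumps,
and in general only a part of the kernel mass would count. -/
lemma tendsto_smoothing (hf : IsIntervalDensity f m) {k : ℝ → ℝ} (hk : Integrable k)
    (hk1 : ∫ u, k u = 1) {h : ℕ → ℝ} (hh : Tendsto h atTop (nhds 0)) {y : ℝ} (hy : y ≠ m)
    (hy' : y ≠ -m) : Tendsto (fun n => smoothing k f (h n) y) atTop (nhds (f y)) := by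
  have hcont : ContinuousAt f y := by
    by_cases hym : y ∈ Set.Icc (-m) m
    · exact hf.continuousOn.continuousAt (Icc_mem_nhds (lt_of_le_of_ne hym.1 hy'.symm)
        (lt_of_le_of_ne hym.2 hy))
    · have h1 : (Set.Icc (-m) m)ᶜ ∈ nhds y := isClosed_Icc.isOpen_compl.mem_nhds hym
      refine ContinuousAt.congr (f := fun _ => (0 : ℝ)) continuousAt_const ?_
      filter_upwards [h1] with z hz
      exact (hf.eq_zero z hz).symm
  obtain ⟨M, hM, hfM⟩ := hf.exists_le
  have hlim := tendsto_integral_filter_of_dominated_convergence (μ := volume) (l := atTop)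
    (F := fun n u => k u * f (y - h n * u)) (f := fun u => k u * f y) (fun u => M * |k u|)
    (Eventually.of_forall fun n => (hf.integrable_mul_comp hk (h n) y).aestronglyMeasurable)
    (Eventually.of_forall fun n => ae_of_all _ fun u => by
      rw [norm_mul, Real.norm_eq_abs, Real.norm_eq_abs, abs_of_nonneg (hf.nonneg _), mul_comm]
      exact mul_le_mul_of_nonneg_right (hfM _) (abs_nonneg _))
    (hk.abs.const_mul M)
    (ae_of_all _ fun u => by
      have h2 : Tendsto (fun n => y - h n * u) atTop (nhds y) := by
        simpa using tendsto_const_nhds.sub (hh.mul_const u)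
      exact (hcont.tendsto.comp h2).const_mul (k u))
  rwa [integral_mul_const, hk1, one_mul] at hlim

/-- Up to a uniformly small error, the smoothing at `y` is the value of `f` at the nearest point
of `[-m, m]` times a half-line integral of the kernel. -/
lemma exists_smoothing_approx (hf : IsIntervalDensity f m) {K : ℝ → ℝ} (hK : Integrable K)
    {δ : ℝ} (hδ : 0 < δ) :
    ∃ h₀ > 0, ∀ h, 0 < h → h < h₀ → ∀ y, ∃ F ∈ f '' Set.Icc (-m) m, ∃ c : ℝ,
      (y ≤ m → c ≤ 0) ∧ F * (∫ u in Set.Ici c, K u) - δ ≤ smoothing K f h y ∨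
      (-m ≤ y → 0 ≤ c) ∧ F * (∫ u in Set.Iic c, K u) - δ ≤ smoothing K f h y := by
  obtain ⟨M, hM, hfM⟩ := hf.exists_le
  obtain ⟨F, hFu, hFmem, hFeq⟩ := hf.exists_extension
  have hF0 : ∀ x, 0 ≤ F x := fun x => by
    obtain ⟨z, -, hz⟩ := hFmem x; rw [← hz]; exact hf.nonneg z
  have hFM : ∀ x, F x ≤ M := fun x => by
    obtain ⟨z, -, hz⟩ := hFmem x; rw [← hz]; exact hfM z
  set J := ∫ u, |K u| with hJ
  have hJ0 : 0 ≤ J := integral_nonneg fun u => abs_nonneg _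
  -- The errors are J τ from the oscillation of the extension, 2 M τ from the kernel tail, and M τ
  -- from replacing the interval S by a half-line.
  set τ := δ / (J + 3 * M + 1) with hτ
  have hτ0 : 0 < τ := by positivity
  obtain ⟨R, hR, hR0⟩ := ((tendsto_integral_tail hK).eventually (gt_mem_nhds hτ0)
    |>.and (eventually_gt_atTop 0)).exists
  obtain ⟨r, hr0, hr⟩ := Metric.uniformContinuous_iff.1 hFu τ hτ0
  -- The condition h R < r controls the oscillation over |u| ≤ R; h R < m puts the edge farther from
  -- y outside this window.
  refine ⟨min (r / (R + 1)) (m / (R + 1)), lt_min (by positivity)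
    (div_pos hf.m_pos (by positivity)), fun h hh0 hh y => ?_⟩
  have hhr : h * R < r := by
    have h1 := hh.trans_le (min_le_left _ _)
    rw [lt_div_iff₀ (by positivity)] at h1
    nlinarith
  have hhm : h * R < m := by
    have h1 := hh.trans_le (min_le_right _ _)
    rw [lt_div_iff₀ (by positivity)] at h1
    nlinarith
  set S : Set ℝ := Set.Icc ((y - m) / h) ((y + m) / h) with hS
  have hmem : ∀ u, y - h * u ∈ Set.Icc (-m) m ↔ u ∈ S := by
    intro u
    rw [hS, Set.mem_Icc, Set.mem_Icc, div_le_iff₀ hh0, le_div_iff₀ hh0]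
    constructor <;> rintro ⟨h1, h2⟩ <;> constructor <;> linarith
  have hKf : ∀ u, K u * f (y - h * u) = S.indicator (fun u => K u * F (y - h * u)) u := by
    intro u
    by_cases hu : u ∈ S
    · rw [Set.indicator_of_mem hu, hFeq _ ((hmem u).2 hu)]
    · rw [Set.indicator_of_notMem hu, hf.eq_zero _ fun h => hu ((hmem u).1 h), mul_zero]
  have hsm : smoothing K f h y = ∫ u in S, K u * F (y - h * u) := by
    rw [smoothing, ← integral_indicator measurableSet_Icc]
    exact integral_congr_ae (ae_of_all _ hKf)
  have htail : MeasurableSet {u : ℝ | R < |u|} := measurableSet_lt measurable_const measurable_norm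
  have hint1 : Integrable fun u => K u * F (y - h * u) := by
    have := hK.bdd_mul (f := fun u => F (y - h * u)) (c := M)
      (hFu.continuous.comp (by fun_prop)).aestronglyMeasurable
      (ae_of_all _ fun u => by rw [Real.norm_eq_abs, abs_of_nonneg (hF0 _)]; exact hFM _)
    simpa [mul_comm] using this
  have herr : |smoothing K f h y - F y * ∫ u in S, K u| ≤ J * τ + 2 * M * τ := by
    rw [hsm, ← integral_const_mul, ← integral_sub hint1.integrableOn
      (hK.const_mul _).integrableOn]
    refine (abs_integral_le_integral_abs).trans ?_
    have hb : Integrable fun u => τ * |K u| + 2 * M * ({u : ℝ | R < |u|}.indicator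
        (fun u => |K u|) u) :=
      (hK.abs.const_mul τ).add ((hK.abs.indicator htail).const_mul _)
    calc ∫ u in S, |K u * F (y - h * u) - F y * K u|
        ≤ ∫ u in S, (τ * |K u| + 2 * M * ({u : ℝ | R < |u|}.indicator (fun u => |K u|) u)) := by
          refine integral_mono (hint1.sub (hK.const_mul _)).abs.integrableOn hb.integrableOn
            fun u => ?_
          have h1 : |K u * F (y - h * u) - F y * K u| = |F (y - h * u) - F y| * |K u| := by
            rw [← abs_mul]; congr 1; ring
          simp only [h1]
          by_cases hu : R < |u|
          · rw [Set.indicator_of_mem (show u ∈ {u : ℝ | R < |u|} from hu)]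
            have h2 : |F (y - h * u) - F y| ≤ 2 * M := by
              rw [abs_le]
              constructor <;> linarith [hF0 (y - h * u), hFM (y - h * u), hF0 y, hFM y]
            nlinarith [abs_nonneg (K u)]
          · rw [Set.indicator_of_notMem (show u ∉ {u : ℝ | R < |u|} from hu), mul_zero, add_zero]
            refine mul_le_mul_of_nonneg_right ?_ (abs_nonneg _)
            have h2 : dist (y - h * u) y < r := by
              rw [Real.dist_eq, show y - h * u - y = -(h * u) by ring, abs_neg, abs_mul,
                abs_of_pos hh0]
              exact (mul_le_mul_of_nonneg_left (not_lt.1 hu) hh0.le).trans_lt hhr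
            exact (hr h2).le
      _ ≤ ∫ u, (τ * |K u| + 2 * M * ({u : ℝ | R < |u|}.indicator (fun u => |K u|) u)) := by
          refine setIntegral_le_integral hb (ae_of_all _ fun u => ?_)
          have : 0 ≤ {u : ℝ | R < |u|}.indicator (fun u => |K u|) u :=
            Set.indicator_nonneg (fun _ _ => abs_nonneg _) _
          simp only [Pi.zero_apply]
          positivity
      _ = τ * J + 2 * M * ∫ u in {u : ℝ | R < |u|}, |K u| := by
          rw [integral_add (hK.abs.const_mul τ) ((hK.abs.indicator htail).const_mul _),
            integral_const_mul, integral_const_mul, integral_indicator htail]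
      _ ≤ J * τ + 2 * M * τ := by nlinarith
  have hδτ : J * τ + 3 * M * τ + τ = δ := by
    rw [hτ]; field_simp
  have hlow := (abs_le.1 herr).1
  refine ⟨F y, hFmem y, ?_⟩
  have hFτ : F y * τ ≤ M * τ := mul_le_mul_of_nonneg_right (hFM y) hτ0.le
  -- For y ≥ 0 the left edge is at distance at least m, more than R on the scale h, so only the
  -- right edge cuts the kernel. Since u runs against y - h u, what is left is [(y - m)/h, ∞). For y
  -- ≤ 0 the roles are exchanged.
  rcases le_total 0 y with hy | hy
  · refine ⟨(y - m) / h, Or.inl ⟨fun hym => div_nonpos_of_nonpos_of_nonneg (by linarith) hh0.le,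
      ?_⟩⟩
    have hSd : S = Set.Ici ((y - m) / h) \ Set.Ioi ((y + m) / h) := by
      ext u; simp [hS]
    have hsub : Set.Ioi ((y + m) / h) ⊆ {u : ℝ | R < |u|} := by
      intro u hu
      have h1 : R < (y + m) / h := by rw [lt_div_iff₀ hh0]; linarith
      exact (h1.trans hu).trans_le (le_abs_self u)
    have hI : ∫ u in S, K u = (∫ u in Set.Ici ((y - m) / h), K u)
        - ∫ u in Set.Ioi ((y + m) / h), K u := by
      rw [hSd, setIntegral_sdiff measurableSet_Ioi hK.integrableOn]
      intro u hu
      have : (y - m) / h ≤ (y + m) / h := by gcongr; linarith [hf.m_pos]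
      exact this.trans (le_of_lt hu)
    have htl := (abs_le.1 ((abs_setIntegral_le_tail hK hsub).trans hR.le)).2
    rw [hI] at hlow
    nlinarith [mul_le_mul_of_nonneg_left htl (hF0 y)]
  · refine ⟨(y + m) / h, Or.inr ⟨fun hym => div_nonneg (by linarith) hh0.le, ?_⟩⟩
    have hSd : S = Set.Iic ((y + m) / h) \ Set.Iio ((y - m) / h) := by
      ext u; simp [hS, and_comm]
    have hsub : Set.Iio ((y - m) / h) ⊆ {u : ℝ | R < |u|} := by
      intro u hu
      have h1 : (y - m) / h < -R := by rw [div_lt_iff₀ hh0]; linarith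
      have h2 : u < -R := lt_trans hu h1
      exact (by linarith : R < -u).trans_le (neg_le_abs u)
    have hI : ∫ u in S, K u = (∫ u in Set.Iic ((y + m) / h), K u)
        - ∫ u in Set.Iio ((y - m) / h), K u := by
      rw [hSd, setIntegral_sdiff measurableSet_Iio hK.integrableOn]
      intro u hu
      have : (y - m) / h ≤ (y + m) / h := by gcongr; linarith [hf.m_pos]
      exact (le_of_lt hu).trans this
    have htl := (abs_le.1 ((abs_setIntegral_le_tail hK hsub).trans hR.le)).2
    rw [hI] at hlow
    nlinarith [mul_le_mul_of_nonneg_left htl (hF0 y)]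

/-- By `exists_smoothing_approx` the sign of the smoothing is that of a half-line integral of K, up
to a small error. On [-m, m] the half-line contains 0, so its integral is bounded away from zero. As
κ is chosen before δ, the negative part can later be made a small fraction of κ. -/
theorem exists_smoothing_lower_bound (hf : IsIntervalDensity f m) {K : ℝ → ℝ} {γ : ℝ≥0}
    (hK : IsKernel K γ) :
    ∃ κ > 0, ∀ δ > 0, ∃ h₀ > 0, ∀ h, 0 < h → h < h₀ →
      (∀ y, -δ ≤ smoothing K f h y) ∧ ∀ y ∈ Set.Icc (-m) m, κ ≤ smoothing K f h y := by
  obtain ⟨κ₁, hκ₁, hr⟩ := exists_pos_le_integral_Ici hK.integrable hK.integral_eq_one hK.right_pos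
  obtain ⟨κ₂, hκ₂, hl⟩ := exists_pos_le_integral_Iic hK.integrable hK.integral_eq_one hK.left_pos
  obtain ⟨z, hz, hzmin⟩ := isCompact_Icc.exists_isMinOn
    (⟨0, by constructor <;> linarith [hf.m_pos]⟩ : (Set.Icc (-m) m).Nonempty) hf.continuousOn
  have hfz := hf.pos z hz
  set κ := f z * min κ₁ κ₂ with hκ
  have hκ0 : 0 < κ := mul_pos hfz (lt_min hκ₁ hκ₂)
  refine ⟨κ / 2, by positivity, fun δ hδ => ?_⟩
  obtain ⟨h₀, hh₀, H⟩ := hf.exists_smoothing_approx hK.integrable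
    (lt_min hδ (half_pos hκ0))
  refine ⟨h₀, hh₀, fun h hh hlt => ⟨fun y => ?_, fun y hy => ?_⟩⟩
  · obtain ⟨F, ⟨w, hw, rfl⟩, c, ⟨-, hc⟩ | ⟨-, hc⟩⟩ := H h hh hlt y
    · have := mul_nonneg (hf.nonneg w) (hK.right_nonneg c)
      linarith [min_le_left δ (κ / 2)]
    · have := mul_nonneg (hf.nonneg w) (hK.left_nonneg c)
      linarith [min_le_left δ (κ / 2)]
  · have hmul : ∀ w ∈ Set.Icc (-m) m, ∀ I, min κ₁ κ₂ ≤ I → κ ≤ f w * I := fun w hw I hI =>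
      mul_le_mul (hzmin hw) hI (lt_min hκ₁ hκ₂).le (hf.nonneg w)
    obtain ⟨F, ⟨w, hw, rfl⟩, c, ⟨h1, hc⟩ | ⟨h1, hc⟩⟩ := H h hh hlt y
    · have := hmul w hw _ ((min_le_left _ _).trans (hr c (h1 hy.2)))
      linarith [min_le_right δ (κ / 2)]
    · have := hmul w hw _ ((min_le_right _ _).trans (hl c (h1 hy.1)))
      linarith [min_le_right δ (κ / 2)]

end IsIntervalDensity


/-! ### Bandwidths -/

/-- The properties of the bandwidth that are used: `h_n → 0` and `n h_n / ln n → ∞`. -/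
structure IsBandwidth (h : ℕ → ℝ) : Prop where
  pos : ∀ᶠ n in atTop, 0 < h n
  tendsto_zero : Tendsto h atTop (nhds 0)
  log_div : Tendsto (fun n : ℕ => Real.log n / (n * h n)) atTop (nhds 0)

lemma eventually_one_le_log : ∀ᶠ n : ℕ in atTop, 1 ≤ Real.log n :=
  (Real.tendsto_log_atTop.comp tendsto_natCast_atTop_atTop).eventually_ge_atTop 1

lemma IsBandwidth.one_le_mul {h : ℕ → ℝ} (hh : IsBandwidth h) :
    ∀ᶠ n : ℕ in atTop, 1 ≤ n * h n := by
  filter_upwards [hh.pos, hh.log_div.eventually (gt_mem_nhds one_pos), eventually_one_le_log,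
    eventually_gt_atTop 0] with n h1 h2 h3 h4
  have h5 : (0 : ℝ) < n := by exact_mod_cast h4
  rw [div_lt_one (by positivity)] at h2
  linarith

lemma IsBandwidth.sqrt_eq {h : ℕ → ℝ} (hh : IsBandwidth h) :
    ∀ᶠ n : ℕ in atTop,
      √(n * h n * Real.log n) = n * h n * √(Real.log n / (n * h n)) := by
  filter_upwards [hh.pos, eventually_gt_atTop 0] with n h1 h4
  have h5 : (0 : ℝ) < n := by exact_mod_cast h4
  have h6 : 0 < n * h n := by positivity
  rw [show n * h n * Real.log n = (n * h n) ^ 2 * (Real.log n / (n * h n)) by field_simp,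
    Real.sqrt_mul (by positivity), Real.sqrt_sq h6.le]

/-- The logarithmic factors are negligible against powers of n: β₁ < 0 gives h_n → 0, and -1 < β₁
gives n h_n / ln n → ∞. -/
lemma isBandwidth_of_isEquivalent {h : ℕ → ℝ} {β₁ β₂ : ℝ} (hβ₁ : -1 < β₁ ∧ β₁ < 0)
    (hh : h ~[atTop] fun n : ℕ => (n : ℝ) ^ β₁ * Real.log n ^ β₂) : IsBandwidth h := by
  set v : ℕ → ℝ := fun n : ℕ => (n : ℝ) ^ β₁ * Real.log n ^ β₂ with hv
  have hvpos : ∀ᶠ n : ℕ in atTop, 0 < v n := by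
    filter_upwards [eventually_one_le_log, eventually_gt_atTop 0] with n h1 h2
    have h3 : (0 : ℝ) < n := by exact_mod_cast h2
    have h4 : 0 < Real.log n := by linarith
    positivity
  have hratio : ∀ r s : ℝ, 0 < s →
      Tendsto (fun n : ℕ => Real.log n ^ r / (n : ℝ) ^ s) atTop (nhds 0) := fun r s hs =>
    ((isLittleO_log_rpow_rpow_atTop r hs).tendsto_div_nhds_zero).comp
      tendsto_natCast_atTop_atTop
  have hpos : ∀ᶠ n in atTop, 0 < h n := by
    obtain ⟨u, hu, hhu⟩ := hh.exists_eq_mul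
    filter_upwards [hhu, hvpos, hu.eventually (lt_mem_nhds one_pos)] with n h1 h2 h3
    rw [h1]
    exact mul_pos h3 h2
  refine ⟨hpos, ?_, ?_⟩
  · refine (hh.symm.tendsto_nhds (c := 0) ?_)
    refine (hratio β₂ (-β₁) (by linarith)).congr' ?_
    filter_upwards [eventually_gt_atTop 0] with n h2
    have h3 : (0 : ℝ) < n := by exact_mod_cast h2
    rw [hv]
    simp only
    rw [Real.rpow_neg h3.le, div_inv_eq_mul, mul_comm]
  · have he : (fun n : ℕ => Real.log n / (n * h n)) ~[atTop]
        fun n : ℕ => Real.log n / (n * v n) :=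
      IsEquivalent.refl.div (IsEquivalent.refl.mul hh)
    refine he.symm.tendsto_nhds ?_
    refine (hratio (1 - β₂) (1 + β₁) (by linarith)).congr' ?_
    filter_upwards [eventually_one_le_log, eventually_gt_atTop 0] with n h1 h2
    have h3 : (0 : ℝ) < n := by exact_mod_cast h2
    have h4 : 0 < Real.log n := by linarith
    rw [hv, Real.rpow_sub h4, Real.rpow_add h3, Real.rpow_one, Real.rpow_one]
    field_simp

/-! ### The model with bounded inputs -/

/-- Independent pairs `(η n, ε n)` with independent bounded components; `η n` has the density `f`
on `[-m, m]`, and `ε n` is centered with unit variance. -/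
structure BoundedModel {Ω : Type*} [MeasurableSpace Ω] (P : Measure Ω) (η ε : ℤ → Ω → ℝ)
    (f : ℝ → ℝ) (m B : ℝ) : Prop where
  measurable_input : ∀ n, Measurable (η n)
  measurable_noise : ∀ n, Measurable (ε n)
  indep : iIndepFun (fun n ω => (η n ω, ε n ω)) P
  indep_pair : ∀ n, IndepFun (η n) (ε n) P
  density : IsIntervalDensity f m
  law : ∀ n, P.map (η n) = volume.withDensity (fun x => ENNReal.ofReal (f x))
  mem : ∀ n ω, η n ω ∈ Set.Icc (-m) m
  noise_bound : ∀ n ω, |ε n ω| ≤ B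
  noise_mean : ∀ n, ∫ ω, ε n ω ∂P = 0
  noise_sq : ∀ n, ∫ ω, ε n ω ^ 2 ∂P = 1

/-- The σ-algebra generated by `(η n, ε n)`. -/
abbrev innovation {Ω : Type*} (η ε : ℤ → Ω → ℝ) (n : ℤ) : MeasurableSpace Ω :=
  MeasurableSpace.comap (fun ω => (η n ω, ε n ω)) inferInstance

/-- The σ-algebra generated by `(η n, ε n)`, `n < l`. -/
abbrev past {Ω : Type*} (η ε : ℤ → Ω → ℝ) (l : ℤ) : MeasurableSpace Ω :=
  ⨆ n ∈ Set.Iio l, innovation η ε n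

section Model

variable {Ω : Type*} {η ε : ℤ → Ω → ℝ}

lemma past_mono : Monotone (past η ε) := fun _ _ h =>
  biSup_mono fun _ hn => lt_of_lt_of_le hn h

lemma innovation_le_past {n l : ℤ} (h : n < l) : innovation η ε n ≤ past η ε l :=
  le_biSup (innovation η ε) (Set.mem_Iio.2 h)

lemma measurable_innovation (n : ℤ) :
    Measurable[innovation η ε n] fun ω => (η n ω, ε n ω) :=
  comap_measurable _

lemma measurable_input_innovation (n : ℤ) : Measurable[innovation η ε n] (η n) :=
  measurable_fst.comp (measurable_innovation n)

lemma measurable_noise_innovation (n : ℤ) : Measurable[innovation η ε n] (ε n) :=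
  measurable_snd.comp (measurable_innovation n)

variable [m0 : MeasurableSpace Ω] {P : Measure Ω} {f : ℝ → ℝ} {m B : ℝ}

namespace BoundedModel

lemma innovation_le (H : BoundedModel P η ε f m B) (n : ℤ) : innovation η ε n ≤ m0 :=
  ((H.measurable_input n).prodMk (H.measurable_noise n)).comap_le

lemma past_le (H : BoundedModel P η ε f m B) (l : ℤ) : past η ε l ≤ m0 :=
  iSup₂_le fun n _ => H.innovation_le n

lemma indep_past (H : BoundedModel P η ε f m B) (l : ℤ) :
    Indep (innovation η ε l) (past η ε l) P := by
  have h := indep_iSup_of_disjoint (m := innovation η ε) H.innovation_le H.indep.iIndep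
    (S := {l}) (T := Set.Iio l) (by simp)
  simpa [past] using h

lemma integral_comp_input (H : BoundedModel P η ε f m B) (n : ℤ) {G : ℝ → ℝ}
    (hG : Measurable G) : ∫ ω, G (η n ω) ∂P = ∫ y, G y * f y := by
  rw [← integral_map (H.measurable_input n).aemeasurable hG.aestronglyMeasurable, H.law n,
    integral_withDensity_eq_integral_toReal_smul H.density.measurable.ennreal_ofReal
      (ae_of_all _ fun _ => ENNReal.ofReal_lt_top)]
  congr 1
  ext y
  rw [ENNReal.toReal_ofReal (H.density.nonneg y), smul_eq_mul, mul_comm]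

lemma integral_kernel (H : BoundedModel P η ε f m B) {k : ℝ → ℝ} (hk : Measurable k) (s : ℤ → ℝ)
    (l : ℤ) (x : ℝ) {h : ℝ} (hh : 0 < h) :
    ∫ ω, k ((x - (s l + η l ω)) / h) ∂P = h * smoothing k f h (x - s l) := by
  simp only [← sub_sub]
  rw [H.integral_comp_input l (G := fun y => k ((x - s l - y) / h)) (hk.comp (by fun_prop)),
    IsIntervalDensity.integral_comp_mul_density f _ hh]

variable [IsProbabilityMeasure P]

/-- The shift j serves for lagged innovations, with the σ-algebra of the strict past at l - j.
Centering doubles the bound c but does not increase the second moment. -/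
lemma predictablyWeighted (H : BoundedModel P η ε f m B) (j : ℤ) {φ Y : ℕ → Ω → ℝ} {d c v : ℝ}
    (hφ : ∀ l : ℕ, Measurable[past η ε (l - j)] (φ l)) (hφd : ∀ l ω, |φ l ω| ≤ d)
    (hY : ∀ l : ℕ, Measurable[innovation η ε (l - j)] (Y l)) (hYc : ∀ l ω, |Y l ω| ≤ c)
    (hv : ∀ l, ∫ ω, Y l ω ^ 2 ∂P ≤ v) :
    PredictablyWeighted P (fun l : ℕ => past η ε (l - j)) φ
      (fun l ω => Y l ω - ∫ ω', Y l ω' ∂P) d (2 * c) v := by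
  have hYm : ∀ l, Measurable (Y l) := fun l => (hY l).mono (H.innovation_le _) le_rfl
  have hYi : ∀ l, Integrable (Y l) P := fun l => integrable_of_abs_le (hYm l) (hYc l)
  have hmean : ∀ l, |∫ ω, Y l ω ∂P| ≤ c := by
    intro l
    have := norm_integral_le_of_norm_le_const (μ := P) (f := Y l) (ae_of_all _ (hYc l))
    simpa using this
  refine ⟨fun i k hik => past_mono (by simpa using hik), fun l => H.past_le _, hφ, hφd,
    fun l => ?_, fun l => ?_, fun l ω => ?_, fun l => ?_, fun l => ?_⟩
  · refine ((hY l).sub_const _).mono (innovation_le_past ?_) le_rfl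
    push_cast; linarith
  · exact indep_of_indep_of_le_left (H.indep_past _) ((hY l).sub_const _).comap_le
  · refine (abs_sub _ _).trans ?_
    linarith [hYc l ω, hmean l]
  · rw [integral_sub (hYi l) (integrable_const _)]
    simp
  · refine le_trans ?_ (hv l)
    have h2 : Integrable (fun ω => Y l ω ^ 2) P :=
      integrable_of_abs_le ((hYm l).pow_const 2) (c := c ^ 2) fun ω => by
        rw [abs_pow]; exact pow_le_pow_left₀ (abs_nonneg _) (hYc l ω) 2
    set μ := ∫ ω', Y l ω' ∂P with hμ
    have h3 : ∫ ω, (Y l ω - μ) ^ 2 ∂P = ∫ ω, Y l ω ^ 2 ∂P - μ ^ 2 := by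
      have h4 : ∀ ω, (Y l ω - μ) ^ 2 = Y l ω ^ 2 - (2 * μ) * Y l ω + μ ^ 2 := fun ω => by ring
      have i5 : Integrable (fun ω => Y l ω ^ 2 - (2 * μ) * Y l ω) P :=
        h2.sub ((hYi l).const_mul _)
      simp_rw [h4]
      rw [integral_add i5 (integrable_const _), integral_sub h2 ((hYi l).const_mul _),
        integral_const_mul, ← hμ]
      simp
      ring
    rw [h3]
    nlinarith [sq_nonneg μ]

/-- Rate in the law of large numbers for predictably weighted sums. -/
theorem ae_abs_sum_le_sqrt (H : BoundedModel P η ε f m B) (j : ℤ) {φ : ℕ → Ω → ℝ}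
    {Y : ℕ → ℕ → Ω → ℝ} {d c : ℝ}
    (hφ : ∀ l : ℕ, Measurable[past η ε (l - j)] (φ l)) (hφd : ∀ l ω, |φ l ω| ≤ d)
    (hY : ∀ n l : ℕ, Measurable[innovation η ε (l - j)] (Y n l))
    (hYc : ∀ᶠ n in atTop, ∀ l ω, |Y n l ω| ≤ c) (i₀ : ℕ) :
    ∃ C, ∀ᵐ ω ∂P, ∀ᶠ n : ℕ in atTop,
      |∑ l ∈ Finset.Icc i₀ n, φ l ω * (Y n l ω - ∫ ω', Y n l ω' ∂P)| ≤ C * √(n * Real.log n) := by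
  have hlim : Tendsto (fun n : ℕ => Real.log n / (n * 1)) atTop (nhds 0) := by
    have := (Real.isLittleO_log_id_atTop.tendsto_div_nhds_zero).comp tendsto_natCast_atTop_atTop
    simpa [Function.comp_def] using this
  -- A single index and q = 1: without a kernel factor the variance does not shrink.
  have := ae_eventually_abs_sum_le (P := P) (fun _ => ({()} : Finset Unit)) 1
    ((eventually_ge_atTop 1).mono fun n hn => by simpa using hn) (fun _ => 1)
    (Eventually.of_forall fun _ => one_pos) hlim (fun _ _ => φ)
    (fun n _ l ω => Y n l ω - ∫ ω', Y n l ω' ∂P) i₀ (fun n _ => n + 1) (fun n _ _ => le_rfl)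
    (fun l : ℕ => past η ε (l - j)) d (2 * c) (c ^ 2) (sq_nonneg c)
    (hYc.mono fun n hn i _ => by
      refine H.predictablyWeighted j hφ hφd (hY n) hn fun l => ?_
      rw [mul_one]
      have h1 : ∀ ω, ‖Y n l ω ^ 2‖ ≤ c ^ 2 := fun ω => by
        rw [norm_pow]; exact pow_le_pow_left₀ (norm_nonneg _) (hn l ω) 2
      have := norm_integral_le_of_norm_le_const (μ := P) (ae_of_all _ h1)
      refine (le_abs_self _).trans ?_
      simpa using this)
  refine ⟨2 * d ^ 2 * c ^ 2 + (1 : ℕ) + 2, ?_⟩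
  filter_upwards [this] with ω hω
  filter_upwards [hω] with n hn
  have h1 := hn () (Finset.mem_singleton_self ())
  rwa [mul_one, Finset.Ico_add_one_right_eq_Icc] at h1

theorem ae_tendsto_average (H : BoundedModel P η ε f m B) (j : ℤ) {φ : ℕ → Ω → ℝ}
    {Y : ℕ → ℕ → Ω → ℝ} {d c : ℝ}
    (hφ : ∀ l : ℕ, Measurable[past η ε (l - j)] (φ l)) (hφd : ∀ l ω, |φ l ω| ≤ d)
    (hY : ∀ n l : ℕ, Measurable[innovation η ε (l - j)] (Y n l))
    (hYc : ∀ᶠ n in atTop, ∀ l ω, |Y n l ω| ≤ c) (i₀ : ℕ) :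
    ∀ᵐ ω ∂P, Tendsto (fun n : ℕ =>
      (n : ℝ)⁻¹ * ∑ l ∈ Finset.Icc i₀ n, φ l ω * (Y n l ω - ∫ ω', Y n l ω' ∂P))
      atTop (nhds 0) := by
  obtain ⟨C, hC⟩ := H.ae_abs_sum_le_sqrt j hφ hφd hY hYc i₀
  have hlim : Tendsto (fun n : ℕ => C * √(Real.log n / n)) atTop (nhds 0) := by
    have := (Real.isLittleO_log_id_atTop.tendsto_div_nhds_zero).comp tendsto_natCast_atTop_atTop
    simpa [Function.comp_def] using this.sqrt.const_mul C
  filter_upwards [hC] with ω hω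
  refine squeeze_zero_norm' ?_ hlim
  filter_upwards [hω, eventually_gt_atTop 0] with n hn hn0
  have h5 : (0 : ℝ) < n := by exact_mod_cast hn0
  rw [norm_mul, Real.norm_eq_abs, Real.norm_eq_abs, abs_of_pos (inv_pos.2 h5)]
  calc _ ≤ (n : ℝ)⁻¹ * (C * √(n * Real.log n)) := by gcongr
    _ = C * √(Real.log n / n) := by
      rw [show n * Real.log n = (n : ℝ) ^ 2 * (Real.log n / n) by field_simp,
        Real.sqrt_mul (by positivity), Real.sqrt_sq h5.le]
      field_simp

end BoundedModel

end Model


/-! ### Uniform concentration of kernel sums -/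

/-- The pairs consist of a summation limit and a grid point of mesh n⁻³; polynomially many are
allowed in the union bound. -/
lemma card_grid_le (R : ℕ) : ∀ᶠ n : ℕ in atTop,
    (Finset.range (n + 1) ×ˢ Finset.range (R * n ^ 3 + 1)).card ≤ n ^ 6 := by
  filter_upwards [eventually_ge_atTop (R + 2)] with n hn
  rw [Finset.card_product, Finset.card_range, Finset.card_range]
  have h1 : n + 1 ≤ n ^ 2 := by nlinarith
  have h2 : R * n ^ 3 + 1 ≤ n ^ 4 := by
    have h3 : 1 ≤ n ^ 3 := Nat.one_le_pow _ _ (by omega)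
    calc R * n ^ 3 + 1 ≤ (R + 1) * n ^ 3 := by nlinarith
      _ ≤ n * n ^ 3 := Nat.mul_le_mul_right _ (by omega)
      _ = n ^ 4 := by ring
  calc (n + 1) * (R * n ^ 3 + 1) ≤ n ^ 2 * n ^ 4 := Nat.mul_le_mul h1 h2
    _ = n ^ 6 := by ring

lemma exists_grid_point {R : ℕ} {n : ℕ} (hn : 0 < n) {x : ℝ} (hx : |x| ≤ R) :
    ∃ i ∈ Finset.range (2 * R * n ^ 3 + 1), |x - (-R + i / (n : ℝ) ^ 3)| ≤ 1 / (n : ℝ) ^ 3 := by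
  have h5 : (0 : ℝ) < (n : ℝ) ^ 3 := by positivity
  have hx' := abs_le.1 hx
  have h0 : 0 ≤ (x + R) * (n : ℝ) ^ 3 := mul_nonneg (by linarith) h5.le
  refine ⟨⌊(x + R) * (n : ℝ) ^ 3⌋₊, ?_, ?_⟩
  · rw [Finset.mem_range, Nat.lt_succ_iff]
    apply Nat.floor_le_of_le
    push_cast
    gcongr
    linarith
  · have h1 := Nat.floor_le h0
    have h2 := Nat.lt_floor_add_one ((x + R) * (n : ℝ) ^ 3)
    rw [show x - (-R + (⌊(x + R) * (n : ℝ) ^ 3⌋₊ : ℝ) / (n : ℝ) ^ 3)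
      = ((x + R) * (n : ℝ) ^ 3 - ⌊(x + R) * (n : ℝ) ^ 3⌋₊) / (n : ℝ) ^ 3 by field_simp; ring,
      abs_div, abs_of_pos h5]
    gcongr
    rw [abs_le]
    constructor <;> linarith

section Model

variable {Ω : Type*} {η ε : ℤ → Ω → ℝ} [m0 : MeasurableSpace Ω] {P : Measure Ω} {f : ℝ → ℝ}
  {m B : ℝ} [IsProbabilityMeasure P]

namespace BoundedModel

/-- The substitution z = y - h u brings out one factor h. This is the source of √(n h ln n) instead
of √(n ln n). -/
lemma integral_kernel_sq_le (H : BoundedModel P η ε f m B) {k : ℝ → ℝ} (hk : Measurable k)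
    (hk2 : Integrable fun u => k u ^ 2) {ck : ℝ} (hkb : ∀ u, |k u| ≤ ck) {M : ℝ}
    (hM : ∀ x, f x ≤ M) {ψ : Ω → ℝ} {c : ℝ} (hψc : ∀ ω, |ψ ω| ≤ c)
    (n : ℤ) (y : ℝ) {h : ℝ} (hh : 0 < h) :
    ∫ ω, (ψ ω * k ((y - η n ω) / h)) ^ 2 ∂P ≤ c ^ 2 * (M * ∫ u, k u ^ 2) * h := by
  have hkm : Measurable fun ω => k ((y - η n ω) / h) :=
    hk.comp ((measurable_const.sub (H.measurable_input n)).div_const h)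
  have hsq : ∀ ω, (ψ ω * k ((y - η n ω) / h)) ^ 2 ≤ c ^ 2 * k ((y - η n ω) / h) ^ 2 := by
    intro ω
    rw [mul_pow, ← sq_abs (ψ ω)]
    gcongr
    exact hψc ω
  have hi2 : Integrable (fun ω => k ((y - η n ω) / h) ^ 2) P :=
    integrable_of_abs_le (hkm.pow_const 2) (c := ck ^ 2) fun ω => by
      rw [abs_pow]; exact pow_le_pow_left₀ (abs_nonneg _) (hkb _) 2
  calc _ ≤ ∫ ω, c ^ 2 * k ((y - η n ω) / h) ^ 2 ∂P :=
        integral_mono_of_nonneg (ae_of_all _ fun ω => sq_nonneg _) (hi2.const_mul _)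
          (ae_of_all _ hsq)
    _ = c ^ 2 * ∫ z, k ((y - z) / h) ^ 2 * f z := by
        rw [integral_const_mul, H.integral_comp_input n (G := fun z => k ((y - z) / h) ^ 2)
          ((hk.comp (by fun_prop)).pow_const 2)]
    _ ≤ c ^ 2 * (h * (M * ∫ u, k u ^ 2)) := by
        gcongr
        exact H.density.integral_comp_mul_density_le (k := fun u => k u ^ 2) hk2
          (fun u => sq_nonneg _) hM y hh
    _ = _ := by ring

/-- The concentration bound is applied at all grid points and summation limits at once. Moving x to
a grid point changes the whole sum by O(1), as K is Lipschitz and the mesh is n⁻³, and O(1) is below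
the rate. Weights φ from the past and factors ψ from the present cover the kernel mass, the noisy
responses and the lagged regressors alike. -/
theorem ae_uniform_kernel_sum (H : BoundedModel P η ε f m B) (s : ℤ → ℝ) {k : ℝ → ℝ} {L : ℝ≥0}
    (hkL : LipschitzWith L k) (hki : Integrable k) {φ ψ : ℕ → Ω → ℝ} {d c : ℝ}
    (hφ : ∀ l : ℕ, Measurable[past η ε l] (φ l)) (hφd : ∀ l ω, |φ l ω| ≤ d)
    (hψ : ∀ l : ℕ, Measurable[innovation η ε l] (ψ l)) (hψc : ∀ l ω, |ψ l ω| ≤ c)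
    {h : ℕ → ℝ} (hh : IsBandwidth h) (i₀ : ℕ) (R : ℝ) :
    ∃ C, ∀ᵐ ω ∂P, ∀ᶠ n : ℕ in atTop, ∀ M ≤ n, ∀ x : ℝ, |x| ≤ R →
      |∑ l ∈ Finset.Icc i₀ M, φ l ω * (ψ l ω * k ((x - (s l + η l ω)) / h n)
        - ∫ ω', ψ l ω' * k ((x - (s l + η l ω')) / h n) ∂P)|
      ≤ C * (n * h n * √(Real.log n / (n * h n))) := by
  obtain ⟨Mf, hMf0, hMf⟩ := H.density.exists_le
  obtain ⟨ck, hck⟩ : ∃ ck, ∀ u, |k u| ≤ ck := ⟨_, abs_le_of_lipschitz_integrable hkL hki⟩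
  obtain ⟨R', hR'⟩ := exists_nat_ge R
  have ω₀ : Ω := Classical.choice (nonempty_of_isProbabilityMeasure P)
  have hd0 : 0 ≤ d := (abs_nonneg _).trans (hφd 0 ω₀)
  have hc0 : 0 ≤ c := (abs_nonneg _).trans (hψc 0 ω₀)
  have hkm : Measurable k := hkL.continuous.measurable
  have hk2 := integrable_sq_of_abs_le hki hck
  set v := c ^ 2 * (Mf * ∫ u, k u ^ 2) with hv
  have hv0 : 0 ≤ v := by
    have : 0 ≤ ∫ u, k u ^ 2 := integral_nonneg fun u => sq_nonneg _
    positivity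
  set Z : ℕ → ℝ → ℕ → Ω → ℝ := fun n x l ω => ψ l ω * k ((x - (s l + η l ω)) / h n) with hZ
  have hZm : ∀ n x (l : ℕ), Measurable[innovation η ε l] (Z n x l) := by
    intro n x l
    exact (hψ l).mul (hkm.comp ((measurable_const.sub
      (measurable_const.add (measurable_input_innovation _))).div_const _))
  have hZb : ∀ n x l ω, |Z n x l ω| ≤ c * ck := by
    intro n x l ω
    rw [hZ, abs_mul]
    exact mul_le_mul (hψc l ω) (hck _) (abs_nonneg _) hc0
  have hZi : ∀ n x l, Integrable (Z n x l) P := fun n x l =>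
    integrable_of_abs_le ((hZm n x l).mono (H.innovation_le _) le_rfl) (hZb n x l)
  have hmain := ae_eventually_abs_sum_le (P := P)
    (fun n => Finset.range (n + 1) ×ˢ Finset.range (2 * R' * n ^ 3 + 1)) 6
    (card_grid_le (2 * R')) h hh.pos hh.log_div (fun _ _ => φ)
    (fun n i l ω => Z n (-R' + i.2 / (n : ℝ) ^ 3) l ω
      - ∫ ω', Z n (-R' + i.2 / (n : ℝ) ^ 3) l ω' ∂P) i₀ (fun _ i => i.1 + 1)
    (fun n i hi => by
      have := Finset.mem_range.1 (Finset.mem_product.1 hi).1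
      omega) (fun l : ℕ => past η ε (l - 0)) d (2 * (c * ck)) v hv0
    (hh.pos.mono fun n hn i _ => by
      refine H.predictablyWeighted 0 (fun l => by simpa using hφ l) hφd
        (fun l => by simpa using hZm n _ l) (hZb n _) fun l => ?_
      have h1 := H.integral_kernel_sq_le hkm hk2 hck hMf (hψc l) l
        (-R' + i.2 / (n : ℝ) ^ 3 - s l) hn
      simpa only [hZ, sub_sub] using h1)
  set A : ℝ := 2 * d ^ 2 * v + (6 : ℕ) + 2 with hA
  refine ⟨A + 4 * (d * (c * L)), ?_⟩
  filter_upwards [hmain] with ω hω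
  filter_upwards [hω, hh.pos, hh.one_le_mul, hh.sqrt_eq, eventually_one_le_log,
    eventually_gt_atTop 0] with n hn hhn hnh hsq hlog hn0 M hM x hx
  have hn1 : (1 : ℝ) ≤ n := by exact_mod_cast hn0
  obtain ⟨i, hi, hxi⟩ := exists_grid_point (R := R') hn0 (hx.trans hR')
  set x' := -(R' : ℝ) + i / (n : ℝ) ^ 3 with hx'
  have h1 := hn (M, i) (Finset.mem_product.2 ⟨Finset.mem_range.2 (by simp only; omega), hi⟩)
  simp only [Finset.Ico_add_one_right_eq_Icc] at h1
  rw [hsq] at h1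
  have hZL : ∀ l ω, |Z n x l ω - Z n x' l ω| ≤ c * L * (1 / (n : ℝ) ^ 3 / h n) := by
    intro l ω
    rw [hZ]
    simp only
    rw [← mul_sub, abs_mul, mul_assoc]
    refine mul_le_mul (hψc l ω) ?_ (abs_nonneg _) hc0
    have h2 := hkL.dist_le_mul ((x - (s l + η l ω)) / h n) ((x' - (s l + η l ω)) / h n)
    rw [Real.dist_eq, Real.dist_eq, ← sub_div, abs_div, abs_of_pos hhn,
      sub_sub_sub_cancel_right] at h2
    refine h2.trans ?_
    gcongr
  have hEL : ∀ l, |∫ ω, Z n x l ω ∂P - ∫ ω, Z n x' l ω ∂P|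
      ≤ c * L * (1 / (n : ℝ) ^ 3 / h n) := by
    intro l
    rw [← integral_sub (hZi n x l) (hZi n x' l)]
    have := norm_integral_le_of_norm_le_const (μ := P) (f := fun ω => Z n x l ω - Z n x' l ω)
      (ae_of_all _ (hZL l))
    simpa using this
  have hdiff : |∑ l ∈ Finset.Icc i₀ M, φ l ω * (Z n x l ω - ∫ ω', Z n x l ω' ∂P)
      - ∑ l ∈ Finset.Icc i₀ M, φ l ω * (Z n x' l ω - ∫ ω', Z n x' l ω' ∂P)|
      ≤ (2 * n) * (d * (2 * (c * L * (1 / (n : ℝ) ^ 3 / h n)))) := by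
    rw [← Finset.sum_sub_distrib]
    refine (Finset.abs_sum_le_sum_abs _ _).trans ?_
    refine (Finset.sum_le_card_nsmul _ _ (d * (2 * (c * L * (1 / (n : ℝ) ^ 3 / h n))))
      fun l _ => ?_).trans ?_
    · rw [← mul_sub, abs_mul]
      refine mul_le_mul (hφd l ω) ?_ (abs_nonneg _) hd0
      rw [show Z n x l ω - ∫ ω', Z n x l ω' ∂P - (Z n x' l ω - ∫ ω', Z n x' l ω' ∂P)
        = (Z n x l ω - Z n x' l ω) - (∫ ω', Z n x l ω' ∂P - ∫ ω', Z n x' l ω' ∂P) by ring]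
      refine (abs_sub _ _).trans ?_
      linarith [hZL l ω, hEL l]
    · rw [nsmul_eq_mul]
      refine mul_le_mul_of_nonneg_right ?_ (by positivity)
      rw [Nat.card_Icc]
      exact_mod_cast (by omega : M + 1 - i₀ ≤ 2 * n)
  have hroot : 1 ≤ n * h n * √(Real.log n / (n * h n)) := by
    rw [← hsq]
    exact Real.one_le_sqrt.2 (one_le_mul_of_one_le_of_one_le hnh hlog)
  have hsmall : (2 * n) * (d * (2 * (c * L * (1 / (n : ℝ) ^ 3 / h n))))
      ≤ 4 * (d * (c * L)) := by
    have e1 : (2 * n) * (d * (2 * (c * L * (1 / (n : ℝ) ^ 3 / h n))))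
        = 4 * (d * (c * L)) * (1 / (n * (n * h n))) := by
      field_simp
      ring
    rw [e1]
    refine mul_le_of_le_one_right (by positivity) ?_
    exact div_le_one_of_le₀ (one_le_mul_of_one_le_of_one_le hn1 hnh) (by positivity)
  have hD0 : 0 ≤ 4 * (d * (c * L)) := by positivity
  have htri := abs_sub_abs_le_abs_sub
    (∑ l ∈ Finset.Icc i₀ M, φ l ω * (Z n x l ω - ∫ ω', Z n x l ω' ∂P))
    (∑ l ∈ Finset.Icc i₀ M, φ l ω * (Z n x' l ω - ∫ ω', Z n x' l ω' ∂P))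
  have hfin : 4 * (d * (c * L)) ≤ 4 * (d * (c * L)) * (n * h n * √(Real.log n / (n * h n))) :=
    le_mul_of_one_le_right hD0 hroot
  rw [add_mul]
  linarith

end BoundedModel

end Model


/-! ### Periodic sequences and sums over residue classes -/

lemma periodic_emod {F : ℤ → ℝ} {T : ℕ} (hF : Function.Periodic F (T : ℤ)) (n : ℤ) :
    F (n % T) = F n := by
  have := hF.sub_zsmul_eq (x := n) (n / T)
  rwa [smul_eq_mul, mul_comm, ← Int.emod_def] at this

lemma sum_periodic_mul {F : ℤ → ℝ} {T : ℕ} (hT : 0 < T) (hF : Function.Periodic F (T : ℤ))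
    (A : Finset ℕ) (y : ℕ → ℝ) :
    ∑ l ∈ A, F l * y l = ∑ r ∈ Finset.range T, F r * ∑ l ∈ A with l % T = r, y l := by
  rw [← Finset.sum_fiberwise_of_maps_to (g := fun l => l % T) (t := Finset.range T)
    fun l _ => Finset.mem_range.2 (Nat.mod_lt l hT)]
  refine Finset.sum_congr rfl fun r _ => ?_
  rw [Finset.mul_sum]
  refine Finset.sum_congr rfl fun l hl => ?_
  have h1 := (Finset.mem_filter.1 hl).2
  rw [← periodic_emod hF l]
  congr 2
  rw [← h1]
  simp

/-- The exact count is a difference of two floors, truncated at zero; rounding costs less than 1 and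
the offset p costs p / T ≤ p. -/
lemma abs_card_residue_sub_le {T : ℕ} (hT : 0 < T) (p N : ℕ) {r : ℕ} (hr : r < T) :
    |(((Finset.Icc (p + 1) N).filter fun l => l % T = r).card : ℝ) - N / T| ≤ p + 1 := by
  have hTq : (0 : ℚ) < T := by exact_mod_cast hT
  have hT1 : (1 : ℚ) ≤ T := by exact_mod_cast hT
  have h1 := Nat.Ioc_filter_modEq_card p N hT r
  have h2 : ((Finset.Icc (p + 1) N).filter fun l => l % T = r)
      = (Finset.Ioc p N).filter fun l => l ≡ r [MOD T] := by
    rw [Finset.Icc_add_one_left_eq_Ioc]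
    refine Finset.filter_congr fun l _ => ?_
    rw [Nat.ModEq, Nat.mod_eq_of_lt hr]
  rw [h2]
  set κ := ((Finset.Ioc p N).filter fun l => l ≡ r [MOD T]).card
  have h3 : (κ : ℚ) = max ((⌊((N : ℚ) - r) / T⌋ : ℚ) - ⌊((p : ℚ) - r) / T⌋) 0 := by
    exact_mod_cast h1
  have f1 := Int.floor_le (((N : ℚ) - r) / T)
  have f2 := Int.lt_floor_add_one (((N : ℚ) - r) / T)
  have f3 := Int.floor_le (((p : ℚ) - r) / T)
  have f4 := Int.lt_floor_add_one (((p : ℚ) - r) / T)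
  have hpT : (p : ℚ) / T ≤ p := div_le_self (by positivity) hT1
  have hpT0 : 0 ≤ (p : ℚ) / T := by positivity
  have hNT0 : 0 ≤ (N : ℚ) / T := by positivity
  rw [sub_div] at f1 f2 f3 f4
  have h4 : |(κ : ℚ) - N / T| ≤ p + 1 := by
    rw [h3, abs_le]
    rcases max_cases ((⌊((N : ℚ) - r) / T⌋ : ℚ) - ⌊((p : ℚ) - r) / T⌋) 0 with ⟨h, h'⟩ | ⟨h, h'⟩
    all_goals
      rw [h]
      rw [sub_div, sub_div] at *
      constructor <;> linarith
  have h5 := (Rat.cast_le (K := ℝ)).2 h4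
  push_cast at h5
  exact h5

lemma abs_sum_periodic_sub_le {F : ℤ → ℝ} {T : ℕ} (hT : 0 < T)
    (hF : Function.Periodic F (T : ℤ)) {c : ℝ} (hc : ∀ l, |F l| ≤ c) (p N : ℕ) :
    |∑ l ∈ Finset.Icc (p + 1) N, F l - N / T * ∑ r ∈ Finset.range T, F r| ≤ T * (c * (p + 1)) := by
  have h1 := sum_periodic_mul hT hF (Finset.Icc (p + 1) N) fun _ => 1
  simp only [mul_one] at h1
  rw [h1, Finset.mul_sum, ← Finset.sum_sub_distrib]
  refine (Finset.abs_sum_le_sum_abs _ _).trans ?_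
  refine (Finset.sum_le_card_nsmul _ _ (c * (p + 1)) fun r hr => ?_).trans ?_
  · rw [Finset.sum_const, nsmul_eq_mul, mul_one, mul_comm _ (F r), ← mul_sub, abs_mul]
    exact mul_le_mul (hc _) (abs_card_residue_sub_le hT p N (Finset.mem_range.1 hr))
      (abs_nonneg _) ((abs_nonneg _).trans (hc 0))
  · rw [Finset.card_range, nsmul_eq_mul]

/-! ### The support of the exogenous variable -/

lemma mem_inputSupport {T : ℕ} (hT : 0 < T) {s : ℤ → ℝ} (hs : Function.Periodic s (T : ℤ))
    {m y : ℝ} (hy : y ∈ Set.Icc (-m) m) (n : ℤ) : s n + y ∈ inputSupport T s m := by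
  have hT' : (0 : ℤ) < T := by exact_mod_cast hT
  -- `inputSupport` runs over the seasons 1, ..., T, hence the shift by one around the remainder.
  refine Set.mem_biUnion (x := (n - 1) % T + 1)
    ⟨by linarith [Int.emod_nonneg (n - 1) hT'.ne'], by linarith [Int.emod_lt_of_pos (n - 1) hT']⟩ ?_
  have h1 : s ((n - 1) % T + 1) = s n := by
    have := hs.sub_zsmul_eq (x := n) ((n - 1) / T)
    rw [Int.emod_def, ← this, smul_eq_mul]
    congr 1
    ring
  rw [h1]
  constructor <;> linarith [hy.1, hy.2]

lemma exists_residue_of_mem_inputSupport {T : ℕ} (hT : 0 < T) {s : ℤ → ℝ}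
    (hs : Function.Periodic s (T : ℤ)) {m x : ℝ} (hx : x ∈ inputSupport T s m) :
    ∃ r ∈ Finset.range T, x - s r ∈ Set.Icc (-m) m := by
  have hT' : (0 : ℤ) < T := by exact_mod_cast hT
  obtain ⟨j, -, hj⟩ := Set.mem_iUnion₂.1 hx
  have h0 := Int.emod_nonneg j hT'.ne'
  have h1 : (((j % T).toNat : ℕ) : ℤ) = j % T := Int.toNat_of_nonneg h0
  refine ⟨(j % T).toNat, Finset.mem_range.2 ?_, ?_⟩
  · have := Int.emod_lt_of_pos j hT'
    omega
  · rw [h1, periodic_emod hs]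
    constructor <;> linarith [hj.1, hj.2]

lemma isCompact_inputSupport (T : ℕ) (s : ℤ → ℝ) (m : ℝ) : IsCompact (inputSupport T s m) :=
  (Set.finite_Icc (1 : ℤ) T).isCompact_biUnion fun _ _ => isCompact_Icc

lemma exists_bound_inputSupport (T : ℕ) (s : ℤ → ℝ) (m : ℝ) :
    ∃ R, ∀ x ∈ inputSupport T s m, |x| ≤ R :=
  (isCompact_inputSupport T s m).isBounded.exists_norm_le

/-- The kernel smoothing of the sum of the densities of `e_1, ..., e_T`. -/
noncomputable def mixture (T : ℕ) (s : ℤ → ℝ) (K f : ℝ → ℝ) (h x : ℝ) : ℝ :=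
  ∑ r ∈ Finset.range T, smoothing K f h (x - s r)

/-- Some season has x in its support and contributes at least κ. The other ones may contribute
negatively, since K may be signed, but each by no more than κ / (2T). -/
theorem exists_mixture_lower_bound {f : ℝ → ℝ} {m : ℝ} (hf : IsIntervalDensity f m) {K : ℝ → ℝ}
    {γ : ℝ≥0} (hK : IsKernel K γ) {T : ℕ} (hT : 0 < T) {s : ℤ → ℝ}
    (hs : Function.Periodic s (T : ℤ)) :
    ∃ κ > 0, ∃ h₀ > 0, ∀ h, 0 < h → h < h₀ → ∀ x ∈ inputSupport T s m,
      κ ≤ mixture T s K f h x := by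
  have hT' : (0 : ℝ) < T := by exact_mod_cast hT
  obtain ⟨κ, hκ, H⟩ := hf.exists_smoothing_lower_bound hK
  obtain ⟨h₀, hh₀, H'⟩ := H (κ / (2 * T)) (by positivity)
  refine ⟨κ / 2, by positivity, h₀, hh₀, fun h h1 h2 x hx => ?_⟩
  obtain ⟨hlow, hin⟩ := H' h h1 h2
  obtain ⟨r, hr, hxr⟩ := exists_residue_of_mem_inputSupport hT hs hx
  rw [mixture, ← Finset.add_sum_erase _ _ hr]
  have h3 : ∑ q ∈ (Finset.range T).erase r, -(κ / (2 * T))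
      ≤ ∑ q ∈ (Finset.range T).erase r, smoothing K f h (x - s q) :=
    Finset.sum_le_sum fun q _ => hlow _
  rw [Finset.sum_const, nsmul_eq_mul] at h3
  have h4 : (((Finset.range T).erase r).card : ℝ) ≤ T := by
    have := Finset.card_erase_le (s := Finset.range T) (a := r)
    rw [Finset.card_range] at this
    exact_mod_cast this
  have h5 : (((Finset.range T).erase r).card : ℝ) * (κ / (2 * T)) ≤ κ / 2 := by
    calc _ ≤ (T : ℝ) * (κ / (2 * T)) := by gcongr
      _ = κ / 2 := by field_simp
  linarith [hin _ hxr]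


/-! ### Kernel sums and kernel regression -/

section Model

variable {Ω : Type*} {η ε : ℤ → Ω → ℝ} [m0 : MeasurableSpace Ω] {P : Measure Ω} {f : ℝ → ℝ}
  {m B : ℝ} [IsProbabilityMeasure P] {T : ℕ} {s : ℤ → ℝ} {K : ℝ → ℝ} {γ : ℝ≥0} {h : ℕ → ℝ}

lemma IsKernel.measurable (hK : IsKernel K γ) : Measurable K := by
  obtain ⟨L, hL⟩ := hK.lipschitz
  exact hL.continuous.measurable

lemma IsBandwidth.eventually_mixture_lower_bound (hh : IsBandwidth h)
    (hf : IsIntervalDensity f m) (hK : IsKernel K γ) (hT : 0 < T)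
    (hs : Function.Periodic s (T : ℤ)) :
    ∃ κ > 0, ∀ᶠ n in atTop, ∀ x ∈ inputSupport T s m, κ ≤ mixture T s K f (h n) x := by
  obtain ⟨κ, hκ, h₀, hh₀, H⟩ := exists_mixture_lower_bound hf hK hT hs
  refine ⟨κ, hκ, ?_⟩
  filter_upwards [hh.pos, hh.tendsto_zero.eventually (gt_mem_nhds hh₀)] with n h1 h2
  exact H _ h1 h2

lemma periodic_smoothing (hs : Function.Periodic s (T : ℤ)) (K f : ℝ → ℝ) (h x : ℝ) :
    Function.Periodic (fun l : ℤ => smoothing K f h (x - s l)) (T : ℤ) := fun l => by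
  simp only [hs l]

namespace BoundedModel

/-- The kernel mass is of the exact order `n h_n`, uniformly on the support. -/
theorem ae_kernelMass_lower_bound (H : BoundedModel P η ε f m B) (hK : IsKernel K γ)
    (hh : IsBandwidth h) (hT : 0 < T) (hs : Function.Periodic s (T : ℤ)) (p : ℕ) :
    ∃ c > 0, ∀ᵐ ω ∂P, ∀ᶠ n : ℕ in atTop, ∀ N ≤ n, n ≤ N + 1 → ∀ x ∈ inputSupport T s m,
      c * (n * h n) ≤ kernelMass p K (h n) (fun l => s l + η l ω) N x := by
  obtain ⟨L, hL⟩ := hK.lipschitz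
  obtain ⟨R, hR⟩ := exists_bound_inputSupport T s m
  obtain ⟨M, hM0, hM⟩ := H.density.exists_le
  obtain ⟨κ, hκ, hmix⟩ := hh.eventually_mixture_lower_bound H.density hK hT hs
  obtain ⟨C, hC⟩ := H.ae_uniform_kernel_sum s hL hK.integrable (φ := fun _ _ => 1)
    (ψ := fun _ _ => 1) (d := 1) (c := 1) (fun _ => measurable_const) (fun _ _ => by simp)
    (fun _ => measurable_const) (fun _ _ => by simp) hh (p + 1) R
  have hT' : (0 : ℝ) < T := by exact_mod_cast hT
  set J := M * ∫ u, |K u| with hJ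
  set D := (T : ℝ) * (J * (p + 1)) with hD
  have hJ0 : 0 ≤ J := mul_nonneg hM0.le (integral_nonneg fun u => abs_nonneg _)
  -- Since N ≥ n / 2, the main term is at least four times this constant times n h_n; the incomplete
  -- period and the fluctuation each use up at most one of the four parts.
  refine ⟨κ / (8 * T), by positivity, ?_⟩
  have hr : Tendsto (fun n : ℕ => |C| * √(Real.log n / (n * h n))) atTop (nhds 0) := by
    simpa using hh.log_div.sqrt.const_mul |C|
  have hDn : Tendsto (fun n : ℕ => D / (n : ℝ)) atTop (nhds 0) :=
    tendsto_const_div_atTop_nhds_zero_nat D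
  have hpos : (0 : ℝ) < κ / (8 * T) := by positivity
  filter_upwards [hC] with ω hω
  filter_upwards [hω, hmix, hh.pos, hr.eventually (gt_mem_nhds hpos),
    hDn.eventually (gt_mem_nhds hpos), eventually_ge_atTop 2] with n h1 h2 hhn h3 h4 hn2
    N hN hnN x hx
  have hn0 : (0 : ℝ) < n := by exact_mod_cast (by omega : 0 < n)
  have h5 := h1 N hN x (hR x hx)
  simp only [one_mul, H.integral_kernel hL.continuous.measurable s _ x hhn] at h5
  rw [Finset.sum_sub_distrib, ← Finset.mul_sum] at h5
  have h6 := abs_sum_periodic_sub_le hT (periodic_smoothing hs K f (h n) x)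
    (fun l => H.density.abs_smoothing_le hK.integrable hM (h n) (x - s l)) p N
  have h7 : κ ≤ ∑ r ∈ Finset.range T, smoothing K f (h n) (x - s r) := h2 x hx
  have h8 := (abs_le.1 h5).1
  have h9 := (abs_le.1 h6).1
  rw [← hJ, ← hD] at h9
  have h10 : (n : ℝ) / 2 ≤ N := by
    have : n ≤ 2 * N := by omega
    have : (n : ℝ) ≤ 2 * N := by exact_mod_cast this
    linarith
  have h11 : (n : ℝ) / 2 / T * κ ≤ N / T * ∑ r ∈ Finset.range T, smoothing K f (h n) (x - s r) := by
    gcongr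
  have h12 : D < κ / (8 * T) * n := by rwa [div_lt_iff₀ hn0] at h4
  have h13 : C * (n * h n * √(Real.log n / (n * h n))) ≤ κ / (8 * T) * (n * h n) := by
    have : C * √(Real.log n / (n * h n)) ≤ κ / (8 * T) :=
      (mul_le_mul_of_nonneg_right (le_abs_self C) (Real.sqrt_nonneg _)).trans h3.le
    calc _ = C * √(Real.log n / (n * h n)) * (n * h n) := by ring
      _ ≤ _ := mul_le_mul_of_nonneg_right this (by positivity)
  have h14 : h n * (3 * (κ / (8 * T)) * n)
      ≤ h n * ∑ l ∈ Finset.Icc (p + 1) N, smoothing K f (h n) (x - s l) := by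
    refine mul_le_mul_of_nonneg_left ?_ hhn.le
    have : (n : ℝ) / 2 / T * κ = 4 * (κ / (8 * T)) * n := by field_simp; ring
    linarith
  have h15 : 0 ≤ κ / (8 * T) * (n * h n) := by positivity
  rw [kernelMass]
  nlinarith

/-- For a signed kernel a regression is no average; its norm is controlled by this mass divided by
the one in `ae_kernelMass_lower_bound`. -/
theorem ae_abs_kernelMass_le (H : BoundedModel P η ε f m B) (hK : IsKernel K γ)
    (hh : IsBandwidth h) (p : ℕ) :
    ∃ C, 0 < C ∧ ∀ᵐ ω ∂P, ∀ᶠ n : ℕ in atTop, ∀ N ≤ n, ∀ x ∈ inputSupport T s m,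
      kernelMass p (fun u => |K u|) (h n) (fun l => s l + η l ω) N x ≤ C * (n * h n) := by
  obtain ⟨L, hL⟩ := hK.lipschitz
  obtain ⟨R, hR⟩ := exists_bound_inputSupport T s m
  obtain ⟨M, hM0, hM⟩ := H.density.exists_le
  have hLa : LipschitzWith L fun u => |K u| := by
    simpa [Function.comp_def] using lipschitzWith_one_norm.comp hL
  obtain ⟨C, hC⟩ := H.ae_uniform_kernel_sum s hLa hK.integrable.abs (φ := fun _ _ => 1)
    (ψ := fun _ _ => 1) (d := 1) (c := 1) (fun _ => measurable_const) (fun _ _ => by simp)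
    (fun _ => measurable_const) (fun _ _ => by simp) hh (p + 1) R
  set J := M * ∫ u, |K u| with hJ
  have hJ0 : 0 ≤ J := mul_nonneg hM0.le (integral_nonneg fun u => abs_nonneg _)
  have hr : Tendsto (fun n : ℕ => |C| * √(Real.log n / (n * h n))) atTop (nhds 0) := by
    simpa using hh.log_div.sqrt.const_mul |C|
  refine ⟨J + 1, by positivity, ?_⟩
  filter_upwards [hC] with ω hω
  filter_upwards [hω, hh.pos, hr.eventually (gt_mem_nhds one_pos), eventually_ge_atTop 2] with
    n h1 hhn h3 hn2 N hN x hx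
  have hn0 : (0 : ℝ) < n := by exact_mod_cast (by omega : 0 < n)
  have h5 := h1 N hN x (hR x hx)
  simp only [one_mul, H.integral_kernel hLa.continuous.measurable s _ x hhn] at h5
  rw [Finset.sum_sub_distrib, ← Finset.mul_sum] at h5
  have h6 : ∑ l ∈ Finset.Icc (p + 1) N, smoothing (fun u => |K u|) f (h n) (x - s l)
      ≤ n * J := by
    refine (Finset.sum_le_card_nsmul _ _ J fun l _ => ?_).trans ?_
    · have := H.density.abs_smoothing_le hK.integrable.abs hM (h n) (x - s l)
      simp only [abs_abs] at this
      exact (le_abs_self _).trans this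
    · rw [Nat.card_Icc, nsmul_eq_mul]
      exact mul_le_mul_of_nonneg_right (by exact_mod_cast (by omega : N + 1 - (p + 1) ≤ n)) hJ0
  have h8 := (abs_le.1 h5).2
  have h13 : C * (n * h n * √(Real.log n / (n * h n))) ≤ 1 * (n * h n) := by
    have : C * √(Real.log n / (n * h n)) ≤ 1 :=
      (mul_le_mul_of_nonneg_right (le_abs_self C) (Real.sqrt_nonneg _)).trans h3.le
    calc _ = C * √(Real.log n / (n * h n)) * (n * h n) := by ring
      _ ≤ _ := mul_le_mul_of_nonneg_right this (by positivity)
  have h14 := mul_le_mul_of_nonneg_left h6 hhn.le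
  rw [kernelMass]
  nlinarith

/-- The bias of kernel sums for a Hölder function. -/
lemma abs_bias_le (H : BoundedModel P η ε f m B) (hK : IsKernel K γ) (hT : 0 < T)
    (hs : Function.Periodic s (T : ℤ)) {c : ℝ → ℝ} (hcm : Measurable c) {cb : ℝ}
    (hcb : ∀ x, |c x| ≤ cb) {α Cα : ℝ≥0} (hα : HolderOnWith Cα α c (inputSupport T s m))
    (hmom : Integrable fun u => |u| ^ (α : ℝ) * |K u|) {M : ℝ} (hM : ∀ x, f x ≤ M) (l : ℤ)
    {x : ℝ} (hx : x ∈ inputSupport T s m) {h : ℝ} (hh : 0 < h) :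
    |∫ ω, c (s l + η l ω) * K ((x - (s l + η l ω)) / h) ∂P
      - c x * ∫ ω, K ((x - (s l + η l ω)) / h) ∂P|
      ≤ Cα * (M * ∫ u, |u| ^ (α : ℝ) * |K u|) * (h * h ^ (α : ℝ)) := by
  obtain ⟨L, hL⟩ := hK.lipschitz
  obtain ⟨ck, hck⟩ : ∃ ck, ∀ u, |K u| ≤ ck := ⟨_, abs_le_of_lipschitz_integrable hL hK.integrable⟩
  have hKm : Measurable K := hL.continuous.measurable
  have hem : Measurable fun ω => s l + η l ω := measurable_const.add (H.measurable_input l)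
  have hKe : Measurable fun ω => K ((x - (s l + η l ω)) / h) :=
    hKm.comp ((measurable_const.sub hem).div_const h)
  have i1 : Integrable (fun ω => K ((x - (s l + η l ω)) / h)) P :=
    integrable_of_abs_le hKe fun ω => hck _
  have i2 : Integrable (fun ω => c (s l + η l ω) * K ((x - (s l + η l ω)) / h)) P :=
    integrable_of_abs_le ((hcm.comp hem).mul hKe) (c := cb * ck) fun ω => by
      rw [abs_mul]
      exact mul_le_mul (hcb _) (hck _) (abs_nonneg _) ((abs_nonneg _).trans (hcb 0))
  rw [← integral_const_mul, ← integral_sub i2 (i1.const_mul _)]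
  refine abs_integral_le_integral_abs.trans ?_
  -- The Hölder increment |e - x|^α equals h^α |(x - e)/h|^α, so rescaling leaves the moment of K of
  -- order α.
  set G : ℝ → ℝ := fun y => |(x - s l - y) / h| ^ (α : ℝ) * |K ((x - s l - y) / h)| with hG
  have hGm : Measurable G := by
    have : Measurable fun y : ℝ => (x - s l - y) / h := by fun_prop
    exact ((measurable_norm.comp this).pow_const _).mul (measurable_norm.comp (hKm.comp this))
  have hGi : Integrable (fun ω => G (η l ω)) P := by
    obtain ⟨A, hA⟩ : ∃ A, ∀ ω, |(x - s l - η l ω) / h| ≤ A := by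
      refine ⟨(|x - s l| + m) / h, fun ω => ?_⟩
      rw [abs_div, abs_of_pos hh]
      gcongr
      have h1 : |η l ω| ≤ m := abs_le.2 (H.mem l ω)
      exact (abs_sub _ _).trans (by linarith)
    refine integrable_of_abs_le (hGm.comp (H.measurable_input l)) (c := A ^ (α : ℝ) * ck)
      fun ω => ?_
    rw [hG]
    simp only [abs_mul, abs_abs]
    refine mul_le_mul ?_ (hck _) (abs_nonneg _)
      (Real.rpow_nonneg ((abs_nonneg _).trans (hA ω)) _)
    rw [abs_of_nonneg (Real.rpow_nonneg (abs_nonneg _) _)]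
    exact Real.rpow_le_rpow (abs_nonneg _) (hA ω) α.2
  calc ∫ ω, |c (s l + η l ω) * K ((x - (s l + η l ω)) / h)
        - c x * K ((x - (s l + η l ω)) / h)| ∂P
      ≤ ∫ ω, Cα * h ^ (α : ℝ) * G (η l ω) ∂P := by
        refine integral_mono (i2.sub (i1.const_mul _)).abs (hGi.const_mul _) fun ω => ?_
        simp only [← sub_mul, abs_mul, hG]
        have h1 := hα.dist_le (mem_inputSupport hT hs (H.mem l ω) l) hx
        rw [Real.dist_eq, Real.dist_eq] at h1
        have h2 : |s l + η l ω - x| ^ (α : ℝ)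
            = h ^ (α : ℝ) * |(x - s l - η l ω) / h| ^ (α : ℝ) := by
          rw [← Real.mul_rpow hh.le (abs_nonneg _), abs_div, abs_of_pos hh,
            mul_div_cancel₀ _ hh.ne', abs_sub_comm, sub_sub]
        rw [h2] at h1
        rw [← sub_sub]
        calc _ ≤ Cα * (h ^ (α : ℝ) * |(x - s l - η l ω) / h| ^ (α : ℝ))
              * |K ((x - s l - η l ω) / h)| := mul_le_mul_of_nonneg_right h1 (abs_nonneg _)
          _ = _ := by ring
    _ = Cα * h ^ (α : ℝ) * ∫ y, G y * f y := by
        rw [integral_const_mul, H.integral_comp_input l hGm]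
    _ ≤ Cα * h ^ (α : ℝ) * (h * (M * ∫ u, |u| ^ (α : ℝ) * |K u|)) := by
        refine mul_le_mul_of_nonneg_left ?_ (by positivity)
        exact H.density.integral_comp_mul_density_le (k := fun u => |u| ^ (α : ℝ) * |K u|) hmom
          (fun u => by positivity) hM (x - s l) hh
    _ = _ := by ring

/-- Uniform rate of the kernel regression of responses `ψ l` whose regression function on the
exogenous variable is the Hölder function `c`. -/
theorem ae_kernelRegression_rate (H : BoundedModel P η ε f m B) (hK : IsKernel K γ)
    (hh : IsBandwidth h) (hT : 0 < T) (hs : Function.Periodic s (T : ℤ)) (p : ℕ)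
    {c : ℝ → ℝ} (hcm : Measurable c) {cb : ℝ}
    (hcb : ∀ x, |c x| ≤ cb) {α Cα : ℝ≥0} (hα : HolderOnWith Cα α c (inputSupport T s m))
    (hmom : Integrable fun u => |u| ^ (α : ℝ) * |K u|) {ψ : ℕ → Ω → ℝ} {cψ : ℝ}
    (hψ : ∀ l : ℕ, Measurable[innovation η ε l] (ψ l)) (hψc : ∀ l ω, |ψ l ω| ≤ cψ)
    (hreg : ∀ (l : ℕ) (G : ℝ → ℝ) (M : ℝ), Measurable G → (∀ x, |G x| ≤ M) →
      ∫ ω, ψ l ω * G (s l + η l ω) ∂P = ∫ ω, c (s l + η l ω) * G (s l + η l ω) ∂P) :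
    ∃ C, 0 ≤ C ∧ ∀ᵐ ω ∂P, ∀ᶠ n : ℕ in atTop, ∀ N ≤ n, n ≤ N + 1 → ∀ x ∈ inputSupport T s m,
      |kernelRegression p K (h n) (fun l => s l + η l ω) N (fun l => ψ l ω) x - c x|
        ≤ C * (√(Real.log n / (n * h n)) + h n ^ (α : ℝ)) := by
  obtain ⟨L, hL⟩ := hK.lipschitz
  have hKm : Measurable K := hL.continuous.measurable
  obtain ⟨R, hR⟩ := exists_bound_inputSupport T s m
  obtain ⟨M, hM0, hM⟩ := H.density.exists_le
  obtain ⟨c₀, hc₀, hmass⟩ := H.ae_kernelMass_lower_bound hK hh hT hs p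
  obtain ⟨C₁, hC₁⟩ := H.ae_uniform_kernel_sum s hL hK.integrable (φ := fun _ _ => 1)
    (ψ := fun _ _ => 1) (d := 1) (c := 1) (fun _ => measurable_const) (fun _ _ => by simp)
    (fun _ => measurable_const) (fun _ _ => by simp) hh (p + 1) R
  obtain ⟨C₂, hC₂⟩ := H.ae_uniform_kernel_sum s hL hK.integrable (φ := fun _ _ => 1)
    (ψ := ψ) (d := 1) (fun _ => measurable_const) (fun _ _ => by simp) hψ hψc hh (p + 1) R
  set A := Cα * (M * ∫ u, |u| ^ (α : ℝ) * |K u|) with hA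
  have hA0 : 0 ≤ A := by
    have : 0 ≤ ∫ u, |u| ^ (α : ℝ) * |K u| := integral_nonneg fun u => by positivity
    positivity
  have hcb0 : 0 ≤ cb := (abs_nonneg _).trans (hcb 0)
  refine ⟨(|C₂| + cb * |C₁| + A) / c₀, by positivity, ?_⟩
  filter_upwards [hmass, hC₁, hC₂] with ω w1 w2 w3
  filter_upwards [w1, w2, w3, hh.pos, eventually_ge_atTop 1] with n v1 v2 v3 hhn hn1 N hN hnN x hx
  have hn0 : (0 : ℝ) < n := by exact_mod_cast (by omega : 0 < n)
  have u1 := v1 N hN hnN x hx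
  have u2 := v2 N hN x (hR x hx)
  have u3 := v3 N hN x (hR x hx)
  simp only [one_mul] at u2 u3
  set r := √(Real.log n / (n * h n)) with hr
  have hnh : 0 < n * h n := by positivity
  have hmpos : 0 < kernelMass p K (h n) (fun l => s l + η l ω) N x :=
    lt_of_lt_of_le (by positivity) u1
  have hnum : |∑ l ∈ Finset.Icc (p + 1) N, ψ l ω * K ((x - (s l + η l ω)) / h n)
      - c x * kernelMass p K (h n) (fun l => s l + η l ω) N x|
      ≤ (|C₂| + cb * |C₁| + A) * (r + h n ^ (α : ℝ)) * (n * h n) := by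
    have hbias : |∑ l ∈ Finset.Icc (p + 1) N,
        (∫ ω', ψ l ω' * K ((x - (s l + η l ω')) / h n) ∂P
          - c x * ∫ ω', K ((x - (s l + η l ω')) / h n) ∂P)| ≤ n * (A * (h n * h n ^ (α : ℝ))) := by
      refine (Finset.abs_sum_le_sum_abs _ _).trans ?_
      refine (Finset.sum_le_card_nsmul _ _ (A * (h n * h n ^ (α : ℝ))) fun l _ => ?_).trans ?_
      · have h1 := hreg l (fun e => K ((x - e) / h n)) _ (hKm.comp (by fun_prop))
          fun e => abs_le_of_lipschitz_integrable hL hK.integrable _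
        rw [h1]
        exact H.abs_bias_le hK hT hs hcm hcb hα hmom hM l hx hhn
      · rw [Nat.card_Icc, nsmul_eq_mul]
        exact mul_le_mul_of_nonneg_right (by exact_mod_cast (by omega : N + 1 - (p + 1) ≤ n))
          (by positivity)
    -- The fluctuations of numerator and denominator are separated from the difference of their
    -- means, which is a pure bias.
    have hdec : ∑ l ∈ Finset.Icc (p + 1) N, ψ l ω * K ((x - (s l + η l ω)) / h n)
        - c x * kernelMass p K (h n) (fun l => s l + η l ω) N x
        = ∑ l ∈ Finset.Icc (p + 1) N, (ψ l ω * K ((x - (s l + η l ω)) / h n)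
            - ∫ ω', ψ l ω' * K ((x - (s l + η l ω')) / h n) ∂P)
          - c x * ∑ l ∈ Finset.Icc (p + 1) N, (K ((x - (s l + η l ω)) / h n)
            - ∫ ω', K ((x - (s l + η l ω')) / h n) ∂P)
          + ∑ l ∈ Finset.Icc (p + 1) N, (∫ ω', ψ l ω' * K ((x - (s l + η l ω')) / h n) ∂P
          - c x * ∫ ω', K ((x - (s l + η l ω')) / h n) ∂P) := by
      simp only [kernelMass, Finset.sum_sub_distrib, Finset.mul_sum, mul_sub]
      ring
    rw [hdec]
    refine (abs_add_le _ _).trans ?_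
    have t1 := abs_sub (∑ l ∈ Finset.Icc (p + 1) N, (ψ l ω * K ((x - (s l + η l ω)) / h n)
            - ∫ ω', ψ l ω' * K ((x - (s l + η l ω')) / h n) ∂P))
            (c x * ∑ l ∈ Finset.Icc (p + 1) N, (K ((x - (s l + η l ω)) / h n)
            - ∫ ω', K ((x - (s l + η l ω')) / h n) ∂P))
    rw [abs_mul] at t1
    have t2 := mul_le_mul (hcb x) u2 (abs_nonneg _) hcb0
    have hrn : 0 ≤ n * h n * r := by positivity
    have t3 : C₁ * (n * h n * r) ≤ |C₁| * (n * h n * r) :=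
      mul_le_mul_of_nonneg_right (le_abs_self _) hrn
    have t4 : C₂ * (n * h n * r) ≤ |C₂| * (n * h n * r) :=
      mul_le_mul_of_nonneg_right (le_abs_self _) hrn
    have t5 := mul_le_mul_of_nonneg_left t3 hcb0
    have t6 : 0 ≤ A * (n * h n * r) := by positivity
    have t7 : 0 ≤ (|C₂| + cb * |C₁|) * (n * h n * h n ^ (α : ℝ)) := by positivity
    nlinarith
  rw [kernelRegression, div_sub' hmpos.ne', abs_div, abs_of_pos hmpos, div_le_iff₀ hmpos,
    mul_comm (kernelMass _ _ _ _ _ _)]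
  refine hnum.trans ?_
  have hpos : 0 ≤ (|C₂| + cb * |C₁| + A) / c₀ * (r + h n ^ (α : ℝ)) := by positivity
  calc _ = (|C₂| + cb * |C₁| + A) / c₀ * (r + h n ^ (α : ℝ)) * (c₀ * (n * h n)) := by
        field_simp
    _ ≤ _ := mul_le_mul_of_nonneg_left u1 hpos

end BoundedModel

end Model


/-! ### Laws of large numbers for the filtered process -/

/-- The centered sequence `u_j - E u_j`. -/
noncomputable def centered {Ω : Type*} [MeasurableSpace Ω] (P : Measure Ω) (u : ℤ → Ω → ℝ)
    (j : ℤ) (ω : Ω) : ℝ := u j ω - ∫ ω', u j ω' ∂P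

lemma abs_integral_le_of_abs_le {Ω : Type*} [MeasurableSpace Ω] {P : Measure Ω}
    [IsProbabilityMeasure P] {F : Ω → ℝ} {c : ℝ} (hF : ∀ ω, |F ω| ≤ c) : |∫ ω, F ω ∂P| ≤ c := by
  have := norm_integral_le_of_norm_le_const (μ := P) (f := F) (ae_of_all _ hF)
  simpa using this

lemma abs_centered_le {Ω : Type*} [MeasurableSpace Ω] {P : Measure Ω}
    [IsProbabilityMeasure P] {u : ℤ → Ω → ℝ} {c : ℝ} (hu : ∀ j ω, |u j ω| ≤ c) (j : ℤ) (ω : Ω) :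
    |centered P u j ω| ≤ 2 * c := by
  refine (abs_sub _ _).trans ?_
  linarith [hu j ω, abs_integral_le_of_abs_le (P := P) (hu j)]

lemma causalFilter_sub {g : ℕ → ℝ} (hg : Summable fun j => |g j|) {u v : ℤ → ℝ} {c d : ℝ}
    (hu : ∀ n, |u n| ≤ c) (hv : ∀ n, |v n| ≤ d) (n : ℤ) :
    causalFilter g (fun j => u j - v j) n = causalFilter g u n - causalFilter g v n := by
  rw [causalFilter, causalFilter, causalFilter,
    ← (summable_filter hg hu n).tsum_sub (summable_filter hg hv n)]
  simp only [mul_sub]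

lemma periodic_causalFilter {g : ℕ → ℝ} {v : ℤ → ℝ} {T : ℕ} (hv : Function.Periodic v (T : ℤ)) :
    Function.Periodic (causalFilter g v) (T : ℤ) := by
  intro n
  simp only [causalFilter]
  congr 1
  ext j
  rw [show n + (T : ℤ) - j = n - j + T by ring, hv]

lemma average_abs_le {F : ℕ → ℝ} {c : ℝ} (hc : ∀ l, |F l| ≤ c) (p n : ℕ) :
    |(n : ℝ)⁻¹ * ∑ l ∈ Finset.Icc (p + 1) n, F l| ≤ c := by
  have hc0 : 0 ≤ c := (abs_nonneg _).trans (hc 0)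
  rcases Nat.eq_zero_or_pos n with rfl | hn
  · simpa using hc0
  have hn0 : (0 : ℝ) < n := by exact_mod_cast hn
  rw [abs_mul, abs_of_pos (inv_pos.2 hn0), inv_mul_le_iff₀ hn0]
  refine (Finset.abs_sum_le_sum_abs _ _).trans ?_
  refine (Finset.sum_le_card_nsmul _ _ c fun l _ => hc l).trans ?_
  rw [Nat.card_Icc, nsmul_eq_mul]
  exact mul_le_mul_of_nonneg_right (by exact_mod_cast (by omega : n + 1 - (p + 1) ≤ n)) hc0

lemma tendsto_average_periodic {F : ℤ → ℝ} {T : ℕ} (hT : 0 < T)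
    (hF : Function.Periodic F (T : ℤ)) {c : ℝ} (hc : ∀ l, |F l| ≤ c) (p : ℕ) :
    Tendsto (fun n : ℕ => (n : ℝ)⁻¹ * ∑ l ∈ Finset.Icc (p + 1) n, F l) atTop
      (nhds ((T : ℝ)⁻¹ * ∑ r ∈ Finset.range T, F r)) := by
  rw [tendsto_iff_norm_sub_tendsto_zero]
  refine squeeze_zero' (Eventually.of_forall fun n => norm_nonneg _) ?_
    (tendsto_const_div_atTop_nhds_zero_nat (T * (c * (p + 1))))
  filter_upwards [eventually_gt_atTop 0] with n hn
  have hn0 : (0 : ℝ) < n := by exact_mod_cast hn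
  have h1 := abs_sum_periodic_sub_le hT hF hc p n
  rw [Real.norm_eq_abs, le_div_iff₀ hn0]
  calc _ = |((n : ℝ)⁻¹ * ∑ l ∈ Finset.Icc (p + 1) n, F l
        - (T : ℝ)⁻¹ * ∑ r ∈ Finset.range T, F r) * n| := by rw [abs_mul, abs_of_pos hn0]
    _ = |∑ l ∈ Finset.Icc (p + 1) n, F l - n / T * ∑ r ∈ Finset.range T, F r| := by
        congr 1
        field_simp
    _ ≤ _ := h1

lemma measurable_tsum_past {Ω : Type*} {η ε u : ℤ → Ω → ℝ} {g : ℕ → ℝ}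
    (hu : ∀ l, Measurable[innovation η ε l] (u l)) (i : ℕ → ℤ) {n : ℤ} (hi : ∀ j, i j < n) :
    Measurable[past η ε n] fun ω => ∑' j, g j * u (i j) ω := by
  let _ : MeasurableSpace Ω := past η ε n
  refine Measurable.tsum fun j => ?_
  exact ((hu (i j)).mono (innovation_le_past (hi j)) le_rfl).const_mul _

lemma measurable_causalFilter {Ω : Type*} {η ε u : ℤ → Ω → ℝ} {g : ℕ → ℝ}
    (hu : ∀ l, Measurable[innovation η ε l] (u l)) {i n : ℤ} (hi : i < n) :
    Measurable[past η ε n] fun ω => causalFilter g (fun j => u j ω) i :=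
  measurable_tsum_past hu (fun j : ℕ => i - j) fun j => by omega

section Model

variable {Ω : Type*} {η ε : ℤ → Ω → ℝ} [m0 : MeasurableSpace Ω] {P : Measure Ω} {f : ℝ → ℝ}
  {m B : ℝ} {u : ℤ → Ω → ℝ} {c : ℝ} {g : ℕ → ℝ} [IsProbabilityMeasure P]

namespace BoundedModel

/-- For each fixed lag the average of independent centered terms tends to zero. After exchanging
average and series, domination by a multiple of |g j| lets the limit pass through the sum over lags.
-/
theorem ae_tendsto_average_causalFilter (H : BoundedModel P η ε f m B)
    (hg : Summable fun j => |g j|) (hu : ∀ l, Measurable[innovation η ε l] (u l))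
    (huc : ∀ l ω, |u l ω| ≤ c) {w : ℕ → ℝ} {d : ℝ} (hw : ∀ l, |w l| ≤ d) (i : ℤ) (p : ℕ) :
    ∀ᵐ ω ∂P, Tendsto (fun n : ℕ => (n : ℝ)⁻¹ * ∑ l ∈ Finset.Icc (p + 1) n,
      w l * causalFilter g (fun j => centered P u j ω) (l - i)) atTop (nhds 0) := by
  have hj : ∀ j : ℕ, ∀ᵐ ω ∂P, Tendsto (fun n : ℕ => (n : ℝ)⁻¹ * ∑ l ∈ Finset.Icc (p + 1) n,
      w l * centered P u (l - i - j) ω) atTop (nhds 0) := by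
    intro j
    have := H.ae_tendsto_average (i + j) (φ := fun l _ => w l)
      (Y := fun _ l => u (l - (i + j))) (fun l => measurable_const) (fun l _ => hw l)
      (fun _ l => hu _) (Eventually.of_forall fun _ l ω => huc _ ω) (p + 1)
    simpa only [centered, sub_sub] using this
  filter_upwards [ae_all_iff.2 hj] with ω hω
  have hcent : ∀ j, |centered P u j ω| ≤ 2 * c := fun j => abs_centered_le huc j ω
  have hd0 : 0 ≤ d := (abs_nonneg _).trans (hw 0)
  have hswap : ∀ n : ℕ, (n : ℝ)⁻¹ * ∑ l ∈ Finset.Icc (p + 1) n,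
      w l * causalFilter g (fun j => centered P u j ω) (l - i)
      = ∑' j : ℕ, g j * ((n : ℝ)⁻¹ * ∑ l ∈ Finset.Icc (p + 1) n,
        w l * centered P u (l - i - j) ω) := by
    intro n
    have h1 : ∀ l ∈ Finset.Icc (p + 1) n, Summable fun j : ℕ =>
        (n : ℝ)⁻¹ * (w l * (g j * centered P u ((l : ℤ) - i - j) ω)) := fun l _ =>
      ((summable_filter hg hcent _).mul_left _).mul_left _
    rw [Finset.mul_sum]
    simp only [causalFilter]
    simp_rw [← tsum_mul_left]
    rw [← Summable.tsum_finsetSum h1]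
    congr 1
    ext j
    rw [Finset.mul_sum, Finset.mul_sum]
    refine Finset.sum_congr rfl fun l _ => ?_
    ring
  simp_rw [hswap]
  have hlim := tendsto_tsum_of_dominated_convergence (𝓕 := atTop)
    (f := fun (n j : ℕ) => g j * ((n : ℝ)⁻¹ * ∑ l ∈ Finset.Icc (p + 1) n,
        w l * centered P u (l - i - j) ω)) (g := fun _ => (0 : ℝ))
    (bound := fun j => |g j| * (d * (2 * c))) (hg.mul_right _)
    (fun j => by simpa using (hω j).const_mul (g j))
    (Eventually.of_forall fun n j => by
      rw [Real.norm_eq_abs, abs_mul]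
      refine mul_le_mul_of_nonneg_left (average_abs_le (fun l => ?_) p n) (abs_nonneg _)
      rw [abs_mul]
      exact mul_le_mul (hw l) (hcent _) (abs_nonneg _) hd0)
  simpa using hlim

lemma causalFilter_centered (hg : Summable fun j => |g j|) (huc : ∀ l ω, |u l ω| ≤ c) (n : ℤ)
    (ω : Ω) : causalFilter g (fun j => centered P u j ω) n
      = causalFilter g (fun j => u j ω) n - causalFilter g (fun j => ∫ ω', u j ω' ∂P) n :=
  causalFilter_sub hg (fun j => huc j ω) (fun j => abs_integral_le_of_abs_le (huc j)) n

/-- Within one season the mean of the filter is constant, and a fraction 1/T of the times belongs to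
it. Averages season by season are needed because the smoothed kernel weights are periodic in time.
-/
theorem ae_tendsto_residue_average (H : BoundedModel P η ε f m B)
    (hg : Summable fun j => |g j|) (hu : ∀ l, Measurable[innovation η ε l] (u l))
    (huc : ∀ l ω, |u l ω| ≤ c) {T : ℕ} (hT : 0 < T)
    (hper : Function.Periodic (fun j => ∫ ω, u j ω ∂P) (T : ℤ)) (i : ℤ) (p : ℕ) {r : ℕ}
    (hr : r < T) :
    ∀ᵐ ω ∂P, Tendsto (fun n : ℕ => (n : ℝ)⁻¹ *
      ∑ l ∈ Finset.Icc (p + 1) n with l % T = r, causalFilter g (fun j => u j ω) (l - i)) atTop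
      (nhds ((T : ℝ)⁻¹ * causalFilter g (fun j => ∫ ω, u j ω ∂P) (r - i))) := by
  have h1 := H.ae_tendsto_average_causalFilter hg hu huc
    (w := fun l => if l % T = r then (1 : ℝ) else 0) (d := 1)
    (fun l => by by_cases h : l % T = r <;> simp [h]) i p
  set ν : ℤ → ℝ := fun j => ∫ ω, u j ω ∂P with hν
  have hx := periodic_causalFilter (g := g) hper
  set F : ℤ → ℝ := fun l => if l % T = r then causalFilter g ν (l - i) else 0 with hF
  have hFper : Function.Periodic F (T : ℤ) := by
    intro l
    simp only [hF, Int.add_emod_right]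
    rw [show l + (T : ℤ) - i = l - i + T by ring, hx]
  have hνc : ∀ j, |ν j| ≤ c := fun j => abs_integral_le_of_abs_le (huc j)
  have hFc : ∀ l, |F l| ≤ (∑' j, |g j|) * c := by
    intro l
    have := abs_causalFilter_le hg hνc (l - i)
    by_cases h : l % T = r
    · simpa [hF, h] using this
    · simpa [hF, h] using (abs_nonneg _).trans this
  have h2 := tendsto_average_periodic hT hFper hFc p
  have h3 : ∑ q ∈ Finset.range T, F q = causalFilter g ν (r - i) := by
    rw [Finset.sum_eq_single r]
    · simp only [hF]
      rw [if_pos (by exact_mod_cast Nat.mod_eq_of_lt hr)]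
    · intro q hq hqr
      simp only [hF]
      refine if_neg fun h => hqr ?_
      have : q % T = r := by exact_mod_cast h
      rwa [Nat.mod_eq_of_lt (Finset.mem_range.1 hq)] at this
    · intro h; exact absurd (Finset.mem_range.2 hr) h
  rw [h3] at h2
  filter_upwards [h1] with ω hω
  have h4 := hω.add h2
  rw [zero_add] at h4
  refine h4.congr fun n => ?_
  rw [← mul_add, ← Finset.sum_add_distrib, Finset.sum_filter]
  congr 1
  refine Finset.sum_congr rfl fun l _ => ?_
  have h5 : ((l : ℤ) % (T : ℤ) = (r : ℤ)) ↔ l % T = r := by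
    constructor <;> intro h <;> exact_mod_cast h
  simp only [hF, h5]
  by_cases h : l % T = r
  · simp only [h, if_true, one_mul]
    rw [causalFilter_centered hg huc]
    ring
  · simp [h]

end BoundedModel

end Model


/-! ### Averages of quadratic forms -/

/-- The normalized sum `n⁻¹ ∑_{l = p + 1}^n F l`. -/
noncomputable def average (p n : ℕ) (F : ℕ → ℝ) : ℝ := (n : ℝ)⁻¹ * ∑ l ∈ Finset.Icc (p + 1) n, F l

lemma average_add (p n : ℕ) (F G : ℕ → ℝ) :
    average p n (fun l => F l + G l) = average p n F + average p n G := by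
  simp only [average, Finset.sum_add_distrib, mul_add]

lemma average_const_mul (p n : ℕ) (c : ℝ) (F : ℕ → ℝ) :
    average p n (fun l => c * F l) = c * average p n F := by
  simp only [average, ← Finset.mul_sum]
  ring

lemma average_mono {p n : ℕ} {F G : ℕ → ℝ} (h : ∀ l, F l ≤ G l) :
    average p n F ≤ average p n G :=
  mul_le_mul_of_nonneg_left (Finset.sum_le_sum fun l _ => h l) (by positivity)

lemma average_sum {ι : Type*} (A : Finset ι) (p n : ℕ) (F : ι → ℕ → ℝ) :
    average p n (fun l => ∑ i ∈ A, F i l) = ∑ i ∈ A, average p n (F i) := by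
  simp only [average]
  rw [Finset.sum_comm, Finset.mul_sum]

lemma average_bilin {ι κ : Type*} [Fintype ι] [Fintype κ] (p n : ℕ) (v : ι → ℝ) (w : κ → ℝ)
    (a : ι → ℕ → ℝ) (b : κ → ℕ → ℝ) :
    average p n (fun l => (∑ i, v i * a i l) * ∑ j, w j * b j l)
      = ∑ i, ∑ j, v i * w j * average p n (fun l => a i l * b j l) := by
  simp only [Finset.sum_mul_sum, average_sum]
  refine Finset.sum_congr rfl fun i _ => Finset.sum_congr rfl fun j _ => ?_
  rw [← average_const_mul]
  congr 1
  ext l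
  ring

lemma abs_bilin_le {ι κ : Type*} [Fintype ι] [Fintype κ] {E : ι → κ → ℝ} {τ : ℝ}
    (hE : ∀ i j, |E i j| ≤ τ) (v : ι → ℝ) (w : κ → ℝ) :
    |∑ i, ∑ j, v i * w j * E i j|
      ≤ τ * (Fintype.card κ * ∑ i, v i ^ 2 + Fintype.card ι * ∑ j, w j ^ 2) := by
  refine (Finset.abs_sum_le_sum_abs _ _).trans ?_
  calc ∑ i, |∑ j, v i * w j * E i j| ≤ ∑ i, ∑ j, τ * (v i ^ 2 + w j ^ 2) := by
        refine Finset.sum_le_sum fun i _ => (Finset.abs_sum_le_sum_abs _ _).trans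
          (Finset.sum_le_sum fun j _ => ?_)
        have hτ : 0 ≤ τ := (abs_nonneg _).trans (hE i j)
        rw [abs_mul, mul_comm]
        refine mul_le_mul (hE i j) ?_ (abs_nonneg _) hτ
        rw [abs_mul]
        nlinarith [sq_abs (v i), sq_abs (w j), sq_nonneg (|v i| - |w j|), sq_nonneg (v i),
          sq_nonneg (w j)]
    _ = _ := by
        simp only [← Finset.mul_sum, Finset.sum_add_distrib, Finset.sum_const, Finset.card_univ,
          nsmul_eq_mul]

/-- Entrywise convergence becomes a bound for all vectors at once, hence also for data-dependent
ones such as θ̂ - a. -/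
lemma eventually_abs_bilin_le {ι κ : Type*} [Fintype ι] [Fintype κ] {E : ℕ → ι → κ → ℝ}
    (hE : ∀ i j, Tendsto (fun n => E n i j) atTop (nhds 0)) {τ : ℝ} (hτ : 0 < τ) :
    ∀ᶠ n in atTop, ∀ (v : ι → ℝ) (w : κ → ℝ),
      |∑ i, ∑ j, v i * w j * E n i j| ≤ τ * (∑ i, v i ^ 2 + ∑ j, w j ^ 2) := by
  set D : ℝ := (Fintype.card κ : ℝ) + Fintype.card ι + 1 with hD
  have hD0 : 0 < D := by positivity
  have h1 : ∀ᶠ n in atTop, ∀ i j, |E n i j| ≤ τ / D := by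
    refine eventually_all.2 fun i => eventually_all.2 fun j => ?_
    have := (hE i j).abs
    rw [abs_zero] at this
    exact (this.eventually (gt_mem_nhds (by positivity : 0 < τ / D))).mono fun n hn => hn.le
  filter_upwards [h1] with n hn v w
  refine (abs_bilin_le hn v w).trans ?_
  have hv : 0 ≤ ∑ i, v i ^ 2 := Finset.sum_nonneg fun i _ => sq_nonneg _
  have hw : 0 ≤ ∑ j, w j ^ 2 := Finset.sum_nonneg fun i _ => sq_nonneg _
  calc _ ≤ τ / D * (D * (∑ i, v i ^ 2 + ∑ j, w j ^ 2)) := by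
        gcongr
        have i1 : (0 : ℝ) ≤ Fintype.card κ := by positivity
        have i2 : (0 : ℝ) ≤ Fintype.card ι := by positivity
        rw [hD]
        nlinarith [mul_nonneg i1 hw, mul_nonneg i2 hv]
    _ = _ := by field_simp

/-- The unit upper triangular Toeplitz matrix with entries `g (j - i)`. -/
def toeplitz (p : ℕ) (g : ℕ → ℝ) (i j : Fin p) : ℝ := if i ≤ j then g (j - i : ℕ) else 0

/-- A triangular matrix with unit diagonal is injective, and an injective linear map in finite
dimension is antilipschitz. -/
lemma exists_toeplitz_lower_bound (p : ℕ) {g : ℕ → ℝ} (hg : g 0 = 1) :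
    ∃ ρ > 0, ∀ v : Fin p → ℝ, ρ * ∑ i, v i ^ 2 ≤ ∑ j, (∑ i, v i * toeplitz p g i j) ^ 2 := by
  let A : EuclideanSpace ℝ (Fin p) →ₗ[ℝ] EuclideanSpace ℝ (Fin p) :=
    { toFun := fun v => WithLp.toLp 2 fun j => ∑ i, v i * toeplitz p g i j
      map_add' := fun v w => by
        ext j; simp [add_mul, Finset.sum_add_distrib]
      map_smul' := fun c v => by
        ext j; simp [Finset.mul_sum, mul_assoc] }
  have hker : LinearMap.ker A = ⊥ := by
    refine LinearMap.ker_eq_bot'.2 fun v hv => ?_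
    have hj : ∀ j : Fin p, ∑ i, v i * toeplitz p g i j = 0 := fun j => by
      have := congrArg (fun z : EuclideanSpace ℝ (Fin p) => z j) hv
      simpa [A] using this
    have hall : ∀ k : ℕ, ∀ hk : k < p, v ⟨k, hk⟩ = 0 := by
      intro k
      induction k using Nat.strong_induction_on with
      | _ k ih =>
        intro hk
        have h1 := hj ⟨k, hk⟩
        rw [Finset.sum_eq_single ⟨k, hk⟩] at h1
        · simpa [toeplitz, hg] using h1
        · intro i _ hik
          by_cases hle : i ≤ ⟨k, hk⟩
          · have hlt : (i : ℕ) < k := lt_of_le_of_ne hle fun h => hik (Fin.ext h)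
            have := ih i hlt i.2
            rw [show v i = 0 from this, zero_mul]
          · simp [toeplitz, hle]
        · intro h; exact absurd (Finset.mem_univ _) h
    ext i
    exact hall i i.2
  obtain ⟨C, hC, hA⟩ := A.exists_antilipschitzWith hker
  have hC' : (0 : ℝ) < C := hC
  refine ⟨((C : ℝ) ^ 2)⁻¹, by positivity, fun v => ?_⟩
  have h1 := hA.le_mul_dist (WithLp.toLp 2 v) 0
  rw [dist_zero_right, map_zero, dist_zero_right] at h1
  have h2 := pow_le_pow_left₀ (norm_nonneg _) h1 2
  rw [mul_pow, EuclideanSpace.norm_sq_eq, EuclideanSpace.norm_sq_eq] at h2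
  rw [inv_mul_le_iff₀ (by positivity)]
  simpa [A] using h2

/-- The first p - i terms of the filter involve only the innovations at l - 1, ..., l - p; the tail
involves only earlier ones, so that it is predictable for all of them. -/
lemma causalFilter_eq_toeplitz_add {g : ℕ → ℝ} (hg : Summable fun j => |g j|) {u : ℤ → ℝ} {c : ℝ}
    (hu : ∀ n, |u n| ≤ c) {p : ℕ} (i : Fin p) (l : ℤ) :
    causalFilter g u (l - ((i : ℕ) + 1 : ℤ))
      = ∑ j : Fin p, toeplitz p g i j * u (l - ((j : ℕ) + 1 : ℤ))
        + ∑' j : ℕ, g (j + (p - i)) * u (l - p - 1 - j) := by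
  have hip := i.2
  rw [causalFilter, ← (summable_filter hg hu _).sum_add_tsum_nat_add (p - i)]
  congr 1
  · have h1 : ∑ j : Fin p, toeplitz p g i j * u (l - ((j : ℕ) + 1 : ℤ))
        = ∑ j ∈ Finset.range p, if (i : ℕ) ≤ j then g (j - i) * u (l - ((j : ℕ) + 1 : ℤ)) else 0 := by
      rw [Finset.sum_range]
      refine Finset.sum_congr rfl fun j _ => ?_
      simp only [toeplitz, Fin.le_def, ite_mul, zero_mul]
    rw [h1, ← Finset.sum_filter]
    have h2 : (Finset.range p).filter (fun j => (i : ℕ) ≤ j) = Finset.Ico (i : ℕ) p := by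
      ext j; simp [and_comm]
    rw [h2, Finset.sum_Ico_eq_sum_range]
    refine Finset.sum_congr rfl fun j _ => ?_
    rw [add_tsub_cancel_left]
    congr 2
    push_cast
    ring
  · congr 1
    ext j
    congr 2
    push_cast [Nat.cast_sub hip.le]
    ring


/-! ### Lower bound for the Gram matrix -/

/-- The quadratic inequality behind the lower bound of the Gram matrix: `y` is the centered
regressor, split into its recent innovations `U` and a remainder `R`, and `μ` is its mean. -/
lemma average_sq_lower_bound {p n : ℕ} {y R U μ : Fin p → ℕ → ℝ} {G : Fin p → Fin p → ℝ}
    (hy : ∀ i l, y i l = ∑ j, G i j * U j l + R i l) {c₀ ρ τ : ℝ} {V Q : Fin p → Fin p → ℝ}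
    (hG : ∀ v : Fin p → ℝ, ρ * ∑ i, v i ^ 2 ≤ ∑ j, (∑ i, v i * G i j) ^ 2)
    (hV : ∀ w : Fin p → ℝ, c₀ * ∑ i, w i ^ 2 ≤ ∑ i, ∑ j, w i * w j * V i j)
    (hτ : 0 < τ) (hτ₁ : 8 * τ ≤ c₀) (hτ₂ : 32 * τ ≤ ρ * c₀)
    (hU : ∀ v w : Fin p → ℝ,
      |∑ i, ∑ j, v i * w j * (average p n (fun l => U i l * U j l) - V i j)|
        ≤ τ * (∑ i, v i ^ 2 + ∑ j, w j ^ 2))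
    (hUR : ∀ v w : Fin p → ℝ, |∑ i, ∑ j, v i * w j * average p n (fun l => U i l * R j l)|
        ≤ τ * (∑ i, v i ^ 2 + ∑ j, w j ^ 2))
    (hyμ : ∀ v w : Fin p → ℝ, |∑ i, ∑ j, v i * w j * average p n (fun l => μ j l * y i l)|
        ≤ τ * (∑ i, v i ^ 2 + ∑ j, w j ^ 2))
    (hμ : ∀ v w : Fin p → ℝ,
      |∑ i, ∑ j, v i * w j * (average p n (fun l => μ i l * μ j l) - Q i j)|
        ≤ τ * (∑ i, v i ^ 2 + ∑ j, w j ^ 2)) (v : Fin p → ℝ) :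
    ∑ i, ∑ j, v i * v j * Q i j + ρ * c₀ / 4 * ∑ i, v i ^ 2
      ≤ average p n (fun l => (∑ i, v i * (y i l + μ i l)) ^ 2) := by
  set d : Fin p → ℝ := fun j => ∑ i, v i * G i j with hd
  have hvy : ∀ l, ∑ i, v i * y i l = ∑ j, d j * U j l + ∑ i, v i * R i l := by
    intro l
    simp only [hy, mul_add, Finset.sum_add_distrib, Finset.mul_sum, hd, Finset.sum_mul]
    congr 1
    rw [Finset.sum_comm]
    refine Finset.sum_congr rfl fun j _ => Finset.sum_congr rfl fun i _ => ?_
    ring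
  -- Only the square of the remainder R is dropped; the cross terms are small on average.
  have hpt : ∀ l, (∑ j, d j * U j l) * (∑ j, d j * U j l)
        + (2 * ((∑ j, d j * U j l) * ∑ i, v i * R i l)
        + (2 * ((∑ i, v i * y i l) * ∑ i, v i * μ i l)
        + (∑ i, v i * μ i l) * ∑ i, v i * μ i l))
      ≤ (∑ i, v i * (y i l + μ i l)) ^ 2 := by
    intro l
    simp only [mul_add, Finset.sum_add_distrib]
    have := hvy l
    set A := ∑ i, v i * y i l
    set D := ∑ j, d j * U j l
    set R' := ∑ i, v i * R i l
    set μ' := ∑ i, v i * μ i l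
    rw [this]
    nlinarith [sq_nonneg R']
  have havg := average_mono (p := p) (n := n) hpt
  rw [average_add, average_add, average_add, average_const_mul, average_const_mul,
    average_bilin, average_bilin, average_bilin, average_bilin] at havg
  have e1 := (abs_le.1 (hU d d)).1
  have e2 := (abs_le.1 (hUR d v)).1
  have e3 := (abs_le.1 (hyμ v v)).1
  have e4 := (abs_le.1 (hμ v v)).1
  have e5 := hV d
  have e6 := hG v
  simp only [mul_sub, Finset.sum_sub_distrib] at e1 e4
  have e7 : ∑ i, ∑ j, v i * v j * average p n (fun l => μ j l * y i l)
      = ∑ i, ∑ j, v i * v j * average p n (fun l => y i l * μ j l) := by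
    simp only [mul_comm (μ _ _)]
  rw [e7] at e3
  set Sv := ∑ i, v i ^ 2 with hSv
  set Sd := ∑ j, d j ^ 2 with hSd
  have hSv0 : 0 ≤ Sv := Finset.sum_nonneg fun i _ => sq_nonneg _
  have hSd0 : 0 ≤ Sd := Finset.sum_nonneg fun i _ => sq_nonneg _
  have e8 : ρ * Sv ≤ Sd := e6
  -- The total error is 4 τ Sd + 8 τ Sv, at most c₀ Sd / 2 + ρ c₀ Sv / 4, while c₀ Sd / 2 ≥ ρ c₀ Sv
  -- / 2 remains.
  have e9 : 8 * τ * Sd ≤ c₀ * Sd := mul_le_mul_of_nonneg_right hτ₁ hSd0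
  have e10 : 32 * τ * Sv ≤ ρ * c₀ * Sv := mul_le_mul_of_nonneg_right hτ₂ hSv0
  have hc₀ : 0 ≤ c₀ := by linarith
  have e11 : c₀ * (ρ * Sv) ≤ c₀ * Sd := mul_le_mul_of_nonneg_left e8 hc₀
  nlinarith

lemma measurable_centered {Ω : Type*} {η ε u : ℤ → Ω → ℝ} [MeasurableSpace Ω] {P : Measure Ω}
    (hu : ∀ l, Measurable[innovation η ε l] (u l)) (l : ℤ) :
    Measurable[innovation η ε l] (centered P u l) :=
  (hu l).sub_const _

section Model

variable {Ω : Type*} {η ε : ℤ → Ω → ℝ} [m0 : MeasurableSpace Ω] {P : Measure Ω} {f : ℝ → ℝ}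
  {m B : ℝ} {u : ℤ → Ω → ℝ} {c : ℝ} {g : ℕ → ℝ} [IsProbabilityMeasure P]

namespace BoundedModel

/-- Off the diagonal the earlier innovation is a predictable weight for the later, centered one. On
the diagonal squares are compared with their means; no limit is claimed since only a lower bound on
these variances is used. -/
lemma ae_tendsto_average_innovation (H : BoundedModel P η ε f m B)
    (hu : ∀ l, Measurable[innovation η ε l] (u l)) (huc : ∀ l ω, |u l ω| ≤ c) (p : ℕ)
    (i j : ℕ) :
    ∀ᵐ ω ∂P, Tendsto (fun n : ℕ => average p n (fun l =>
        centered P u (l - (i + 1 : ℤ)) ω * centered P u (l - (j + 1 : ℤ)) ω)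
        - if i = j then average p n (fun l => ∫ ω', centered P u (l - (i + 1 : ℤ)) ω' ^ 2 ∂P)
          else 0) atTop (nhds 0) := by
  have hcm := fun l => measurable_centered (P := P) hu l
  have hcc := abs_centered_le (P := P) huc
  have hlt : ∀ i j : ℕ, i < j → ∀ᵐ ω ∂P, Tendsto (fun n : ℕ => average p n (fun l =>
        centered P u (l - (j + 1 : ℤ)) ω * centered P u (l - (i + 1 : ℤ)) ω)) atTop (nhds 0) := by
    intro i j hij
    exact H.ae_tendsto_average (i + 1) (φ := fun l => centered P u (l - (j + 1 : ℤ)))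
      (Y := fun _ l => u (l - (i + 1 : ℤ)))
      (fun l => (hcm _).mono (innovation_le_past (by omega)) le_rfl) (fun l ω => hcc _ ω)
      (fun _ l => hu _) (Eventually.of_forall fun _ l ω => huc _ ω) (p + 1)
  rcases lt_trichotomy i j with h | h | h
  · filter_upwards [hlt i j h] with ω hω
    simpa [h.ne, mul_comm] using hω
  · subst h
    have := H.ae_tendsto_average (i + 1) (φ := fun _ _ => 1)
      (Y := fun _ l ω => centered P u (l - (i + 1 : ℤ)) ω ^ 2) (d := 1) (c := (2 * c) ^ 2)
      (fun l => measurable_const) (fun l ω => by simp)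
      (fun _ l => (hcm _).pow_const 2) (Eventually.of_forall fun _ l ω => by
        rw [abs_pow]; exact pow_le_pow_left₀ (abs_nonneg _) (hcc _ ω) 2) (p + 1)
    filter_upwards [this] with ω hω
    refine hω.congr fun n => ?_
    simp only [average, if_true, one_mul, Finset.sum_sub_distrib, mul_sub, sq]
  · filter_upwards [hlt j i h] with ω hω
    simpa [h.ne'] using hω

/-- The Gram matrix dominates the Gram matrix of the means by a positive multiple of the
identity. -/
theorem ae_gram_lower_bound (H : BoundedModel P η ε f m B)
    (hg : Summable fun j => |g j|) (hg0 : g 0 = 1)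
    (hu : ∀ l, Measurable[innovation η ε l] (u l))
    (huc : ∀ l ω, |u l ω| ≤ c) {T : ℕ} (hT : 0 < T)
    (hper : Function.Periodic (fun j => ∫ ω, u j ω ∂P) (T : ℤ)) {c₀ : ℝ} (hc₀ : 0 < c₀)
    (hvar : ∀ l, c₀ ≤ ∫ ω, centered P u l ω ^ 2 ∂P) (p : ℕ) :
    ∃ δ > 0, ∀ᵐ ω ∂P, ∀ᶠ n : ℕ in atTop, ∀ v : Fin p → ℝ,
      (T : ℝ)⁻¹ * ∑ r ∈ Finset.range T,
          (∑ i, v i * causalFilter g (fun j => ∫ ω, u j ω ∂P) (r - ((i : ℕ) + 1 : ℤ))) ^ 2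
        + δ * ∑ i, v i ^ 2
      ≤ average p n fun l =>
        (∑ i, v i * causalFilter g (fun j => u j ω) (l - ((i : ℕ) + 1 : ℤ))) ^ 2 := by
  obtain ⟨ρ, hρ, hG⟩ := exists_toeplitz_lower_bound p hg0
  set ν : ℤ → ℝ := fun j => ∫ ω, u j ω ∂P with hν
  have hνc : ∀ j, |ν j| ≤ c := fun j => abs_integral_le_of_abs_le (huc j)
  have hcm := fun l => measurable_centered (P := P) hu l
  have hcc := abs_centered_le (P := P) huc
  set x := causalFilter g ν with hx
  have hxb := abs_causalFilter_le hg hνc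
  have hxper : Function.Periodic x (T : ℤ) := periodic_causalFilter hper
  set Gs := ∑' j, |g j| with hGs
  set R : Fin p → ℕ → Ω → ℝ := fun i l ω =>
    ∑' j : ℕ, g (j + (p - i)) * centered P u (l - p - 1 - j) ω with hR
  have hRm : ∀ i (l : ℕ), Measurable[past η ε (l - p)] (R i l) := fun i l =>
    measurable_tsum_past (g := fun j => g (j + (p - i))) hcm (fun j : ℕ => (l : ℤ) - p - 1 - j)
      fun j => by omega
  have hRb : ∀ i l ω, |R i l ω| ≤ (∑' j : ℕ, |g (j + (p - i))|) * (2 * c) := fun i l ω =>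
    abs_causalFilter_le (g := fun j => g (j + (p - i)))
      (hg.comp_injective (add_left_injective (p - (i : ℕ)))) (fun n => hcc n ω) (l - p - 1)
  have hUR : ∀ i j : Fin p, ∀ᵐ ω ∂P, Tendsto (fun n : ℕ => average p n (fun l =>
      centered P u (l - ((i : ℕ) + 1 : ℤ)) ω * R j l ω)) atTop (nhds 0) := by
    intro i j
    have := H.ae_tendsto_average ((i : ℕ) + 1) (φ := R j)
      (Y := fun _ l => u (l - ((i : ℕ) + 1 : ℤ)))
      (fun l => (hRm j l).mono (past_mono (by omega)) le_rfl) (hRb j)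
      (fun _ l => hu _) (Eventually.of_forall fun _ l ω => huc _ ω) (p + 1)
    filter_upwards [this] with ω hω
    refine hω.congr fun n => ?_
    simp only [average, centered, mul_comm]
  have hyμ : ∀ i j : Fin p, ∀ᵐ ω ∂P, Tendsto (fun n : ℕ => average p n (fun l =>
      x (l - ((j : ℕ) + 1 : ℤ))
        * causalFilter g (fun q => centered P u q ω) (l - ((i : ℕ) + 1 : ℤ)))) atTop (nhds 0) :=
    fun i j => H.ae_tendsto_average_causalFilter hg hu huc
      (w := fun l => x (l - ((j : ℕ) + 1 : ℤ))) (fun l => hxb _) _ p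
  have hμ : ∀ i j : Fin p, Tendsto (fun n : ℕ => average p n (fun l =>
      x (l - ((i : ℕ) + 1 : ℤ)) * x (l - ((j : ℕ) + 1 : ℤ)))
      - (T : ℝ)⁻¹ * ∑ r ∈ Finset.range T,
        x (r - ((i : ℕ) + 1 : ℤ)) * x (r - ((j : ℕ) + 1 : ℤ))) atTop (nhds 0) := by
    intro i j
    have := tendsto_average_periodic hT
      (F := fun l => x (l - ((i : ℕ) + 1 : ℤ)) * x (l - ((j : ℕ) + 1 : ℤ)))
      (c := Gs * c * (Gs * c)) (fun l => by
        have e : ∀ k : ℕ, x (l + (T : ℤ) - (k + 1 : ℤ)) = x (l - (k + 1 : ℤ)) := fun k => by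
          rw [show l + (T : ℤ) - (k + 1 : ℤ) = l - (k + 1 : ℤ) + T by ring, hxper]
        simp only [e]) (fun l => by
        rw [abs_mul]
        exact mul_le_mul (hxb _) (hxb _) (abs_nonneg _) ((abs_nonneg _).trans (hxb 0))) p
    exact tendsto_sub_nhds_zero_iff.2 this
  have hU := fun i j : Fin p => H.ae_tendsto_average_innovation hu huc p i j
  set τ := min (c₀ / 16) (ρ * c₀ / 64) with hτ
  have hτ0 : 0 < τ := lt_min (by positivity) (by positivity)
  have hτ1 : τ ≤ c₀ / 16 := min_le_left _ _
  have hτ2 : τ ≤ ρ * c₀ / 64 := min_le_right _ _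
  -- The variance bound is halved because the averages divide by n but have only n - p ≥ n / 2
  -- terms; τ is fitted to c₀ / 2.
  refine ⟨ρ * (c₀ / 2) / 4, by positivity, ?_⟩
  filter_upwards [ae_all_iff.2 fun i => ae_all_iff.2 (hU i),
    ae_all_iff.2 fun i => ae_all_iff.2 (hUR i), ae_all_iff.2 fun i => ae_all_iff.2 (hyμ i)]
    with ω w1 w2 w3
  filter_upwards [eventually_abs_bilin_le w1 hτ0, eventually_abs_bilin_le w2 hτ0,
    eventually_abs_bilin_le w3 hτ0, eventually_abs_bilin_le hμ hτ0, eventually_ge_atTop (2 * p + 1)]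
    with n v1 v2 v3 v4 hn v
  have hn0 : (0 : ℝ) < n := by exact_mod_cast (by omega : 0 < n)
  have hV : ∀ w : Fin p → ℝ, c₀ / 2 * ∑ i, w i ^ 2 ≤ ∑ i, ∑ j, w i * w j *
      (if (i : ℕ) = j then
        average p n (fun l => ∫ ω', centered P u (l - ((i : ℕ) + 1 : ℤ)) ω' ^ 2 ∂P)
      else 0) := by
    intro w
    rw [Finset.mul_sum]
    refine Finset.sum_le_sum fun i _ => ?_
    rw [Finset.sum_eq_single i]
    · rw [if_pos rfl, mul_comm, ← sq]
      refine mul_le_mul_of_nonneg_left ?_ (sq_nonneg _)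
      have h1 : (Finset.Icc (p + 1) n).card • c₀ ≤ ∑ l ∈ Finset.Icc (p + 1) n,
          ∫ ω', centered P u (l - ((i : ℕ) + 1 : ℤ)) ω' ^ 2 ∂P :=
        Finset.card_nsmul_le_sum _ _ _ fun l _ => hvar _
      rw [Nat.card_Icc, nsmul_eq_mul] at h1
      have h2 : (n : ℝ) / 2 ≤ ((n + 1 - (p + 1) : ℕ) : ℝ) := by
        rw [div_le_iff₀ two_pos]
        exact_mod_cast (by omega : n ≤ (n + 1 - (p + 1)) * 2)
      rw [average, le_inv_mul_iff₀ hn0]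
      nlinarith
    · intro j _ hji
      rw [if_neg fun h => hji (Fin.ext h.symm), mul_zero]
    · intro h; exact absurd (Finset.mem_univ _) h
  have key := average_sq_lower_bound (p := p) (n := n)
    (y := fun i l => causalFilter g (fun q => centered P u q ω) (l - ((i : ℕ) + 1 : ℤ)))
    (R := fun i l => R i l ω) (U := fun i l => centered P u (l - ((i : ℕ) + 1 : ℤ)) ω)
    (μ := fun i l => x (l - ((i : ℕ) + 1 : ℤ)))
    (G := toeplitz p g) (fun i l => causalFilter_eq_toeplitz_add hg (fun j => hcc j ω) i l)
    hG hV hτ0 (by linarith) (by linarith) v1 v2 v3 v4 v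
  have e1 : ∀ i l, causalFilter g (fun q => centered P u q ω) (l - ((i : ℕ) + 1 : ℤ))
      + x (l - ((i : ℕ) + 1 : ℤ)) = causalFilter g (fun q => u q ω) (l - ((i : ℕ) + 1 : ℤ)) := by
    intro i l
    rw [causalFilter_centered hg huc, ← hν, ← hx]
    ring
  simp only [e1] at key
  refine le_trans (le_of_eq ?_) key
  congr 1
  have e2 : ∀ r : ℕ, (∑ i : Fin p, v i * x (r - ((i : ℕ) + 1 : ℤ))) ^ 2
      = ∑ i, ∑ j, v i * v j * (x (r - ((i : ℕ) + 1 : ℤ)) * x (r - ((j : ℕ) + 1 : ℤ))) := by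
    intro r
    rw [sq, Finset.sum_mul_sum]
    refine Finset.sum_congr rfl fun i _ => Finset.sum_congr rfl fun j _ => ?_
    ring
  simp only [e2]
  rw [Finset.sum_comm, Finset.mul_sum]
  refine Finset.sum_congr rfl fun i _ => ?_
  rw [Finset.sum_comm, Finset.mul_sum]
  refine Finset.sum_congr rfl fun j _ => ?_
  rw [← Finset.mul_sum]
  ring

end BoundedModel

end Model


/-! ### Kernel regression of the regressors -/

/-- The population version of the kernel regression of a sequence with periodic mean `μ`. -/
noncomputable def meanRegression (T : ℕ) (s : ℤ → ℝ) (K f : ℝ → ℝ) (h : ℝ) (μ : ℤ → ℝ)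
    (x : ℝ) : ℝ :=
  (∑ r ∈ Finset.range T, smoothing K f h (x - s r) * μ r) / mixture T s K f h x

/-- The conditional mean of a sequence with periodic mean `μ` given the exogenous variable. -/
noncomputable def limitRegression (T : ℕ) (s : ℤ → ℝ) (f : ℝ → ℝ) (μ : ℤ → ℝ) (x : ℝ) : ℝ :=
  (∑ r ∈ Finset.range T, f (x - s r) * μ r) / ∑ r ∈ Finset.range T, f (x - s r)

lemma abs_div_sub_div_le {A a B b κ τ C : ℝ} (hκ : 0 < κ) (hb : κ ≤ b) (hB : |B - b| ≤ τ)
    (hA : |A - a| ≤ τ) (hτ : τ ≤ κ / 2) (ha : |a| ≤ C) :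
    |A / B - a / b| ≤ τ * (2 / κ + 2 * C / κ ^ 2) := by
  have hB' : κ / 2 ≤ B := by linarith [(abs_le.1 hB).1]
  have hB0 : 0 < B := by linarith
  have hb0 : 0 < b := by linarith
  have hτ0 : 0 ≤ τ := (abs_nonneg _).trans hB
  have hC0 : 0 ≤ C := (abs_nonneg _).trans ha
  have h1 : A / B - a / b = (A - a) / B + a * (b - B) / (B * b) := by
    field_simp
    ring
  rw [h1]
  refine (abs_add_le _ _).trans ?_
  rw [abs_div, abs_div, abs_mul, abs_of_pos hB0, abs_of_pos (mul_pos hB0 hb0), abs_sub_comm b B]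
  have h2 : |A - a| / B ≤ τ / (κ / 2) := by gcongr
  have h3 : |a| * |B - b| / (B * b) ≤ C * τ / (κ / 2 * κ) := by gcongr
  calc _ ≤ τ / (κ / 2) + C * τ / (κ / 2 * κ) := add_le_add h2 h3
    _ = _ := by field_simp

section Model

variable {Ω : Type*} {η ε : ℤ → Ω → ℝ} [m0 : MeasurableSpace Ω] {P : Measure Ω} {f : ℝ → ℝ}
  {m B : ℝ} {u : ℤ → Ω → ℝ} {c : ℝ} {g : ℕ → ℝ} [IsProbabilityMeasure P]
  {T : ℕ} {s : ℤ → ℝ} {K : ℝ → ℝ} {γ : ℝ≥0} {h : ℕ → ℝ}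

namespace BoundedModel

/-- The lag is known before e_l is drawn, so the kernel factor may be replaced by its mean. This
mean is periodic in l, and seasonal averages then replace the lags by their means. No rate is
required, since this enters only the contraction. -/
theorem ae_kernelRegression_regressor (H : BoundedModel P η ε f m B) (hK : IsKernel K γ)
    (hh : IsBandwidth h) (hT : 0 < T) (hs : Function.Periodic s (T : ℤ))
    (hg : Summable fun j => |g j|) (hu : ∀ l, Measurable[innovation η ε l] (u l))
    (huc : ∀ l ω, |u l ω| ≤ c) (hper : Function.Periodic (fun j => ∫ ω, u j ω ∂P) (T : ℤ))
    (p i : ℕ) :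
    ∀ᵐ ω ∂P, ∀ τ > 0, ∀ᶠ n : ℕ in atTop, ∀ x ∈ inputSupport T s m,
      |kernelRegression p K (h n) (fun l => s l + η l ω) n
          (fun l => causalFilter g (fun j => u j ω) (l - (i + 1 : ℤ))) x
        - meanRegression T s K f (h n)
          (fun r => causalFilter g (fun j => ∫ ω', u j ω' ∂P) (r - (i + 1 : ℤ))) x| ≤ τ := by
  obtain ⟨L, hL⟩ := hK.lipschitz
  have hKm : Measurable K := hL.continuous.measurable
  obtain ⟨R, hR⟩ := exists_bound_inputSupport T s m
  obtain ⟨M, hM0, hM⟩ := H.density.exists_le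
  obtain ⟨κ, hκ, hmix⟩ := hh.eventually_mixture_lower_bound H.density hK hT hs
  set Gs := ∑' j, |g j| with hGs
  set ν : ℤ → ℝ := fun j => ∫ ω, u j ω ∂P with hν
  have hνc : ∀ j, |ν j| ≤ c := fun j => abs_integral_le_of_abs_le (huc j)
  set Z : ℕ → Ω → ℝ := fun l ω => causalFilter g (fun j => u j ω) (l - (i + 1 : ℤ)) with hZ
  set μ : ℤ → ℝ := fun r => causalFilter g ν (r - (i + 1 : ℤ)) with hμ
  have hZb : ∀ l ω, |Z l ω| ≤ Gs * c := fun l ω => abs_causalFilter_le hg (fun j => huc j ω) _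
  have hμb : ∀ l, |μ l| ≤ Gs * c := fun l => abs_causalFilter_le hg hνc _
  have hGc : 0 ≤ Gs * c := (abs_nonneg _).trans (hμb 0)
  have hZm : ∀ l : ℕ, Measurable[past η ε l] (Z l) := fun l =>
    measurable_causalFilter hu (by omega)
  obtain ⟨C₁, hC₁⟩ := H.ae_uniform_kernel_sum s hL hK.integrable (φ := fun _ _ => 1)
    (ψ := fun _ _ => 1) (d := 1) (c := 1) (fun _ => measurable_const) (fun _ _ => by simp)
    (fun _ => measurable_const) (fun _ _ => by simp) hh (p + 1) R
  obtain ⟨C₂, hC₂⟩ := H.ae_uniform_kernel_sum s hL hK.integrable (φ := Z)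
    (ψ := fun _ _ => 1) (c := 1) hZm hZb
    (fun _ => measurable_const) (fun _ _ => by simp) hh (p + 1) R
  have hres : ∀ᵐ ω ∂P, ∀ r ∈ Finset.range T, Tendsto (fun n : ℕ => (n : ℝ)⁻¹ *
      ∑ l ∈ Finset.Icc (p + 1) n with l % T = r, Z l ω) atTop (nhds ((T : ℝ)⁻¹ * μ r)) :=
    (ae_ball_iff (Finset.range T).countable_toSet).2 fun r hr =>
      H.ae_tendsto_residue_average hg hu huc hT hper _ p (Finset.mem_range.1 hr)
  have hT' : (0 : ℝ) < T := by exact_mod_cast hT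
  set J := M * ∫ u, |K u| with hJ
  have hJ0 : 0 ≤ J := mul_nonneg hM0.le (integral_nonneg fun u => abs_nonneg _)
  have hw : ∀ (n : ℕ) (y : ℝ), |smoothing K f (h n) y| ≤ J := fun n y =>
    H.density.abs_smoothing_le hK.integrable hM (h n) y
  set D := (T : ℝ) * (J * (p + 1)) with hD
  filter_upwards [hC₁, hC₂, hres] with ω w1 w2 w3
  -- One modulus, free of x, for numerator and denominator both, to be fed into
  -- `abs_div_sub_div_le`.
  set ρ : ℕ → ℝ := fun n => T * ((|C₁| + |C₂|) * √(Real.log n / (n * h n)) + D / n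
    + J * ∑ r ∈ Finset.range T, |(n : ℝ)⁻¹ *
      ∑ l ∈ Finset.Icc (p + 1) n with l % T = r, Z l ω - (T : ℝ)⁻¹ * μ r|) with hρ
  have hρ0 : Tendsto ρ atTop (nhds 0) := by
    have t1 : Tendsto (fun n : ℕ => (|C₁| + |C₂|) * √(Real.log n / (n * h n))) atTop (nhds 0) := by
      simpa using hh.log_div.sqrt.const_mul (|C₁| + |C₂|)
    have t2 : Tendsto (fun n : ℕ => D / (n : ℝ)) atTop (nhds 0) :=
      tendsto_const_div_atTop_nhds_zero_nat D
    have t3 : Tendsto (fun n : ℕ => ∑ r ∈ Finset.range T, |(n : ℝ)⁻¹ *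
      ∑ l ∈ Finset.Icc (p + 1) n with l % T = r, Z l ω - (T : ℝ)⁻¹ * μ r|) atTop (nhds 0) := by
      have : Tendsto (fun n : ℕ => ∑ r ∈ Finset.range T, |(n : ℝ)⁻¹ *
        ∑ l ∈ Finset.Icc (p + 1) n with l % T = r, Z l ω - (T : ℝ)⁻¹ * μ r|) atTop
        (nhds (∑ r ∈ Finset.range T, |(T : ℝ)⁻¹ * μ r - (T : ℝ)⁻¹ * μ r|)) :=
        tendsto_finsetSum _ fun r hr => ((w3 r hr).sub_const _).abs
      simpa using this
    simpa using ((t1.add t2).add (t3.const_mul J)).const_mul (T : ℝ)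
  intro τ hτ
  set Ca := (T : ℝ) * (J * (Gs * c)) with hCa
  set E := 2 / κ + 2 * Ca / κ ^ 2 with hE
  have hE0 : 0 < E := by positivity
  filter_upwards [w1, w2, hmix, hh.pos, eventually_ge_atTop 1,
    hρ0.eventually (gt_mem_nhds (half_pos hκ)), hρ0.eventually (gt_mem_nhds (div_pos hτ hE0))]
    with n v1 v2 v3 hhn hn1 v4 v5 x hx
  have hn0 : (0 : ℝ) < n := by exact_mod_cast (by omega : 0 < n)
  have hnh : 0 < n * h n := by positivity
  have u1 := v1 n le_rfl x (hR x hx)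
  have u2 := v2 n le_rfl x (hR x hx)
  simp only [one_mul, H.integral_kernel hKm s _ x hhn] at u1 u2
  set w : ℤ → ℝ := fun l => smoothing K f (h n) (x - s l) with hwdef
  have hwper : Function.Periodic w (T : ℤ) := periodic_smoothing hs K f (h n) x
  set r₀ := √(Real.log n / (n * h n)) with hr₀
  have hr₀0 : 0 ≤ r₀ := Real.sqrt_nonneg _
  set Δ := ∑ r ∈ Finset.range T, |(n : ℝ)⁻¹ *
      ∑ l ∈ Finset.Icc (p + 1) n with l % T = r, Z l ω - (T : ℝ)⁻¹ * μ r| with hΔ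
  have hΔ0 : 0 ≤ Δ := Finset.sum_nonneg fun r _ => abs_nonneg _
  have hD0 : 0 ≤ D / n := by positivity
  set a := ∑ r ∈ Finset.range T, w r * μ r with ha
  set b := ∑ r ∈ Finset.range T, w r with hb
  set Num := ∑ l ∈ Finset.Icc (p + 1) n, Z l ω * K ((x - (s l + η l ω)) / h n) with hNum
  set Mass := kernelMass p K (h n) (fun l => s l + η l ω) n x with hMass
  have hbκ : κ ≤ b := v3 x hx
  have haC : |a| ≤ Ca := by
    refine (Finset.abs_sum_le_sum_abs _ _).trans ?_
    refine (Finset.sum_le_card_nsmul _ _ (J * (Gs * c)) fun r _ => ?_).trans ?_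
    · rw [abs_mul]
      exact mul_le_mul (hw n _) (hμb _) (abs_nonneg _) hJ0
    · rw [Finset.card_range, nsmul_eq_mul]
  have hBb : |T * (Mass / (n * h n)) - b| ≤ ρ n := by
    have q1 := abs_sum_periodic_sub_le hT hwper (fun l => hw n _) p n
    rw [← hD] at q1
    have q2 : |Mass - h n * ∑ l ∈ Finset.Icc (p + 1) n, w l| ≤ |C₁| * (n * h n * r₀) := by
      rw [hMass, kernelMass, Finset.mul_sum, ← Finset.sum_sub_distrib]
      exact u1.trans (mul_le_mul_of_nonneg_right (le_abs_self _) (by positivity))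
    have q3 : T * (Mass / (n * h n)) - b
        = T * ((Mass - h n * ∑ l ∈ Finset.Icc (p + 1) n, w l) / (n * h n)
          + (∑ l ∈ Finset.Icc (p + 1) n, w l - n / T * b) / n) := by
      field_simp
      ring
    rw [q3, abs_mul, abs_of_pos hT']
    refine mul_le_mul_of_nonneg_left ?_ hT'.le
    refine (abs_add_le _ _).trans ?_
    rw [abs_div, abs_div, abs_of_pos hnh, abs_of_pos hn0]
    have q4 : |Mass - h n * ∑ l ∈ Finset.Icc (p + 1) n, w l| / (n * h n) ≤ |C₁| * r₀ := by
      rw [div_le_iff₀ hnh]; linarith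
    have q5 : |∑ l ∈ Finset.Icc (p + 1) n, w l - n / T * b| / n ≤ D / n := by gcongr
    have q6 : 0 ≤ |C₂| * r₀ := by positivity
    have q7 : 0 ≤ J * Δ := by positivity
    linarith
  have hAa : |T * (Num / (n * h n)) - a| ≤ ρ n := by
    have q1 : ∑ l ∈ Finset.Icc (p + 1) n, w l * Z l ω
        = ∑ r ∈ Finset.range T, w r * ∑ l ∈ Finset.Icc (p + 1) n with l % T = r, Z l ω :=
      sum_periodic_mul hT hwper _ _
    have q2 : |Num - h n * ∑ l ∈ Finset.Icc (p + 1) n, w l * Z l ω| ≤ |C₂| * (n * h n * r₀) := by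
      refine le_trans (le_of_eq ?_)
        (u2.trans (mul_le_mul_of_nonneg_right (le_abs_self _) (by positivity)))
      rw [hNum, Finset.mul_sum, ← Finset.sum_sub_distrib]
      congr 1
      refine Finset.sum_congr rfl fun l _ => ?_
      ring
    have q3 : |(n : ℝ)⁻¹ * ∑ l ∈ Finset.Icc (p + 1) n, w l * Z l ω - (T : ℝ)⁻¹ * a| ≤ J * Δ := by
      rw [q1, ha, hΔ, Finset.mul_sum, Finset.mul_sum, Finset.mul_sum, ← Finset.sum_sub_distrib]
      refine (Finset.abs_sum_le_sum_abs _ _).trans (Finset.sum_le_sum fun r _ => ?_)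
      rw [mul_left_comm, mul_left_comm (T : ℝ)⁻¹, ← mul_sub, abs_mul]
      exact mul_le_mul_of_nonneg_right (hw n _) (abs_nonneg _)
    have q4 : T * (Num / (n * h n)) - a
        = T * ((Num - h n * ∑ l ∈ Finset.Icc (p + 1) n, w l * Z l ω) / (n * h n)
          + ((n : ℝ)⁻¹ * ∑ l ∈ Finset.Icc (p + 1) n, w l * Z l ω - (T : ℝ)⁻¹ * a)) := by
      field_simp
      ring
    rw [q4, abs_mul, abs_of_pos hT']
    refine mul_le_mul_of_nonneg_left ?_ hT'.le
    refine (abs_add_le _ _).trans ?_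
    rw [abs_div, abs_of_pos hnh]
    have q5 : |Num - h n * ∑ l ∈ Finset.Icc (p + 1) n, w l * Z l ω| / (n * h n) ≤ |C₂| * r₀ := by
      rw [div_le_iff₀ hnh]; linarith
    have q6 : 0 ≤ |C₁| * r₀ := by positivity
    linarith
  have key := abs_div_sub_div_le hκ hbκ hBb hAa v4.le haC
  rw [mul_div_mul_left _ _ hT'.ne', div_div_div_cancel_right₀ hnh.ne'] at key
  refine le_trans key ?_
  have := (lt_div_iff₀ hE0).1 v5
  exact this.le

end BoundedModel

end Model


/-! ### The limit of the backfitting operator -/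

section Limit

variable {f : ℝ → ℝ} {m : ℝ} {T : ℕ} {s : ℤ → ℝ} {K : ℝ → ℝ} {γ : ℝ≥0}

lemma measurable_meanRegression (hf : IsIntervalDensity f m) (hK : Measurable K) (h : ℝ)
    (μ : ℤ → ℝ) : Measurable (meanRegression T s K f h μ) := by
  have h1 : ∀ r : ℕ, Measurable fun x => smoothing K f h (x - s r) := fun r =>
    (hf.measurable_smoothing hK h).comp (measurable_id.sub_const _)
  refine Measurable.div ?_ ?_
  · exact Finset.measurable_sum _ fun r _ => (h1 r).mul_const _
  · exact Finset.measurable_sum _ fun r _ => h1 r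

lemma measurable_limitRegression (hf : IsIntervalDensity f m) (μ : ℤ → ℝ) :
    Measurable (limitRegression T s f μ) := by
  have h1 : ∀ r : ℕ, Measurable fun x => f (x - s r) := fun r =>
    hf.measurable.comp (measurable_id.sub_const _)
  refine Measurable.div ?_ ?_
  · exact Finset.measurable_sum _ fun r _ => (h1 r).mul_const _
  · exact Finset.measurable_sum _ fun r _ => h1 r

lemma abs_meanRegression_le (hf : IsIntervalDensity f m) (hK : Integrable K) {M : ℝ}
    (hM : ∀ x, f x ≤ M) {μ : ℤ → ℝ} {C : ℝ} (hμ : ∀ r, |μ r| ≤ C) {κ h x : ℝ} (hκ : 0 < κ)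
    (hx : κ ≤ mixture T s K f h x) :
    |meanRegression T s K f h μ x| ≤ T * (M * (∫ u, |K u|) * C) / κ := by
  have hC0 : 0 ≤ C := (abs_nonneg _).trans (hμ 0)
  have hJ0 : 0 ≤ M * ∫ u, |K u| := (abs_nonneg _).trans (hf.abs_smoothing_le hK hM h 0)
  have hx0 : 0 < mixture T s K f h x := hκ.trans_le hx
  rw [meanRegression, abs_div, abs_of_pos hx0]
  have h1 : |∑ r ∈ Finset.range T, smoothing K f h (x - s r) * μ r|
      ≤ T * (M * (∫ u, |K u|) * C) := by
    refine (Finset.abs_sum_le_sum_abs _ _).trans ?_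
    refine (Finset.sum_le_card_nsmul _ _ (M * (∫ u, |K u|) * C) fun r _ => ?_).trans ?_
    · rw [abs_mul]
      exact mul_le_mul (hf.abs_smoothing_le hK hM h _) (hμ _) (abs_nonneg _) hJ0
    · rw [Finset.card_range, nsmul_eq_mul]
  gcongr

/-- The population regression converges in the mean. -/
lemma tendsto_integral_meanRegression (hf : IsIntervalDensity f m) (hK : IsKernel K γ)
    {h : ℕ → ℝ} (hh : IsBandwidth h) (hT : 0 < T) (hs : Function.Periodic s (T : ℤ))
    {μ : ℤ → ℝ} {C : ℝ} (hμ : ∀ r, |μ r| ≤ C) (r : ℤ) :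
    Tendsto (fun n => ∫ y, meanRegression T s K f (h n) μ (s r + y) * f y) atTop
      (nhds (∫ y, limitRegression T s f μ (s r + y) * f y)) := by
  obtain ⟨M, hM0, hM⟩ := hf.exists_le
  obtain ⟨κ, hκ, hmix⟩ := hh.eventually_mixture_lower_bound hf hK hT hs
  refine tendsto_integral_filter_of_dominated_convergence
    (fun y => T * (M * (∫ u, |K u|) * C) / κ * f y) ?_ ?_ (hf.integrable.const_mul _) ?_
  · refine Eventually.of_forall fun n => ?_
    exact (((measurable_meanRegression hf hK.measurable _ _).comp
      (measurable_const_add _)).mul hf.measurable).aestronglyMeasurable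
  · filter_upwards [hmix] with n hn
    refine ae_of_all _ fun y => ?_
    by_cases hy : y ∈ Set.Icc (-m) m
    · rw [norm_mul, Real.norm_eq_abs, Real.norm_eq_abs, abs_of_nonneg (hf.nonneg y)]
      exact mul_le_mul_of_nonneg_right (abs_meanRegression_le hf hK.integrable hM hμ hκ
        (hn _ (mem_inputSupport hT hs hy r))) (hf.nonneg y)
    · rw [hf.eq_zero y hy]
      simp
  -- The finitely many edges of the translated supports are the only places where pointwise
  -- convergence may fail.
  · have hfin : (⋃ q ∈ Finset.range T, ({s q - s r + m, s q - s r - m} : Set ℝ)).Finite :=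
      (Finset.range T).finite_toSet.biUnion fun q _ => by simp
    filter_upwards [hfin.countable.ae_notMem volume] with y hy
    by_cases hym : y ∈ Set.Icc (-m) m
    swap
    · rw [hf.eq_zero y hym]
      simp
    have hlim : ∀ q ∈ Finset.range T, Tendsto (fun n => smoothing K f (h n) (s r + y - s q)) atTop
        (nhds (f (s r + y - s q))) := by
      intro q hq
      refine hf.tendsto_smoothing hK.integrable hK.integral_eq_one hh.tendsto_zero ?_ ?_
      · intro h1
        refine hy (Set.mem_biUnion hq (Or.inl ?_))
        linarith
      · intro h1
        refine hy (Set.mem_biUnion hq (Or.inr ?_))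
        show y = s q - s r - m
        linarith
    have hpos : 0 < ∑ q ∈ Finset.range T, f (s r + y - s q) := by
      obtain ⟨q, hq, hxq⟩ := exists_residue_of_mem_inputSupport hT hs (mem_inputSupport hT hs hym r)
      exact Finset.sum_pos' (fun q _ => hf.nonneg _) ⟨q, hq, hf.pos _ hxq⟩
    refine Tendsto.mul_const _ ?_
    exact (tendsto_finsetSum _ fun q hq => (hlim q hq).mul_const _).div
      (tendsto_finsetSum _ hlim) hpos.ne'

/-- The integrand of the limiting bilinear form. -/
noncomputable def limitDensity (T : ℕ) (s : ℤ → ℝ) (f : ℝ → ℝ) (μ μ' : ℤ → ℝ) (x : ℝ) : ℝ :=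
  (∑ r ∈ Finset.range T, f (x - s r) * μ r) * (∑ r ∈ Finset.range T, f (x - s r) * μ' r)
    / ∑ r ∈ Finset.range T, f (x - s r)

/-- The limiting bilinear form, evaluated at two periodic means. -/
noncomputable def limitForm (T : ℕ) (s : ℤ → ℝ) (f : ℝ → ℝ) (μ μ' : ℤ → ℝ) : ℝ :=
  (T : ℝ)⁻¹ * ∫ x, limitDensity T s f μ μ' x

lemma integrable_translate (hf : IsIntervalDensity f m) (r : ℝ) :
    Integrable fun x => f (x - r) := hf.integrable.comp_sub_right r

lemma abs_weighted_sum_le (hf : IsIntervalDensity f m) {μ : ℤ → ℝ} {C : ℝ} (hμ : ∀ r, |μ r| ≤ C)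
    (x : ℝ) : |∑ r ∈ Finset.range T, f (x - s r) * μ r|
      ≤ C * ∑ r ∈ Finset.range T, f (x - s r) := by
  rw [Finset.mul_sum]
  refine (Finset.abs_sum_le_sum_abs _ _).trans (Finset.sum_le_sum fun r _ => ?_)
  rw [abs_mul, abs_of_nonneg (hf.nonneg _), mul_comm]
  exact mul_le_mul_of_nonneg_right (hμ _) (hf.nonneg _)

lemma abs_limitRegression_le (hf : IsIntervalDensity f m) {μ : ℤ → ℝ} {C : ℝ}
    (hμ : ∀ r, |μ r| ≤ C) (x : ℝ) : |limitRegression T s f μ x| ≤ C := by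
  have h0 : 0 ≤ ∑ r ∈ Finset.range T, f (x - s r) := Finset.sum_nonneg fun r _ => hf.nonneg _
  rw [limitRegression, abs_div, abs_of_nonneg h0]
  exact div_le_of_le_mul₀ h0 ((abs_nonneg _).trans (hμ 0)) (abs_weighted_sum_le hf hμ x)

lemma integrable_limitDensity (hf : IsIntervalDensity f m) (μ : ℤ → ℝ) {μ' : ℤ → ℝ} {C : ℝ}
    (hμ' : ∀ r, |μ' r| ≤ C) : Integrable (limitDensity T s f μ μ') := by
  have hi : Integrable fun x => ∑ r ∈ Finset.range T, f (x - s r) * μ r :=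
    integrable_finsetSum _ fun r _ => (integrable_translate hf _).mul_const _
  have := hi.bdd_mul (f := limitRegression T s f μ') (c := C)
    (measurable_limitRegression hf μ').aestronglyMeasurable
    (ae_of_all _ fun x => abs_limitRegression_le hf hμ' x)
  refine this.congr (ae_of_all _ fun x => ?_)
  simp only [limitDensity, limitRegression]
  ring

/-- Splitting the first argument by season gives the shape in which the averages converge. -/
lemma limitForm_eq (hf : IsIntervalDensity f m) {μ μ' : ℤ → ℝ} {C : ℝ}
    (hμ' : ∀ r, |μ' r| ≤ C) :
    limitForm T s f μ μ' = ∑ r ∈ Finset.range T, (∫ y, limitRegression T s f μ' (s r + y) * f y)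
      * ((T : ℝ)⁻¹ * μ r) := by
  have hint : ∀ r : ℕ, Integrable fun x => limitRegression T s f μ' x * f (x - s r) := fun r =>
    (integrable_translate hf _).bdd_mul (f := limitRegression T s f μ') (c := C)
      (measurable_limitRegression hf μ').aestronglyMeasurable
      (ae_of_all _ fun x => abs_limitRegression_le hf hμ' x)
  have h1 : ∀ r : ℕ, ∫ y, limitRegression T s f μ' (s r + y) * f y
      = ∫ x, limitRegression T s f μ' x * f (x - s r) := by
    intro r
    rw [← integral_add_left_eq_self (μ := volume)
      (fun x => limitRegression T s f μ' x * f (x - s r)) (s r)]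
    simp only [add_sub_cancel_left]
  have h2 : ∫ x, limitDensity T s f μ μ' x
      = ∑ r ∈ Finset.range T, (∫ x, limitRegression T s f μ' x * f (x - s r)) * μ r := by
    simp_rw [← integral_mul_const]
    rw [← integral_finsetSum _ fun r _ => (hint r).mul_const _]
    congr 1
    ext x
    simp only [limitDensity, limitRegression]
    rw [mul_div_assoc, mul_comm, Finset.mul_sum]
    refine Finset.sum_congr rfl fun r _ => ?_
    ring
  rw [limitForm, h2, Finset.mul_sum]
  refine Finset.sum_congr rfl fun r _ => ?_
  rw [h1]
  ring

lemma limitForm_bilin (hf : IsIntervalDensity f m) {p : ℕ} {μ : Fin p → ℤ → ℝ} {C : ℝ}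
    (hμ : ∀ i r, |μ i r| ≤ C) (v w : Fin p → ℝ) :
    ∑ i, ∑ j, v i * w j * limitForm T s f (μ i) (μ j)
      = limitForm T s f (fun r => ∑ i, v i * μ i r) (fun r => ∑ i, w i * μ i r) := by
  have hint : ∀ i j, Integrable (limitDensity T s f (μ i) (μ j)) := fun i j =>
    integrable_limitDensity hf (μ i) (hμ j)
  have hlin : ∀ (v : Fin p → ℝ) (x : ℝ), ∑ r ∈ Finset.range T, f (x - s r) * ∑ i, v i * μ i r
      = ∑ i, v i * ∑ r ∈ Finset.range T, f (x - s r) * μ i r := by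
    intro v x
    simp only [Finset.mul_sum]
    rw [Finset.sum_comm]
    refine Finset.sum_congr rfl fun i _ => Finset.sum_congr rfl fun r _ => ?_
    ring
  have h1 : ∀ x, limitDensity T s f (fun r => ∑ i, v i * μ i r) (fun r => ∑ i, w i * μ i r) x
      = ∑ i, ∑ j, v i * w j * limitDensity T s f (μ i) (μ j) x := by
    intro x
    simp only [limitDensity]
    rw [hlin, hlin, Finset.sum_mul_sum, Finset.sum_div]
    refine Finset.sum_congr rfl fun i _ => ?_
    rw [Finset.sum_div]
    refine Finset.sum_congr rfl fun j _ => ?_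
    ring
  simp only [limitForm]
  simp_rw [h1]
  rw [integral_finsetSum _ fun i _ => integrable_finsetSum _ fun j _ => (hint i j).const_mul _,
    Finset.mul_sum]
  refine Finset.sum_congr rfl fun i _ => ?_
  rw [integral_finsetSum _ fun j _ => (hint i j).const_mul _, Finset.mul_sum]
  refine Finset.sum_congr rfl fun j _ => ?_
  rw [integral_const_mul]
  ring

/-- Integrate 2 A B ≤ A² + B², divided by the total density. Taking one argument zero gives
positivity of the form. -/
lemma two_mul_limitForm_le (hf : IsIntervalDensity f m) {μ μ' : ℤ → ℝ} {C : ℝ}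
    (hμ : ∀ r, |μ r| ≤ C) (hμ' : ∀ r, |μ' r| ≤ C) :
    2 * limitForm T s f μ μ' ≤ limitForm T s f μ μ + limitForm T s f μ' μ' := by
  have h1 : ∫ x, 2 * limitDensity T s f μ μ' x
      ≤ ∫ x, (limitDensity T s f μ μ x + limitDensity T s f μ' μ' x) := by
    refine integral_mono ((integrable_limitDensity hf μ hμ').const_mul 2)
      ((integrable_limitDensity hf μ hμ).add (integrable_limitDensity hf μ' hμ')) fun x => ?_
    simp only [limitDensity]
    rw [← add_div, ← mul_div_assoc]
    refine div_le_div_of_nonneg_right ?_ (Finset.sum_nonneg fun r _ => hf.nonneg _)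
    nlinarith [sq_nonneg (∑ r ∈ Finset.range T, f (x - s r) * μ r
      - ∑ r ∈ Finset.range T, f (x - s r) * μ' r)]
  rw [integral_const_mul, integral_add (integrable_limitDensity hf μ hμ)
    (integrable_limitDensity hf μ' hμ')] at h1
  simp only [limitForm]
  have := mul_le_mul_of_nonneg_left h1 (by positivity : (0 : ℝ) ≤ (T : ℝ)⁻¹)
  linarith

/-- Cauchy–Schwarz with the weights f (x - s r): conditioning on the exogenous variable can only
shrink the second moment of the seasonal means. -/
lemma limitForm_self_le (hf : IsIntervalDensity f m) {μ : ℤ → ℝ} {C : ℝ}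
    (hμ : ∀ r, |μ r| ≤ C) :
    limitForm T s f μ μ ≤ (T : ℝ)⁻¹ * ∑ r ∈ Finset.range T, μ r ^ 2 := by
  refine mul_le_mul_of_nonneg_left ?_ (by positivity)
  have hi : Integrable fun x => ∑ r ∈ Finset.range T, f (x - s r) * μ r ^ 2 :=
    integrable_finsetSum _ fun r _ => (integrable_translate hf _).mul_const _
  calc ∫ x, limitDensity T s f μ μ x ≤ ∫ x, ∑ r ∈ Finset.range T, f (x - s r) * μ r ^ 2 := by
        refine integral_mono (integrable_limitDensity hf μ hμ) hi fun x => ?_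
        have h0 : 0 ≤ ∑ r ∈ Finset.range T, f (x - s r) := Finset.sum_nonneg fun r _ => hf.nonneg _
        refine div_le_of_le_mul₀ h0
          (Finset.sum_nonneg fun r _ => mul_nonneg (hf.nonneg _) (sq_nonneg _)) ?_
        rw [← sq]
        refine Finset.sum_sq_le_sum_mul_sum_of_sq_le_mul _
          (fun r _ => mul_nonneg (hf.nonneg _) (sq_nonneg _)) (fun r _ => hf.nonneg _)
          fun r _ => le_of_eq ?_
        ring
    _ = _ := by
        rw [integral_finsetSum _ fun r _ => (integrable_translate hf _).mul_const _]
        refine Finset.sum_congr rfl fun r _ => ?_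
        rw [integral_mul_const, integral_sub_right_eq_self f, hf.integral_eq_one, one_mul]

end Limit

section Model

variable {Ω : Type*} {η ε : ℤ → Ω → ℝ} [m0 : MeasurableSpace Ω] {P : Measure Ω} {f : ℝ → ℝ}
  {m B : ℝ} {u : ℤ → Ω → ℝ} {c : ℝ} {g : ℕ → ℝ} [IsProbabilityMeasure P]
  {T : ℕ} {s : ℤ → ℝ} {K : ℝ → ℝ} {γ : ℝ≥0} {h : ℕ → ℝ}

namespace BoundedModel

/-- The entries of the normalized backfitting matrix converge. -/
theorem ae_tendsto_backfitting (H : BoundedModel P η ε f m B) (hK : IsKernel K γ)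
    (hh : IsBandwidth h) (hT : 0 < T) (hs : Function.Periodic s (T : ℤ))
    (hg : Summable fun j => |g j|) (hu : ∀ l, Measurable[innovation η ε l] (u l))
    (huc : ∀ l ω, |u l ω| ≤ c) (hper : Function.Periodic (fun j => ∫ ω, u j ω ∂P) (T : ℤ))
    (p i j : ℕ) :
    ∀ᵐ ω ∂P, Tendsto (fun n : ℕ => average p n fun l =>
      causalFilter g (fun q => u q ω) (l - (i + 1 : ℤ))
        * kernelRegression p K (h n) (fun l => s l + η l ω) n
          (fun l => causalFilter g (fun q => u q ω) (l - (j + 1 : ℤ))) (s l + η l ω)) atTop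
      (nhds (limitForm T s f
        (fun r => causalFilter g (fun q => ∫ ω', u q ω' ∂P) (r - (i + 1 : ℤ)))
        (fun r => causalFilter g (fun q => ∫ ω', u q ω' ∂P) (r - (j + 1 : ℤ))))) := by
  obtain ⟨M, hM0, hM⟩ := H.density.exists_le
  obtain ⟨κ, hκ, hmix⟩ := hh.eventually_mixture_lower_bound H.density hK hT hs
  set Gs := ∑' j, |g j| with hGs
  set ν : ℤ → ℝ := fun j => ∫ ω, u j ω ∂P with hν
  have hνc : ∀ j, |ν j| ≤ c := fun j => abs_integral_le_of_abs_le (huc j)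
  set Z : ℕ → ℕ → Ω → ℝ := fun i l ω => causalFilter g (fun j => u j ω) (l - (i + 1 : ℤ)) with hZ
  set μ : ℕ → ℤ → ℝ := fun i r => causalFilter g ν (r - (i + 1 : ℤ)) with hμ
  have hZb : ∀ i l ω, |Z i l ω| ≤ Gs * c := fun i l ω =>
    abs_causalFilter_le hg (fun j => huc j ω) _
  have hμb : ∀ i l, |μ i l| ≤ Gs * c := fun i l => abs_causalFilter_le hg hνc _
  have hGc : 0 ≤ Gs * c := (abs_nonneg _).trans (hμb 0 0)
  have hZm : ∀ i (l : ℕ), Measurable[past η ε l] (Z i l) := fun i l =>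
    measurable_causalFilter hu (by omega)
  set Y : ℕ → ℕ → Ω → ℝ := fun n l ω =>
    meanRegression T s K f (h n) (μ j) (s l + η l ω) with hY
  have hmeas := fun n => measurable_meanRegression (T := T) (s := s) H.density hK.measurable (h n)
    (μ j)
  have hYm : ∀ n (l : ℕ), Measurable[innovation η ε l] (Y n l) := fun n l =>
    (hmeas n).comp (measurable_const.add (measurable_input_innovation _))
  have hYb : ∀ᶠ n in atTop, ∀ l ω, |Y n l ω| ≤ T * (M * (∫ u, |K u|) * (Gs * c)) / κ := by
    filter_upwards [hmix] with n hn l ω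
    exact abs_meanRegression_le H.density hK.integrable hM (hμb j) hκ
      (hn _ (mem_inputSupport hT hs (H.mem l ω) l))
  -- With `meanRegression` in place of the empirical regression, the value at e_l depends on the
  -- present innovation alone, and the lag is a predictable weight.
  have hconc := H.ae_tendsto_average 0 (φ := Z i) (Y := Y) (fun l => by simpa using hZm i l)
    (hZb i) (fun n l => by simpa using hYm n l) hYb (p + 1)
  have hres : ∀ᵐ ω ∂P, ∀ r ∈ Finset.range T, Tendsto (fun n : ℕ => (n : ℝ)⁻¹ *
      ∑ l ∈ Finset.Icc (p + 1) n with l % T = r, Z i l ω) atTop (nhds ((T : ℝ)⁻¹ * μ i r)) :=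
    (ae_ball_iff (Finset.range T).countable_toSet).2 fun r hr =>
      H.ae_tendsto_residue_average hg hu huc hT hper _ p (Finset.mem_range.1 hr)
  have hEY : ∀ (n l : ℕ), ∫ ω, Y n l ω ∂P
      = ∫ y, meanRegression T s K f (h n) (μ j) (s l + y) * f y := fun n l =>
    H.integral_comp_input l (G := fun y => meanRegression T s K f (h n) (μ j) (s l + y))
      ((hmeas n).comp (measurable_const_add _))
  filter_upwards [hconc, hres, H.ae_kernelRegression_regressor hK hh hT hs hg hu huc hper p j]
    with ω w1 w2 w3
  set R : ℕ → ℝ → ℝ := fun n => kernelRegression p K (h n) (fun l => s l + η l ω) n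
    (fun l => Z j l ω) with hR
  have t1 : Tendsto (fun n : ℕ => average p n fun l => Z i l ω * ∫ ω', Y n l ω' ∂P) atTop
      (nhds (limitForm T s f (μ i) (μ j))) := by
    rw [limitForm_eq H.density (hμb j)]
    have h1 : Tendsto (fun n : ℕ => ∑ r ∈ Finset.range T,
        (∫ y, meanRegression T s K f (h n) (μ j) (s r + y) * f y) * ((n : ℝ)⁻¹ *
        ∑ l ∈ Finset.Icc (p + 1) n with l % T = r, Z i l ω)) atTop
        (nhds (∑ r ∈ Finset.range T, (∫ y, limitRegression T s f (μ j) (s r + y) * f y)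
          * ((T : ℝ)⁻¹ * μ i r))) :=
      tendsto_finsetSum _ fun r hr =>
        (tendsto_integral_meanRegression H.density hK hh hT hs (hμb j) r).mul (w2 r hr)
    refine h1.congr fun n => ?_
    have h2 := sum_periodic_mul (F := fun l =>
      ∫ y, meanRegression T s K f (h n) (μ j) (s l + y) * f y) hT
      (fun l => by simp only [hs l]) (Finset.Icc (p + 1) n) fun l => Z i l ω
    simp only [average, hEY]
    simp only [mul_comm (Z i _ ω)]
    rw [h2, Finset.mul_sum]
    refine Finset.sum_congr rfl fun r _ => ?_
    ring
  have t2 : Tendsto (fun n : ℕ => average p n fun l => Z i l ω * (R n (s l + η l ω) - Y n l ω))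
      atTop (nhds 0) := by
    rw [Metric.tendsto_atTop]
    intro τ hτ
    have hpos : 0 < τ / (Gs * c + 1) / 2 := by positivity
    obtain ⟨N, hN⟩ := eventually_atTop.1 (w3 _ hpos)
    refine ⟨N, fun n hn => ?_⟩
    rw [dist_zero_right, Real.norm_eq_abs]
    refine (average_abs_le (c := (Gs * c) * (τ / (Gs * c + 1) / 2)) (fun l => ?_) p n).trans_lt ?_
    · rw [abs_mul]
      exact mul_le_mul (hZb i l ω) (hN n hn _ (mem_inputSupport hT hs (H.mem l ω) l))
        (abs_nonneg _) hGc
    · calc (Gs * c) * (τ / (Gs * c + 1) / 2) ≤ (Gs * c + 1) * (τ / (Gs * c + 1) / 2) := by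
            gcongr; linarith
        _ = τ / 2 := by field_simp
        _ < τ := half_lt_self hτ
  have t3 := (t2.add w1).add t1
  rw [zero_add, zero_add] at t3
  refine t3.congr fun n => ?_
  simp only [average, ← mul_add, ← Finset.sum_add_distrib]
  congr 1
  refine Finset.sum_congr rfl fun l _ => ?_
  ring

end BoundedModel

end Model


/-! ### The backfitting recursion along a path -/

lemma kernelRegression_add (p : ℕ) (K : ℝ → ℝ) (h : ℝ) (e : ℤ → ℝ) (N : ℕ) (y z : ℕ → ℝ)
    (x : ℝ) : kernelRegression p K h e N (fun l => y l + z l) x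
      = kernelRegression p K h e N y x + kernelRegression p K h e N z x := by
  simp only [kernelRegression, add_mul, Finset.sum_add_distrib, add_div]

lemma kernelRegression_sum_mul {ι : Type*} (A : Finset ι) (p : ℕ) (K : ℝ → ℝ) (h : ℝ)
    (e : ℤ → ℝ) (N : ℕ) (c : ι → ℝ) (y : ι → ℕ → ℝ) (x : ℝ) :
    kernelRegression p K h e N (fun l => ∑ i ∈ A, c i * y i l) x
      = ∑ i ∈ A, c i * kernelRegression p K h e N (y i) x := by
  simp only [kernelRegression, Finset.sum_mul]
  rw [Finset.sum_comm, Finset.sum_div]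
  refine Finset.sum_congr rfl fun i _ => ?_
  rw [← mul_div_assoc, Finset.mul_sum]
  simp only [mul_assoc]

lemma abs_kernelRegression_le {p : ℕ} {K : ℝ → ℝ} {h : ℝ} {e : ℤ → ℝ} {N : ℕ} {y : ℕ → ℝ}
    {x Y C : ℝ} (hy : ∀ l, |y l| ≤ Y) (hpos : 0 < kernelMass p K h e N x)
    (hC : kernelMass p (fun u => |K u|) h e N x ≤ C * kernelMass p K h e N x) :
    |kernelRegression p K h e N y x| ≤ C * Y := by
  have hY : 0 ≤ Y := (abs_nonneg _).trans (hy 0)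
  rw [kernelRegression, abs_div, abs_of_pos hpos, div_le_iff₀ hpos]
  calc |∑ l ∈ Finset.Icc (p + 1) N, y l * K ((x - e l) / h)|
      ≤ ∑ l ∈ Finset.Icc (p + 1) N, Y * |K ((x - e l) / h)| := by
        refine (Finset.abs_sum_le_sum_abs _ _).trans (Finset.sum_le_sum fun l _ => ?_)
        rw [abs_mul]
        exact mul_le_mul_of_nonneg_right (hy l) (abs_nonneg _)
    _ = Y * kernelMass p (fun u => |K u|) h e N x := by rw [← Finset.mul_sum]; rfl
    _ ≤ Y * (C * kernelMass p K h e N x) := mul_le_mul_of_nonneg_left hC hY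
    _ = _ := by ring

section Path

variable {p n : ℕ} {K : ℝ → ℝ} {h : ℝ} {X e : ℤ → ℝ} {a : Fin p → ℝ} {b : ℝ → ℝ} {N : ℕ → ℝ}

/-- The kernel regression of the `i`-th lag. -/
noncomputable def lagRegression (K : ℝ → ℝ) (h : ℝ) (X e : ℤ → ℝ) (p n i : ℕ) (x : ℝ) : ℝ :=
  kernelRegression p K h e n (fun l => X (l - (i + 1 : ℤ))) x

/-- The error of the kernel regression of the noisy responses `b(e_l) + N_l`. -/
noncomputable def oracleError (K : ℝ → ℝ) (h : ℝ) (e : ℤ → ℝ) (p n : ℕ) (b : ℝ → ℝ) (N : ℕ → ℝ)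
    (x : ℝ) : ℝ :=
  kernelRegression p K h e n (fun l => b (e l) + N l) x - b x

lemma regressor_dotProduct (l : ℕ) (v : Fin p → ℝ) :
    regressor p X l ⬝ᵥ v = ∑ i, v i * X (l - ((i : ℕ) + 1 : ℤ)) := by
  simp only [regressor, dotProduct, mul_comm]

/-- The partial residual for θ is b(e_l) + N_l minus θ - a applied to the regressor, and the
regression is linear in its responses. -/
lemma bOf_sub_eq (hX : ∀ l : ℕ, X l = regressor p X l ⬝ᵥ a + (b (e l) + N l)) (θ : Fin p → ℝ)
    (x : ℝ) : bOf K h X e n θ x - b x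
      = oracleError K h e p n b N x - ∑ i, (θ - a) i * lagRegression K h X e p n i x := by
  have h1 : ∀ l : ℕ, X l - regressor p X l ⬝ᵥ θ
      = (b (e l) + N l) + ∑ i : Fin p, (-(θ - a) i) * X (l - ((i : ℕ) + 1 : ℤ)) := by
    intro l
    rw [hX l, regressor_dotProduct, regressor_dotProduct]
    simp only [Pi.sub_apply, neg_sub, sub_mul, Finset.sum_sub_distrib]
    ring
  simp only [bOf, h1]
  rw [kernelRegression_add,
    kernelRegression_sum_mul (c := fun i : Fin p => -(θ - a) i)
      (y := fun (i : Fin p) (l : ℕ) => X (l - ((i : ℕ) + 1 : ℤ)))]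
  simp only [oracleError, lagRegression, neg_mul, Finset.sum_neg_distrib]
  ring

lemma dotProduct_gram_mulVec (v w : Fin p → ℝ) :
    v ⬝ᵥ gram p X n *ᵥ w
      = ∑ l ∈ Finset.Icc (p + 1) n, (regressor p X l ⬝ᵥ v) * (regressor p X l ⬝ᵥ w) := by
  rw [gram, Matrix.sum_mulVec, dotProduct_sum]
  refine Finset.sum_congr rfl fun l _ => ?_
  rw [Matrix.vecMulVec_mulVec]
  simp [dotProduct_comm, mul_comm]

/-- The normalized quadratic form of the Gram matrix. -/
noncomputable def gramForm (X : ℤ → ℝ) (p n : ℕ) (v : Fin p → ℝ) : ℝ :=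
  average p n fun l => (∑ i, v i * X (l - ((i : ℕ) + 1 : ℤ))) ^ 2

lemma isUnit_det_gram {δ : ℝ} (hδ : 0 < δ)
    (hlow : ∀ v : Fin p → ℝ, δ * ∑ i, v i ^ 2 ≤ gramForm X p n v) :
    IsUnit (gram p X n).det := by
  rw [isUnit_iff_ne_zero]
  intro h0
  obtain ⟨v, hv, hv0⟩ := Matrix.exists_mulVec_eq_zero_iff.2 h0
  have h1 := dotProduct_gram_mulVec (X := X) (n := n) v v
  rw [hv0, dotProduct_zero] at h1
  have h2 := hlow v
  have h3 : gramForm X p n v = 0 := by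
    simp only [regressor_dotProduct, ← sq] at h1
    rw [gramForm, average, ← h1, mul_zero]
  have h4 : ∑ i, v i ^ 2 ≤ 0 := by nlinarith
  have h5 : ∑ i, v i ^ 2 = 0 := le_antisymm h4 (Finset.sum_nonneg fun i _ => sq_nonneg _)
  rw [Finset.sum_eq_zero_iff_of_nonneg fun i _ => sq_nonneg _] at h5
  exact hv (funext fun i => pow_eq_zero_iff two_ne_zero |>.1 (h5 i (Finset.mem_univ i)))

/-- Subtract Σ_n a from the normal equations and insert `bOf_sub_eq`. Testing against an arbitrary w
avoids any estimate of the inverse Gram matrix. -/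
lemma average_thetaOf_sub (hX : ∀ l : ℕ, X l = regressor p X l ⬝ᵥ a + (b (e l) + N l))
    (hdet : IsUnit (gram p X n).det) (θ w : Fin p → ℝ) :
    average p n (fun l => (∑ i, w i * X (l - ((i : ℕ) + 1 : ℤ)))
        * ∑ i, (thetaOf p X e n (bOf K h X e n θ) - a) i * X (l - ((i : ℕ) + 1 : ℤ)))
      = ∑ i, ∑ j, w i * (θ - a) j * average p n
          (fun l => X (l - ((i : ℕ) + 1 : ℤ)) * lagRegression K h X e p n j (e l))
        + ∑ i, w i * average p n
          (fun l => X (l - ((i : ℕ) + 1 : ℤ)) * (N l - oracleError K h e p n b N (e l))) := by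
  have h1 : gram p X n *ᵥ thetaOf p X e n (bOf K h X e n θ)
      = ∑ l ∈ Finset.Icc (p + 1) n, (X l - bOf K h X e n θ (e l)) • regressor p X l := by
    rw [thetaOf, Matrix.mulVec_mulVec, Matrix.mul_nonsing_inv _ hdet, Matrix.one_mulVec]
  have h2 : w ⬝ᵥ gram p X n *ᵥ (thetaOf p X e n (bOf K h X e n θ) - a)
      = ∑ l ∈ Finset.Icc (p + 1) n, (∑ i, w i * X (l - ((i : ℕ) + 1 : ℤ)))
        * ((∑ j, (θ - a) j * lagRegression K h X e p n j (e l))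
          + (N l - oracleError K h e p n b N (e l))) := by
    rw [Matrix.mulVec_sub, dotProduct_sub, h1, dotProduct_gram_mulVec, dotProduct_sum,
      ← Finset.sum_sub_distrib]
    refine Finset.sum_congr rfl fun l _ => ?_
    rw [dotProduct_smul, dotProduct_comm w, smul_eq_mul, ← regressor_dotProduct]
    have h3 := bOf_sub_eq (K := K) (h := h) (n := n) hX θ (e l)
    have h4 := hX l
    linear_combination (regressor p X l ⬝ᵥ w) * h4 - (regressor p X l ⬝ᵥ w) * h3
  rw [dotProduct_gram_mulVec] at h2
  simp only [regressor_dotProduct] at h2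
  rw [average, h2, ← average_bilin (a := fun (i : Fin p) (l : ℕ) => X (l - ((i : ℕ) + 1 : ℤ)))
    (b := fun (j : Fin p) (l : ℕ) => lagRegression K h X e p n j (e l))]
  have h5 : ∑ i, w i * average p n
      (fun l => X (l - ((i : ℕ) + 1 : ℤ)) * (N l - oracleError K h e p n b N (e l)))
      = average p n (fun l => (∑ i, w i * X (l - ((i : ℕ) + 1 : ℤ)))
        * (N l - oracleError K h e p n b N (e l))) := by
    simp only [← average_const_mul]
    rw [← average_sum]
    congr 1
    ext l
    rw [Finset.sum_mul]
    refine Finset.sum_congr rfl fun i _ => ?_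
    ring
  rw [h5, ← average_add]
  simp only [average, mul_add]

/-- One backfitting step is a contraction for the quadratic form of the Gram matrix, up to the
error of the regression. -/
theorem gramForm_thetaOf_le (hX : ∀ l : ℕ, X l = regressor p X l ⬝ᵥ a + (b (e l) + N l))
    (hdet : IsUnit (gram p X n).det) {δ Λ ζ : ℝ} (hδ : 0 < δ) (hΛ : 0 < Λ)
    {Q : Fin p → Fin p → ℝ}
    (hlow : ∀ v : Fin p → ℝ, ∑ i, ∑ j, v i * v j * Q i j + δ * ∑ i, v i ^ 2 ≤ gramForm X p n v)
    (hup : ∀ v : Fin p → ℝ, gramForm X p n v ≤ Λ * ∑ i, v i ^ 2)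
    (hQ : ∀ v w : Fin p → ℝ, 2 * ∑ i, ∑ j, v i * w j * Q i j
      ≤ ∑ i, ∑ j, v i * v j * Q i j + ∑ i, ∑ j, w i * w j * Q i j)
    (hH : ∀ v w : Fin p → ℝ, |∑ i, ∑ j, v i * w j * (average p n
      (fun l => X (l - ((i : ℕ) + 1 : ℤ)) * lagRegression K h X e p n j (e l)) - Q i j)|
        ≤ δ / 8 * (∑ i, v i ^ 2 + ∑ j, w j ^ 2))
    (hζ : ∀ i : Fin p, |average p n
      (fun l => X (l - ((i : ℕ) + 1 : ℤ)) * (N l - oracleError K h e p n b N (e l)))| ≤ ζ)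
    (θ : Fin p → ℝ) :
    gramForm X p n (thetaOf p X e n (bOf K h X e n θ) - a)
      ≤ (1 - δ / (2 * Λ)) * gramForm X p n (θ - a) + 4 * p / δ * ζ ^ 2 := by
  set D := θ - a with hD
  set D' := thetaOf p X e n (bOf K h X e n θ) - a with hD'
  have h1 := average_thetaOf_sub (K := K) (h := h) hX hdet θ D'
  rw [← hD, ← hD'] at h1
  have h2 : gramForm X p n D' = average p n (fun l => (∑ i, D' i * X (l - ((i : ℕ) + 1 : ℤ)))
      * ∑ i, D' i * X (l - ((i : ℕ) + 1 : ℤ))) := by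
    simp only [gramForm, sq]
  rw [← h2] at h1
  have h3 := (abs_le.1 (hH D' D)).2
  simp only [mul_sub, Finset.sum_sub_distrib] at h3
  -- Young's inequality, with a multiple of |D'|² small enough to be absorbed by δ |D'|².
  have h4 : ∑ i, D' i * average p n
      (fun l => X (l - ((i : ℕ) + 1 : ℤ)) * (N l - oracleError K h e p n b N (e l)))
      ≤ δ / 8 * ∑ i, D' i ^ 2 + 2 * p / δ * ζ ^ 2 := by
    have h5 : ∀ i : Fin p, D' i * average p n
        (fun l => X (l - ((i : ℕ) + 1 : ℤ)) * (N l - oracleError K h e p n b N (e l)))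
        ≤ δ / 8 * D' i ^ 2 + 2 / δ * ζ ^ 2 := by
      intro i
      set z := average p n
        (fun l => X (l - ((i : ℕ) + 1 : ℤ)) * (N l - oracleError K h e p n b N (e l))) with hz
      have h6 : z ^ 2 ≤ ζ ^ 2 := by
        rw [← sq_abs]
        exact pow_le_pow_left₀ (abs_nonneg _) (hζ i) 2
      have h7 : δ / 8 * D' i ^ 2 + 2 / δ * z ^ 2 - D' i * z
          = (δ * D' i - 4 * z) ^ 2 / (8 * δ) := by
        field_simp
        ring
      have h8 : 0 ≤ (δ * D' i - 4 * z) ^ 2 / (8 * δ) := by positivity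
      have h9 : 2 / δ * z ^ 2 ≤ 2 / δ * ζ ^ 2 := by gcongr
      linarith
    refine (Finset.sum_le_sum fun i _ => h5 i).trans (le_of_eq ?_)
    rw [Finset.sum_add_distrib, ← Finset.mul_sum, Finset.sum_const, Finset.card_univ,
      Fintype.card_fin, nsmul_eq_mul]
    ring
  have h5 := hQ D' D
  have h6 := hlow D'
  have h7 := hlow D
  have h8 := hup D
  set S := ∑ i, D i ^ 2 with hS
  set S' := ∑ i, D' i ^ 2 with hS'
  have hS0 : 0 ≤ S := Finset.sum_nonneg fun i _ => sq_nonneg _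
  have hS'0 : 0 ≤ S' := Finset.sum_nonneg fun i _ => sq_nonneg _
  -- Double `h1` and bound 2 Q(D', D) by Q(D', D') + Q(D, D), each at most the Gram form minus δ
  -- times the squared norm. One copy of the Gram form of D' moves to the left; of the surplus
  -- -(3δ/4) S, the part -(δ/2) S yields the contraction.
  have h9 : δ / (2 * Λ) * gramForm X p n D ≤ δ / 2 * S := by
    calc _ ≤ δ / (2 * Λ) * (Λ * S) := by gcongr
      _ = δ / 2 * S := by field_simp
  have h10 : 2 * (2 * p / δ * ζ ^ 2) = 4 * p / δ * ζ ^ 2 := by ring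
  nlinarith [mul_nonneg hδ.le hS0, mul_nonneg hδ.le hS'0]

end Path


/-! ### Error bounds for the iterates along a path -/

section PathBounds

variable {p n : ℕ} {K : ℝ → ℝ} {h : ℝ} {X e : ℤ → ℝ} {a θ₁ : Fin p → ℝ} {b : ℝ → ℝ} {N : ℕ → ℝ}

/-- The number S is the fixed point of q ↦ r q + z, so the excess over S contracts by r. -/
lemma le_geometric_of_affine_le {q : ℕ → ℝ} {r z S : ℝ} (hr : 0 ≤ r) (hz : r * S + z = S)
    (hS : 0 ≤ S) (hq : ∀ k, q (k + 1) ≤ r * q k + z) (k : ℕ) : q k ≤ r ^ k * q 0 + S := by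
  induction k with
  | zero => simpa using hS
  | succ k ih =>
    calc q (k + 1) ≤ r * q k + z := hq k
      _ ≤ r * (r ^ k * q 0 + S) + z := by gcongr
      _ = r ^ (k + 1) * q 0 + S := by rw [pow_succ]; linear_combination hz

/-- The iterates converge geometrically, up to the error of the regression. -/
theorem norm_thetaHat_sub_le {δ Λ ζ β : ℝ} (hδ : 0 < δ) (hδΛ : δ ≤ Λ) (hζ0 : 0 ≤ ζ)
    (hβ : β = √(1 - δ / (2 * Λ)))
    (hlow : ∀ v : Fin p → ℝ, δ * ∑ i, v i ^ 2 ≤ gramForm X p n v)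
    (hup : ∀ v : Fin p → ℝ, gramForm X p n v ≤ Λ * ∑ i, v i ^ 2)
    (hstep : ∀ θ, gramForm X p n (thetaOf p X e n (bOf K h X e n θ) - a)
      ≤ (1 - δ / (2 * Λ)) * gramForm X p n (θ - a) + 4 * p / δ * ζ ^ 2)
    {k : ℕ} (hk : 1 ≤ k) :
    ‖WithLp.toLp 2 (thetaHat K h X e n θ₁ k - a)‖
      ≤ (√(Λ / δ * ∑ i, (θ₁ - a) i ^ 2) / β + √(8 * p * Λ / δ ^ 3)) * (ζ + β ^ k) := by
  have hΛ : 0 < Λ := hδ.trans_le hδΛ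
  have h1 : δ / (2 * Λ) ≤ 1 / 2 := by
    rw [div_le_div_iff₀ (by positivity) two_pos]
    linarith
  set r := 1 - δ / (2 * Λ) with hr
  have hr0 : 0 < r := by linarith
  have hβ0 : 0 < β := hβ ▸ Real.sqrt_pos.2 hr0
  have hβr : β ^ 2 = r := by rw [hβ, Real.sq_sqrt hr0.le]
  obtain ⟨k, rfl⟩ : ∃ j, k = j + 1 := ⟨k - 1, by omega⟩
  -- The fixed point is the error term divided by 1 - r = δ/(2Λ).
  have hS : r * (8 * p * Λ / δ ^ 2 * ζ ^ 2) + 4 * p / δ * ζ ^ 2 = 8 * p * Λ / δ ^ 2 * ζ ^ 2 := by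
    rw [hr]
    field_simp
    ring
  have h2 := le_geometric_of_affine_le
    (q := fun k => gramForm X p n (thetaHat K h X e n θ₁ (k + 1) - a)) hr0.le hS (by positivity)
    (fun k => hstep _) k
  have h3 := hlow (thetaHat K h X e n θ₁ (k + 1) - a)
  have h4 : gramForm X p n (thetaHat K h X e n θ₁ (0 + 1) - a) ≤ Λ * ∑ i, (θ₁ - a) i ^ 2 := hup _
  have hS1 : 0 ≤ ∑ i, (θ₁ - a) i ^ 2 := Finset.sum_nonneg fun i _ => sq_nonneg _
  set S₁ := ∑ i, (θ₁ - a) i ^ 2 with hS₁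
  set A := √(Λ / δ * S₁) with hA
  set A' := √(8 * p * Λ / δ ^ 3) with hA'
  have hA2 : A ^ 2 = Λ / δ * S₁ := Real.sq_sqrt (by positivity)
  have hA'2 : A' ^ 2 = 8 * p * Λ / δ ^ 3 := Real.sq_sqrt (by positivity)
  have hA0 : 0 ≤ A := Real.sqrt_nonneg _
  have hA'0 : 0 ≤ A' := Real.sqrt_nonneg _
  have h5 : ‖WithLp.toLp 2 (thetaHat K h X e n θ₁ (k + 1) - a)‖ ^ 2
      = ∑ i, (thetaHat K h X e n θ₁ (k + 1) - a) i ^ 2 := by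
    rw [EuclideanSpace.norm_sq_eq]
    simp
  have h6 : ‖WithLp.toLp 2 (thetaHat K h X e n θ₁ (k + 1) - a)‖ ^ 2
      ≤ (A * β ^ k) ^ 2 + (A' * ζ) ^ 2 := by
    rw [h5]
    have : δ * ∑ i, (thetaHat K h X e n θ₁ (k + 1) - a) i ^ 2
        ≤ δ * ((A * β ^ k) ^ 2 + (A' * ζ) ^ 2) := by
      calc _ ≤ _ := h3
        _ ≤ r ^ k * (Λ * S₁) + 8 * p * Λ / δ ^ 2 * ζ ^ 2 := by
          refine h2.trans ?_
          gcongr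
        _ = _ := by
          rw [mul_pow, mul_pow, hA2, hA'2, ← pow_mul, mul_comm k 2, pow_mul, hβr]
          field_simp
    exact le_of_mul_le_mul_left this hδ
  have h7 : ‖WithLp.toLp 2 (thetaHat K h X e n θ₁ (k + 1) - a)‖ ≤ A * β ^ k + A' * ζ := by
    refine abs_le_of_sq_le_sq' (h6.trans ?_) (by positivity) |>.2
    nlinarith [mul_nonneg (mul_nonneg hA0 (pow_nonneg hβ0.le k)) (mul_nonneg hA'0 hζ0)]
  refine h7.trans ?_
  -- The iteration starts at index 1, so the power lags by one; the division by β in the constant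
  -- makes up for it.
  have h8 : A * β ^ k = A / β * β ^ (k + 1) := by
    rw [pow_succ]
    field_simp
  rw [h8]
  have h9 : 0 ≤ A / β * ζ := by positivity
  have h10 : 0 ≤ A' * β ^ (k + 1) := by positivity
  linarith

lemma abs_sum_mul_le {v w : Fin p → ℝ} {t c : ℝ} (hv : ‖WithLp.toLp 2 v‖ ≤ t)
    (hw : ∀ i, |w i| ≤ c) : |∑ i, v i * w i| ≤ p * c * t := by
  refine (Finset.abs_sum_le_sum_abs _ _).trans ?_
  refine (Finset.sum_le_card_nsmul _ _ (c * t) fun i _ => ?_).trans (le_of_eq ?_)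
  · rw [abs_mul, mul_comm]
    refine mul_le_mul (hw i) ?_ (abs_nonneg _) ((abs_nonneg _).trans (hw i))
    exact (PiLp.norm_apply_le (WithLp.toLp 2 v) i).trans hv
  · simp [mul_assoc]

lemma abs_bOf_sub_le (hX : ∀ l : ℕ, X l = regressor p X l ⬝ᵥ a + (b (e l) + N l))
    {x c C t r : ℝ} (hXc : ∀ l, |X l| ≤ c) (hpos : 0 < kernelMass p K h e n x)
    (hC : kernelMass p (fun u => |K u|) h e n x ≤ C * kernelMass p K h e n x)
    (hr : |oracleError K h e p n b N x| ≤ r) {θ : Fin p → ℝ} (hθ : ‖WithLp.toLp 2 (θ - a)‖ ≤ t) :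
    |bOf K h X e n θ x - b x| ≤ r + p * (C * c) * t := by
  rw [bOf_sub_eq hX]
  refine (abs_sub _ _).trans (add_le_add hr (abs_sum_mul_le hθ fun i => ?_))
  exact abs_kernelRegression_le (fun l => hXc _) hpos hC

/-- Expanding the square adds the response (2 N + D) D, which is small with D. -/
lemma abs_kernelRegression_sq_sub_le {N' : ℕ} {D : ℕ → ℝ} {x c C d r v : ℝ}
    (hN : ∀ l, |N l| ≤ c) (hD : ∀ l, |D l| ≤ d) (hpos : 0 < kernelMass p K h e N' x)
    (hC : kernelMass p (fun u => |K u|) h e N' x ≤ C * kernelMass p K h e N' x)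
    (hr : |kernelRegression p K h e N' (fun l => N l ^ 2) x - v| ≤ r) :
    |kernelRegression p K h e N' (fun l => (N l + D l) ^ 2) x - v| ≤ r + C * ((2 * c + d) * d) := by
  have h1 : (fun l => (N l + D l) ^ 2) = fun l => N l ^ 2 + (2 * N l + D l) * D l := by
    ext l
    ring
  rw [h1, kernelRegression_add, add_sub_right_comm]
  refine (abs_add_le _ _).trans (add_le_add hr (abs_kernelRegression_le (fun l => ?_) hpos hC))
  rw [abs_mul]
  refine mul_le_mul ?_ (hD l) (abs_nonneg _) ?_
  · refine (abs_add_le _ _).trans (add_le_add ?_ (hD l))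
    rw [abs_mul, abs_two]
    exact mul_le_mul_of_nonneg_left (hN l) zero_le_two
  · have := (abs_nonneg _).trans (hN l)
    have := (abs_nonneg _).trans (hD l)
    positivity

lemma gramForm_le {c : ℝ} (hXc : ∀ l, |X l| ≤ c) (v : Fin p → ℝ) :
    gramForm X p n v ≤ p * c ^ 2 * ∑ i, v i ^ 2 := by
  refine (le_abs_self _).trans (average_abs_le (fun l => ?_) p n)
  rw [abs_of_nonneg (sq_nonneg _)]
  refine (Finset.sum_mul_sq_le_sq_mul_sq _ _ _).trans ?_
  rw [mul_comm]
  refine mul_le_mul_of_nonneg_right ?_ (Finset.sum_nonneg fun i _ => sq_nonneg _)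
  refine (Finset.sum_le_card_nsmul _ _ (c ^ 2) fun i _ => ?_).trans (le_of_eq (by simp))
  rw [← sq_abs]
  exact pow_le_pow_left₀ (abs_nonneg _) (hXc _) 2

end PathBounds


/-! ### The driving sequence of the model -/

/-- The driving sequence `b(e_l) + σ(e_l) ε_l`, where `e_l = s_l + η_l`. -/
def drive {Ω : Type*} (b σ : ℝ → ℝ) (s : ℤ → ℝ) (η ε : ℤ → Ω → ℝ) (l : ℤ) (ω : Ω) : ℝ :=
  b (s l + η l ω) + σ (s l + η l ω) * ε l ω

section Drive

variable {Ω : Type*} {η ε : ℤ → Ω → ℝ} {b σ : ℝ → ℝ} {s : ℤ → ℝ}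

lemma measurable_comp_innovation {G : ℝ → ℝ} (hG : Measurable G) (s : ℤ → ℝ) (l : ℤ) :
    Measurable[innovation η ε l] fun ω => G (s l + η l ω) :=
  hG.comp (measurable_const.add (measurable_input_innovation l))

lemma measurable_drive (hb : Measurable b) (hσ : Measurable σ) (s : ℤ → ℝ) (l : ℤ) :
    Measurable[innovation η ε l] (drive b σ s η ε l) :=
  (measurable_comp_innovation hb s l).add
    ((measurable_comp_innovation hσ s l).mul (measurable_noise_innovation l))

variable [m0 : MeasurableSpace Ω] {P : Measure Ω} {f : ℝ → ℝ} {m B cb cσ : ℝ}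

namespace BoundedModel

lemma abs_scaled_noise_le (H : BoundedModel P η ε f m B) (hσc : ∀ x, |σ x| ≤ cσ) (s : ℤ → ℝ)
    (l : ℤ) (ω : Ω) : |σ (s l + η l ω) * ε l ω| ≤ cσ * B := by
  rw [abs_mul]
  exact mul_le_mul (hσc _) (H.noise_bound l ω) (abs_nonneg _) ((abs_nonneg _).trans (hσc 0))

lemma abs_drive_le (H : BoundedModel P η ε f m B) (hbc : ∀ x, |b x| ≤ cb)
    (hσc : ∀ x, |σ x| ≤ cσ) (s : ℤ → ℝ) (l : ℤ) (ω : Ω) :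
    |drive b σ s η ε l ω| ≤ cb + cσ * B :=
  (abs_add_le _ _).trans (add_le_add (hbc _) (H.abs_scaled_noise_le hσc s l ω))

lemma measurable_comp_input (H : BoundedModel P η ε f m B) {G : ℝ → ℝ} (hG : Measurable G)
    (s : ℤ → ℝ) (l : ℤ) : Measurable fun ω => G (s l + η l ω) :=
  hG.comp (measurable_const.add (H.measurable_input l))

lemma integral_mul_noise (H : BoundedModel P η ε f m B) {G F : ℝ → ℝ} (hG : Measurable G)
    (hF : Measurable F) (s : ℤ → ℝ) (l : ℤ) :
    ∫ ω, G (s l + η l ω) * F (ε l ω) ∂P = (∫ ω, G (s l + η l ω) ∂P) * ∫ ω, F (ε l ω) ∂P := by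
  have h1 : Measurable fun y => G (s l + y) := hG.comp (by fun_prop)
  exact ((H.indep_pair l).comp h1 hF).integral_fun_mul_eq_mul_integral
    (h1.comp (H.measurable_input l)).aestronglyMeasurable
    (hF.comp (H.measurable_noise l)).aestronglyMeasurable

lemma integral_mul_noise_eq_zero (H : BoundedModel P η ε f m B) {G : ℝ → ℝ} (hG : Measurable G)
    (s : ℤ → ℝ) (l : ℤ) : ∫ ω, G (s l + η l ω) * ε l ω ∂P = 0 := by
  have := H.integral_mul_noise hG measurable_id s l
  simpa [H.noise_mean l] using this

lemma integral_mul_noise_sq (H : BoundedModel P η ε f m B) {G : ℝ → ℝ} (hG : Measurable G)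
    (s : ℤ → ℝ) (l : ℤ) : ∫ ω, G (s l + η l ω) * ε l ω ^ 2 ∂P = ∫ ω, G (s l + η l ω) ∂P := by
  rw [H.integral_mul_noise hG (F := fun y => y ^ 2) (by fun_prop), H.noise_sq, mul_one]

variable [IsProbabilityMeasure P]

/-- The noise term integrates to zero against functions of e_l. So b is the regression function
required in `ae_kernelRegression_rate`. -/
lemma integral_drive_mul (H : BoundedModel P η ε f m B) (hb : Measurable b)
    (hbc : ∀ x, |b x| ≤ cb) (hσ : Measurable σ) (hσc : ∀ x, |σ x| ≤ cσ) (s : ℤ → ℝ) (l : ℤ)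
    {G : ℝ → ℝ} {M : ℝ} (hG : Measurable G) (hM : ∀ x, |G x| ≤ M) :
    ∫ ω, drive b σ s η ε l ω * G (s l + η l ω) ∂P
      = ∫ ω, b (s l + η l ω) * G (s l + η l ω) ∂P := by
  have hM0 : 0 ≤ M := (abs_nonneg _).trans (hM 0)
  have i1 : Integrable (fun ω => b (s l + η l ω) * G (s l + η l ω)) P :=
    integrable_of_abs_le (c := cb * M) ((H.measurable_comp_input hb s l).mul
      (H.measurable_comp_input hG s l)) fun ω => by
        rw [abs_mul]
        exact mul_le_mul (hbc _) (hM _) (abs_nonneg _) ((abs_nonneg _).trans (hbc 0))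
  have i2 : Integrable (fun ω => (σ (s l + η l ω) * G (s l + η l ω)) * ε l ω) P :=
    integrable_of_abs_le (c := cσ * B * M) (((H.measurable_comp_input hσ s l).mul
      (H.measurable_comp_input hG s l)).mul (H.measurable_noise l)) fun ω => by
        rw [mul_right_comm, abs_mul]
        have := H.abs_scaled_noise_le hσc s l ω
        exact mul_le_mul this (hM _) (abs_nonneg _) ((abs_nonneg _).trans this)
  have h1 : ∀ ω, drive b σ s η ε l ω * G (s l + η l ω) = b (s l + η l ω) * G (s l + η l ω)
      + (σ (s l + η l ω) * G (s l + η l ω)) * ε l ω := fun ω => by rw [drive]; ring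
  simp_rw [h1]
  rw [integral_add i1 i2, H.integral_mul_noise_eq_zero (G := fun x => σ x * G x) (hσ.mul hG),
    add_zero]

lemma integral_drive (H : BoundedModel P η ε f m B) (hb : Measurable b)
    (hbc : ∀ x, |b x| ≤ cb) (hσ : Measurable σ) (hσc : ∀ x, |σ x| ≤ cσ) (s : ℤ → ℝ) (l : ℤ) :
    ∫ ω, drive b σ s η ε l ω ∂P = ∫ y, b (s l + y) * f y := by
  have h1 := H.integral_drive_mul hb hbc hσ hσc s l (G := fun _ => 1) (M := 1) measurable_const
    (by simp)
  simp only [mul_one] at h1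
  rw [h1]
  exact H.integral_comp_input l (G := fun y => b (s l + y)) (hb.comp (by fun_prop))

lemma periodic_integral_drive (H : BoundedModel P η ε f m B) (hb : Measurable b)
    (hbc : ∀ x, |b x| ≤ cb) (hσ : Measurable σ) (hσc : ∀ x, |σ x| ≤ cσ) {T : ℕ}
    (hs : Function.Periodic s (T : ℤ)) :
    Function.Periodic (fun l => ∫ ω, drive b σ s η ε l ω ∂P) (T : ℤ) := fun l => by
  simp only [H.integral_drive hb hbc hσ hσc]
  rw [hs l]

/-- In the expanded square the term linear in ε has mean zero, and the squared noise alone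
contributes E σ² ≥ c₀, whatever b is. -/
lemma le_integral_centered_drive_sq (H : BoundedModel P η ε f m B) (hb : Measurable b)
    (hbc : ∀ x, |b x| ≤ cb) (hσ : Measurable σ) (hσc : ∀ x, |σ x| ≤ cσ) {c₀ : ℝ} (l : ℤ)
    (hc₀ : ∀ ω, c₀ ≤ σ (s l + η l ω) ^ 2) :
    c₀ ≤ ∫ ω, centered P (drive b σ s η ε) l ω ^ 2 ∂P := by
  set ν := ∫ ω, drive b σ s η ε l ω ∂P with hν
  have hb' : Measurable fun ω => b (s l + η l ω) := H.measurable_comp_input hb s l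
  have hσ' : Measurable fun ω => σ (s l + η l ω) := H.measurable_comp_input hσ s l
  have hε := H.measurable_noise l
  have h1 : ∀ ω, centered P (drive b σ s η ε) l ω ^ 2 = (b (s l + η l ω) - ν) ^ 2
      + ((2 * (b (s l + η l ω) - ν) * σ (s l + η l ω)) * ε l ω
        + σ (s l + η l ω) ^ 2 * ε l ω ^ 2) := fun ω => by
    rw [centered, ← hν, drive]; ring
  have hbν : ∀ ω, |b (s l + η l ω) - ν| ≤ cb + |ν| := fun ω =>
    (abs_sub _ _).trans (add_le_add (hbc _) le_rfl)
  have i1 : Integrable (fun ω => (b (s l + η l ω) - ν) ^ 2) P :=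
    integrable_of_abs_le (c := (cb + |ν|) ^ 2) ((hb'.sub_const _).pow_const 2) fun ω => by
      rw [abs_pow]; exact pow_le_pow_left₀ (abs_nonneg _) (hbν ω) 2
  have i2 : Integrable (fun ω => (2 * (b (s l + η l ω) - ν) * σ (s l + η l ω)) * ε l ω) P :=
    integrable_of_abs_le (c := 2 * (cb + |ν|) * (cσ * B))
      ((((hb'.sub_const _).const_mul 2).mul hσ').mul hε) fun ω => by
        rw [mul_assoc, abs_mul, abs_mul, abs_two]
        exact mul_le_mul (mul_le_mul_of_nonneg_left (hbν ω) zero_le_two)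
          (H.abs_scaled_noise_le hσc s l ω) (abs_nonneg _)
          (mul_nonneg zero_le_two ((abs_nonneg _).trans (hbν ω)))
  have i3 : Integrable (fun ω => σ (s l + η l ω) ^ 2 * ε l ω ^ 2) P :=
    integrable_of_abs_le (c := (cσ * B) ^ 2) ((hσ'.pow_const 2).mul (hε.pow_const 2)) fun ω => by
      rw [← mul_pow, abs_pow]
      exact pow_le_pow_left₀ (abs_nonneg _) (H.abs_scaled_noise_le hσc s l ω) 2
  have i4 : Integrable (fun ω => σ (s l + η l ω) ^ 2) P :=
    integrable_of_abs_le (c := cσ ^ 2) (hσ'.pow_const 2) fun ω => by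
      rw [abs_pow]; exact pow_le_pow_left₀ (abs_nonneg _) (hσc _) 2
  have i5 : Integrable (fun ω => (2 * (b (s l + η l ω) - ν) * σ (s l + η l ω)) * ε l ω
      + σ (s l + η l ω) ^ 2 * ε l ω ^ 2) P := i2.add i3
  simp_rw [h1]
  rw [integral_add i1 i5, integral_add i2 i3,
    H.integral_mul_noise_eq_zero (G := fun x => 2 * (b x - ν) * σ x)
      (((hb.sub_const _).const_mul 2).mul hσ),
    H.integral_mul_noise_sq (G := fun x => σ x ^ 2) (hσ.pow_const 2)]
  have h2 : 0 ≤ ∫ ω, (b (s l + η l ω) - ν) ^ 2 ∂P := integral_nonneg fun ω => sq_nonneg _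
  have h3 : c₀ ≤ ∫ ω, σ (s l + η l ω) ^ 2 ∂P := by
    have := integral_mono (integrable_const c₀) i4 hc₀
    simpa using this
  linarith

/-- The correlation between the past of the solution and the noise. -/
theorem ae_abs_average_mul_noise_le (H : BoundedModel P η ε f m B) {h : ℕ → ℝ}
    (hh : IsBandwidth h) {g : ℕ → ℝ} (hg : Summable fun j => |g j|) (hb : Measurable b)
    (hbc : ∀ x, |b x| ≤ cb) (hσ : Measurable σ) (hσc : ∀ x, |σ x| ≤ cσ) (s : ℤ → ℝ) (p i : ℕ) :
    ∃ C, 0 ≤ C ∧ ∀ᵐ ω ∂P, ∀ᶠ n : ℕ in atTop,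
      |average p n fun l => causalFilter g (fun q => drive b σ s η ε q ω) (l - (i + 1 : ℤ))
        * (σ (s l + η l ω) * ε l ω)| ≤ C * √(Real.log n / (n * h n)) := by
  obtain ⟨C, hC⟩ := H.ae_abs_sum_le_sqrt 0
    (φ := fun l ω => causalFilter g (fun q => drive b σ s η ε q ω) (l - (i + 1 : ℤ)))
    (Y := fun _ l ω => σ (s l + η l ω) * ε l ω)
    (fun l => by
      rw [sub_zero]
      exact measurable_causalFilter (measurable_drive hb hσ s) (by linarith))
    (fun l ω => abs_causalFilter_le hg (fun q => H.abs_drive_le hbc hσc s q ω) _)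
    (fun n l => by
      rw [sub_zero]
      exact (measurable_comp_innovation hσ s l).mul (measurable_noise_innovation l))
    (Eventually.of_forall fun n l ω => H.abs_scaled_noise_le hσc s l ω) (p + 1)
  refine ⟨|C|, abs_nonneg _, ?_⟩
  filter_upwards [hC] with ω hω
  filter_upwards [hω, hh.pos, hh.tendsto_zero.eventually (gt_mem_nhds one_pos),
    eventually_one_le_log, eventually_gt_atTop 0] with n hn hpos hh1 hlog hn0
  have h5 : (0 : ℝ) < n := by exact_mod_cast hn0
  simp only [H.integral_mul_noise_eq_zero hσ, sub_zero] at hn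
  rw [average, abs_mul, abs_of_pos (inv_pos.2 h5)]
  calc _ ≤ (n : ℝ)⁻¹ * (C * √(n * Real.log n)) := by gcongr
    _ ≤ (n : ℝ)⁻¹ * (|C| * √(n * Real.log n)) := by gcongr; exact le_abs_self _
    _ = |C| * √(Real.log n / n) := by
      rw [show n * Real.log n = (n : ℝ) ^ 2 * (Real.log n / n) by field_simp,
        Real.sqrt_mul (by positivity), Real.sqrt_sq h5.le]
      field_simp
    -- The rate without h_n is better; it is relaxed to the common one by h_n < 1.
    _ ≤ |C| * √(Real.log n / (n * h n)) := by
      gcongr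
      nlinarith

end BoundedModel

end Drive


/-! ### Rates of convergence -/

section PathRates

variable {p n : ℕ} {K : ℝ → ℝ} {h : ℝ} {X e : ℤ → ℝ} {a θ₁ : Fin p → ℝ} {b σ : ℝ → ℝ} {N : ℕ → ℝ}
  {E : Set ℝ}

/-- The error bounds of the three estimators, given those of the oracle regressions. -/
theorem path_rates (hX : ∀ l : ℕ, X l = regressor p X l ⬝ᵥ a + (b (e l) + N l))
    (heE : ∀ l : ℕ, e l ∈ E) {c cN : ℝ} (hXc : ∀ l, |X l| ≤ c) (hNc : ∀ l, |N l| ≤ cN)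
    {δ Λ β : ℝ} (hδ : 0 < δ) (hδΛ : δ ≤ Λ) (hβ : β = √(1 - δ / (2 * Λ)))
    {Q : Fin p → Fin p → ℝ}
    (hlow : ∀ v : Fin p → ℝ, ∑ i, ∑ j, v i * v j * Q i j + δ * ∑ i, v i ^ 2 ≤ gramForm X p n v)
    (hup : ∀ v : Fin p → ℝ, gramForm X p n v ≤ Λ * ∑ i, v i ^ 2)
    (hQ : ∀ v w : Fin p → ℝ, 2 * ∑ i, ∑ j, v i * w j * Q i j
      ≤ ∑ i, ∑ j, v i * v j * Q i j + ∑ i, ∑ j, w i * w j * Q i j)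
    (hH : ∀ v w : Fin p → ℝ, |∑ i, ∑ j, v i * w j * (average p n
      (fun l => X (l - ((i : ℕ) + 1 : ℤ)) * lagRegression K h X e p n j (e l)) - Q i j)|
        ≤ δ / 8 * (∑ i, v i ^ 2 + ∑ j, w j ^ 2))
    {Cm R ρ ρ' : ℝ} (hCm : 0 ≤ Cm) (hR : 0 ≤ R) (hρ : 0 ≤ ρ) (hρ1 : ρ ≤ 1) (hρρ' : ρ ≤ ρ')
    (hmass : ∀ N' ≤ n, n ≤ N' + 1 → ∀ x ∈ E, 0 < kernelMass p K h e N' x ∧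
      kernelMass p (fun u => |K u|) h e N' x ≤ Cm * kernelMass p K h e N' x)
    (hcorr : ∀ i : Fin p, |average p n (fun l => X (l - ((i : ℕ) + 1 : ℤ)) * N l)| ≤ R * ρ)
    (horacle : ∀ x ∈ E, |oracleError K h e p n b N x| ≤ R * ρ)
    (hvar : ∀ x ∈ E, |kernelRegression p K h e (n - 1) (fun l => N l ^ 2) x - σ x ^ 2| ≤ R * ρ')
    {A A₁ A₂ A₃ : ℝ}
    (hA : A = √(Λ / δ * ∑ i, (θ₁ - a) i ^ 2) / β + √(8 * p * Λ / δ ^ 3))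
    (hA₁ : A₁ = A * (R * (1 + c) + 1)) (hA₂ : A₂ = R + p * (Cm * c) * A₁)
    (hA₃ : A₃ = p * c * A₁ + A₂ / β) :
    IsUnit (gram p X n).det ∧
    (∀ k ≥ 1, ‖WithLp.toLp 2 (thetaHat K h X e n θ₁ k - a)‖ ≤ A₁ * (ρ + β ^ k)) ∧
    (∀ k ≥ 1, ∀ x ∈ E, |bHat K h X e n θ₁ k x - b x| ≤ A₂ * (ρ + β ^ k)) ∧
    (∀ k ≥ 2, ∀ x ∈ E, |sigmaSqHat K h X e n θ₁ k x - σ x ^ 2|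
      ≤ (R + Cm * ((2 * cN + 2 * A₃) * A₃)) * (ρ' + β ^ k)) := by
  have hΛ : 0 < Λ := hδ.trans_le hδΛ
  have hc : 0 ≤ c := (abs_nonneg _).trans (hXc 0)
  have hcN : 0 ≤ cN := (abs_nonneg _).trans (hNc 0)
  have hβ0 : 0 < β := by
    rw [hβ, Real.sqrt_pos, sub_pos, div_lt_one (by positivity)]
    linarith
  have hβ1 : β ≤ 1 := by
    have : 0 ≤ δ / (2 * Λ) := by positivity
    rw [hβ, Real.sqrt_le_iff]
    constructor <;> linarith
  have hA0 : 0 ≤ A := by rw [hA]; positivity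
  have hA₁0 : 0 ≤ A₁ := by rw [hA₁]; positivity
  have hA₂0 : 0 ≤ A₂ := by rw [hA₂]; positivity
  have hA₃0 : 0 ≤ A₃ := by rw [hA₃]; positivity
  have hlow' : ∀ v : Fin p → ℝ, δ * ∑ i, v i ^ 2 ≤ gramForm X p n v := by
    intro v
    -- Taking w = 0 shows that Q is positive semidefinite.
    have h1 := hQ v 0
    simp only [Pi.zero_apply, mul_zero, zero_mul, Finset.sum_const_zero, add_zero] at h1
    linarith [hlow v]
  have hdet := isUnit_det_gram hδ hlow'
  have hζ : ∀ i : Fin p, |average p n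
      (fun l => X (l - ((i : ℕ) + 1 : ℤ)) * (N l - oracleError K h e p n b N (e l)))|
        ≤ R * (1 + c) * ρ := by
    intro i
    have h1 : average p n
        (fun l => X (l - ((i : ℕ) + 1 : ℤ)) * (N l - oracleError K h e p n b N (e l)))
        = average p n (fun l => X (l - ((i : ℕ) + 1 : ℤ)) * N l)
          + average p n (fun l => X (l - ((i : ℕ) + 1 : ℤ))
            * -oracleError K h e p n b N (e l)) := by
      rw [← average_add]
      simp only [mul_neg, sub_eq_add_neg, mul_add]
    rw [h1]
    refine (abs_add_le _ _).trans ?_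
    have h2 : |average p n (fun l => X (l - ((i : ℕ) + 1 : ℤ))
        * -oracleError K h e p n b N (e l))| ≤ c * (R * ρ) := by
      refine average_abs_le (fun l => ?_) p n
      rw [abs_mul, abs_neg]
      exact mul_le_mul (hXc _) (horacle _ (heE l)) (abs_nonneg _) hc
    linarith [hcorr i]
  have hstep := fun θ => gramForm_thetaOf_le (K := K) (h := h) hX hdet hδ hΛ hlow hup hQ hH hζ θ
  have hθ : ∀ k ≥ 1, ‖WithLp.toLp 2 (thetaHat K h X e n θ₁ k - a)‖ ≤ A₁ * (ρ + β ^ k) := by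
    intro k hk
    have h1 := norm_thetaHat_sub_le (θ₁ := θ₁) hδ hδΛ (by positivity) hβ hlow' hup hstep hk
    rw [← hA] at h1
    refine h1.trans ?_
    rw [hA₁, mul_assoc A]
    refine mul_le_mul_of_nonneg_left ?_ hA0
    have h2 : 0 ≤ R * (1 + c) * β ^ k := by positivity
    nlinarith
  have hbk : ∀ k ≥ 1, ∀ x ∈ E, |bHat K h X e n θ₁ k x - b x| ≤ A₂ * (ρ + β ^ k) := by
    intro k hk x hx
    obtain ⟨h1, h2⟩ := hmass n le_rfl (Nat.le_succ n) x hx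
    refine (abs_bOf_sub_le hX hXc h1 h2 (horacle x hx) (hθ k hk)).trans ?_
    have h3 : 0 ≤ R * β ^ k := by positivity
    rw [hA₂]
    nlinarith
  refine ⟨hdet, hθ, hbk, fun k hk x hx => ?_⟩
  have hβk : β ^ k ≤ 1 := pow_le_one₀ hβ0.le hβ1
  have hβk0 : 0 < β ^ k := by positivity
  have hD : ∀ l : ℕ, |(-(regressor p X l ⬝ᵥ (thetaHat K h X e n θ₁ k - a))
      - (bHat K h X e n θ₁ (k - 1) (e l) - b (e l)))| ≤ A₃ * (ρ + β ^ k) := by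
    intro l
    refine (abs_sub _ _).trans ?_
    rw [abs_neg, regressor_dotProduct]
    have h1 := abs_sum_mul_le (w := fun i : Fin p => X (l - ((i : ℕ) + 1 : ℤ))) (hθ k (by omega))
      (fun i => hXc _)
    have h2 := hbk (k - 1) (by omega) (e l) (heE l)
    -- The variance estimator uses b̂^(k-1), whose error carries β ^ (k - 1); this is the reason for
    -- A₂ / β in A₃.
    have h3 : ρ + β ^ (k - 1) ≤ (ρ + β ^ k) / β := by
      rw [le_div_iff₀ hβ0, add_mul, ← pow_succ, Nat.sub_add_cancel (by omega)]
      nlinarith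
    have h4 := mul_le_mul_of_nonneg_left h3 hA₂0
    rw [hA₃]
    calc _ ≤ p * c * (A₁ * (ρ + β ^ k)) + A₂ * ((ρ + β ^ k) / β) := add_le_add h1 (h2.trans h4)
      _ = _ := by ring
  have hres : ∀ l : ℕ, X l - regressor p X l ⬝ᵥ thetaHat K h X e n θ₁ k
      - bHat K h X e n θ₁ (k - 1) (e l)
      = N l + (-(regressor p X l ⬝ᵥ (thetaHat K h X e n θ₁ k - a))
      - (bHat K h X e n θ₁ (k - 1) (e l) - b (e l))) := by
    intro l
    rw [dotProduct_sub]
    linear_combination hX l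
  obtain ⟨h1, h2⟩ := hmass (n - 1) (Nat.sub_le n 1) (by omega) x hx
  have h3 := abs_kernelRegression_sq_sub_le hNc hD h1 h2 (hvar x hx)
  simp only [sigmaSqHat, hres]
  refine h3.trans ?_
  -- One of the two factors of (2 N + D) D is bounded crudely, so that the error stays linear in the
  -- rate.
  have h4 : A₃ * (ρ + β ^ k) ≤ 2 * A₃ := by nlinarith
  have h5 : (2 * cN + A₃ * (ρ + β ^ k)) * (A₃ * (ρ + β ^ k))
      ≤ (2 * cN + 2 * A₃) * (A₃ * (ρ' + β ^ k)) := by gcongr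
  have h6 := mul_le_mul_of_nonneg_left h5 hCm
  have h7 : 0 ≤ R * β ^ k := by positivity
  linarith

end PathRates

/-! ### Lowering the Hölder exponent. -/

section Holder

/-- Needed for σ² with the exponent min γ γ', since K has a moment of order γ but perhaps none of
order γ' > γ. -/
lemma exists_holderOnWith_of_le {φ : ℝ → ℝ} {C r t : ℝ≥0} {E : Set ℝ} (hE : Bornology.IsBounded E)
    (hφ : HolderOnWith C r φ E) (ht : t ≤ r) : ∃ C', HolderOnWith C' t φ E := by
  obtain ⟨D, hD⟩ := hE.exists_pos_norm_le
  refine ⟨_, HolderOnWith.of_le (D := (2 * D).toNNReal) (fun x hx y hy => ?_) hφ ht⟩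
  rw [edist_dist]
  refine ENNReal.ofReal_le_ofReal ?_
  rw [Real.dist_eq]
  have h1 := hD.2 x hx
  have h2 := hD.2 y hy
  rw [Real.norm_eq_abs] at h1 h2
  linarith [abs_sub x y]

lemma IsKernel.moment_of_le {K : ℝ → ℝ} {γ t : ℝ≥0} (hK : IsKernel K γ) (ht : t ≤ γ) :
    Integrable fun u => |u| ^ (t : ℝ) * |K u| := by
  obtain ⟨L, hL⟩ := hK.lipschitz
  refine (hK.integrable.abs.add hK.moment).mono' ?_ (ae_of_all _ fun u => ?_)
  · exact ((measurable_norm.pow_const _).mul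
      hL.continuous.abs.measurable).aestronglyMeasurable
  · rw [Real.norm_eq_abs, abs_of_nonneg (by positivity), Pi.add_apply]
    have h1 : |u| ^ (t : ℝ) ≤ 1 + |u| ^ (γ : ℝ) := by
      rcases le_total |u| 1 with hu | hu
      · exact (Real.rpow_le_one (abs_nonneg _) hu t.2).trans
          (le_add_of_nonneg_right (by positivity))
      · exact (Real.rpow_le_rpow_of_exponent_le hu (by exact_mod_cast ht)).trans
          (le_add_of_nonneg_left zero_le_one)
    nlinarith [abs_nonneg (K u)]

end Holder


/-! ### Rates for the model with everywhere bounded noises. -/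

section Rates

variable {Ω : Type*} {η ε : ℤ → Ω → ℝ} [m0 : MeasurableSpace Ω] {P : Measure Ω}
  [IsProbabilityMeasure P] {f : ℝ → ℝ} {m B : ℝ}

/-- The rates of the backfitting estimators in a bounded model. -/
theorem BoundedModel.ae_rates (H : BoundedModel P η ε f m B) {K : ℝ → ℝ} {γ γ' : ℝ≥0}
    (hK : IsKernel K γ) (hγ : 0 < γ) {h : ℕ → ℝ} (hh : IsBandwidth h) {T : ℕ} (hT : 0 < T)
    {s : ℤ → ℝ} (hs : Function.Periodic s (T : ℤ)) {p : ℕ} (a θ₁ : Fin p → ℝ)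
    (hg : Summable fun j => |maCoeff a j|) {b σ : ℝ → ℝ} {cb cσ : ℝ} (hb : Measurable b)
    (hbc : ∀ x, |b x| ≤ cb) (hσ : Measurable σ) (hσc : ∀ x, |σ x| ≤ cσ) {Cb Cσ : ℝ≥0}
    (hbH : HolderOnWith Cb γ b (inputSupport T s m))
    (hσH : HolderOnWith Cσ γ' (fun x => σ x ^ 2) (inputSupport T s m))
    {c₀ : ℝ} (hc₀ : 0 < c₀) (hσ₀ : ∀ x ∈ inputSupport T s m, c₀ ≤ σ x ^ 2) :
    ∃ β ∈ Set.Ioo (0 : ℝ) 1, ∃ C : ℝ, ∀ᵐ ω ∂P, ∀ᶠ n : ℕ in atTop,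
      ∀ X e : ℤ → ℝ, X = causalFilter (maCoeff a) (fun q => drive b σ s η ε q ω) →
      e = (fun l => s l + η l ω) →
      IsUnit (gram p X n).det ∧
      (∀ x ∈ inputSupport T s m, kernelMass p K (h n) e n x ≠ 0 ∧
        kernelMass p K (h n) e (n - 1) x ≠ 0) ∧
      (∀ k ≥ 1, ‖WithLp.toLp 2 (thetaHat K (h n) X e n θ₁ k - a)‖
        ≤ C * (√(Real.log n / (n * h n)) + h n ^ (γ : ℝ) + β ^ k)) ∧
      (∀ k ≥ 1, ∀ x ∈ inputSupport T s m, |bHat K (h n) X e n θ₁ k x - b x|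
        ≤ C * (√(Real.log n / (n * h n)) + h n ^ (γ : ℝ) + β ^ k)) ∧
      (∀ k ≥ 2, ∀ x ∈ inputSupport T s m, |sigmaSqHat K (h n) X e n θ₁ k x - σ x ^ 2|
        ≤ C * (√(Real.log n / (n * h n)) + h n ^ (min γ γ' : ℝ) + β ^ k)) := by
  set E := inputSupport T s m with hE
  set g := maCoeff a with hgdef
  set u := drive b σ s η ε with hu
  set cu := cb + cσ * B with hcu
  set Gs := ∑' j, |g j| with hGs
  have hum : ∀ l, Measurable[innovation η ε l] (u l) := measurable_drive hb hσ s
  have huc : ∀ l ω, |u l ω| ≤ cu := H.abs_drive_le hbc hσc s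
  have hper : Function.Periodic (fun l => ∫ ω, u l ω ∂P) (T : ℤ) :=
    H.periodic_integral_drive hb hbc hσ hσc hs
  have hmemE : ∀ (l : ℤ) ω, s l + η l ω ∈ E := fun l ω => mem_inputSupport hT hs (H.mem l ω) l
  obtain ⟨δ, hδ, hgram⟩ := H.ae_gram_lower_bound hg (maCoeff_zero a) hum huc hT hper hc₀
    (fun l => H.le_integral_centered_drive_sq hb hbc hσ hσc l fun ω => hσ₀ _ (hmemE l ω)) p
  obtain ⟨c₁, hc₁, hmass⟩ := H.ae_kernelMass_lower_bound hK hh hT hs p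
  obtain ⟨C₂, hC₂, hmass'⟩ := H.ae_abs_kernelMass_le (T := T) (s := s) hK hh p
  obtain ⟨R₁, hR₁, hreg⟩ := H.ae_kernelRegression_rate hK hh hT hs p hb hbc hbH hK.moment
    (ψ := fun l => u l) (fun l => hum l) (fun l => huc l)
    (fun l G M hG hM => H.integral_drive_mul hb hbc hσ hσc s l hG hM)
  obtain ⟨Cσ', hσH'⟩ := exists_holderOnWith_of_le (isCompact_inputSupport T s m).isBounded hσH
    (min_le_right γ γ')
  have hσc2 : ∀ x, |σ x ^ 2| ≤ cσ ^ 2 := fun x => by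
    rw [abs_pow]; exact pow_le_pow_left₀ (abs_nonneg _) (hσc x) 2
  obtain ⟨R₂, hR₂, hvar⟩ := H.ae_kernelRegression_rate hK hh hT hs p (hσ.pow_const 2) hσc2 hσH'
    (hK.moment_of_le (min_le_left γ γ')) (cψ := (cσ * B) ^ 2)
    (ψ := fun l ω => (σ (s l + η l ω) * ε l ω) ^ 2)
    (fun l => ((measurable_comp_innovation hσ s l).mul
      (measurable_noise_innovation l)).pow_const 2)
    (fun l ω => by
      rw [abs_pow]
      exact pow_le_pow_left₀ (abs_nonneg _) (H.abs_scaled_noise_le hσc s l ω) 2)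
    (fun l G M hG hM => by
      rw [← H.integral_mul_noise_sq (G := fun x => σ x ^ 2 * G x) ((hσ.pow_const 2).mul hG) s l]
      congr 1
      ext ω
      ring)
  choose R₃ hR₃ hcorr using fun i : ℕ => H.ae_abs_average_mul_noise_le hh hg hb hbc hσ hσc s p i
  set R := R₁ + R₂ + ∑ i : Fin p, R₃ i with hRdef
  have hR₃s : 0 ≤ ∑ i : Fin p, R₃ i := Finset.sum_nonneg fun i _ => hR₃ i
  have hR : 0 ≤ R := by positivity
  have hback : ∀ i j : Fin p, _ := fun i j =>
    H.ae_tendsto_backfitting hK hh hT hs hg hum huc hper p i j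
  set μ : Fin p → ℤ → ℝ := fun i r =>
    causalFilter g (fun q => ∫ ω', u q ω' ∂P) (r - ((i : ℕ) + 1 : ℤ)) with hμ
  have hμc : ∀ i r, |μ i r| ≤ Gs * cu := fun i r =>
    abs_causalFilter_le hg (fun q => abs_integral_le_of_abs_le (huc q)) _
  set Q : Fin p → Fin p → ℝ := fun i j => limitForm T s f (μ i) (μ j) with hQdef
  have hvμ : ∀ (v : Fin p → ℝ) r, |∑ i, v i * μ i r| ≤ (∑ i, |v i|) * (Gs * cu) := by
    intro v r
    rw [Finset.sum_mul]
    refine (Finset.abs_sum_le_sum_abs _ _).trans (Finset.sum_le_sum fun i _ => ?_)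
    rw [abs_mul]
    exact mul_le_mul_of_nonneg_left (hμc i r) (abs_nonneg _)
  have hcu0 : 0 ≤ Gs * cu := by
    obtain ⟨ω⟩ : Nonempty Ω := nonempty_of_isProbabilityMeasure P
    exact (abs_nonneg _).trans (abs_causalFilter_le hg (fun q => huc q ω) 0)
  have hQ : ∀ v w : Fin p → ℝ, 2 * ∑ i, ∑ j, v i * w j * Q i j
      ≤ ∑ i, ∑ j, v i * v j * Q i j + ∑ i, ∑ j, w i * w j * Q i j := by
    intro v w
    simp only [hQdef]
    rw [limitForm_bilin H.density hμc, limitForm_bilin H.density hμc,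
      limitForm_bilin H.density hμc]
    have h1 : 0 ≤ ∑ i, |v i| := Finset.sum_nonneg fun i _ => abs_nonneg _
    have h2 : 0 ≤ ∑ i, |w i| := Finset.sum_nonneg fun i _ => abs_nonneg _
    exact two_mul_limitForm_le H.density (C := (∑ i, |v i| + ∑ i, |w i|) * (Gs * cu))
      (fun r => (hvμ v r).trans (by gcongr; linarith))
      (fun r => (hvμ w r).trans (by gcongr; linarith))
  -- Adding δ ensures δ ≤ Λ, hence β > 0. Nothing here depends on the outcome, which makes β
  -- deterministic.
  set Λ := δ + p * (Gs * cu) ^ 2 with hΛdef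
  have hδΛ : δ ≤ Λ := le_add_of_nonneg_right (by positivity)
  have hΛ : 0 < Λ := hδ.trans_le hδΛ
  set β := √(1 - δ / (2 * Λ)) with hβ
  have hβ0 : 0 < β := by
    rw [hβ, Real.sqrt_pos, sub_pos, div_lt_one (by positivity)]
    linarith
  have hβ1 : β < 1 := by
    have : 0 < δ / (2 * Λ) := by positivity
    rw [hβ, Real.sqrt_lt' one_pos]
    linarith
  set A := √(Λ / δ * ∑ i, (θ₁ - a) i ^ 2) / β + √(8 * p * Λ / δ ^ 3) with hA
  set A₁ := A * (R * (1 + Gs * cu) + 1) with hA₁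
  set A₂ := R + p * (C₂ / c₁ * (Gs * cu)) * A₁ with hA₂
  set A₃ := p * (Gs * cu) * A₁ + A₂ / β with hA₃
  set A₄ := R + C₂ / c₁ * ((2 * (cσ * B) + 2 * A₃) * A₃) with hA₄
  have hrate : Tendsto (fun n : ℕ => √(Real.log n / (n * h n)) + h n ^ (γ : ℝ)) atTop (nhds 0) := by
    have h1 := hh.log_div.sqrt
    have h2 := hh.tendsto_zero.rpow_const (p := (γ : ℝ)) (Or.inr γ.2)
    rw [Real.zero_rpow (by exact_mod_cast hγ.ne')] at h2
    simpa using h1.add h2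
  refine ⟨β, ⟨hβ0, hβ1⟩, max A₁ (max A₂ A₄), ?_⟩
  filter_upwards [hgram, hmass, hmass', hreg, hvar, ae_all_iff.2 hcorr,
    ae_all_iff.2 fun i => ae_all_iff.2 (hback i)] with ω w1 w2 w3 w4 w5 w6 w7
  have w8 := eventually_abs_bilin_le (ι := Fin p) (κ := Fin p)
    (E := fun n i j => (average p n fun l =>
      causalFilter g (fun q => u q ω) (l - ((i : ℕ) + 1 : ℤ))
        * kernelRegression p K (h n) (fun l => s l + η l ω) n
          (fun l => causalFilter g (fun q => u q ω) (l - ((j : ℕ) + 1 : ℤ))) (s l + η l ω))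
        - Q i j)
    (fun i j => by
      have := (w7 i j).sub_const (Q i j)
      rwa [show limitForm T s f _ _ - Q i j = 0 from sub_self _] at this)
    (τ := δ / 8) (by positivity)
  filter_upwards [w1, w2, w3, w4, w5, eventually_all.2 fun i : Fin p => w6 i, w8, hh.pos,
    hh.tendsto_zero.eventually (gt_mem_nhds one_pos), hrate.eventually (gt_mem_nhds one_pos),
    eventually_gt_atTop 0] with n v1 v2 v3 v4 v5 v6 v8 hpos hh1 hρ1 hn0 X e hX he
  have hn : (0 : ℝ) < n := by exact_mod_cast hn0
  have hmassE : ∀ N' ≤ n, n ≤ N' + 1 → ∀ x ∈ E, 0 < kernelMass p K (h n) e N' x ∧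
      kernelMass p (fun u => |K u|) (h n) e N' x ≤ C₂ / c₁ * kernelMass p K (h n) e N' x := by
    intro N' h1 h2 x hx
    have h3 := v2 N' h1 h2 x hx
    have h4 := v3 N' h1 x hx
    rw [← he] at h3 h4
    refine ⟨lt_of_lt_of_le (by positivity) h3, h4.trans ?_⟩
    calc C₂ * (n * h n) = C₂ / c₁ * (c₁ * (n * h n)) := by field_simp
      _ ≤ _ := by gcongr
  set ρ := √(Real.log n / (n * h n)) + h n ^ (γ : ℝ) with hρdef
  set ρ' := √(Real.log n / (n * h n)) + h n ^ (min γ γ' : ℝ) with hρ'def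
  have hr0 : 0 ≤ √(Real.log n / (n * h n)) := Real.sqrt_nonneg _
  have hhγ : 0 ≤ h n ^ (γ : ℝ) := by positivity
  have hρ0 : 0 ≤ ρ := by positivity
  have hρρ' : ρ ≤ ρ' := by
    have := Real.rpow_le_rpow_of_exponent_ge hpos hh1.le (min_le_left (γ : ℝ) γ')
    linarith
  have hXeq : ∀ l : ℕ, X l = regressor p X l ⬝ᵥ a
      + (b (e l) + σ (s l + η l ω) * ε l ω) := by
    intro l
    rw [regressor_dotProduct, hX, causalFilter_maCoeff_eq a hg (fun q => huc q ω) l, he]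
    rfl
  have hXc : ∀ l, |X l| ≤ Gs * cu := fun l => by
    rw [hX]; exact abs_causalFilter_le hg (fun q => huc q ω) l
  have hlow : ∀ v : Fin p → ℝ,
      ∑ i, ∑ j, v i * v j * Q i j + δ * ∑ i, v i ^ 2 ≤ gramForm X p n v := by
    intro v
    rw [gramForm, hX]
    -- Cauchy–Schwarz puts Q below the Gram form of the means; the almost sure lower bound supplies
    -- δ.
    refine le_trans ?_ (v1 v)
    simp only [hQdef]
    rw [limitForm_bilin H.density hμc]
    exact add_le_add (limitForm_self_le H.density (hvμ v)) le_rfl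
  have hup : ∀ v : Fin p → ℝ, gramForm X p n v ≤ Λ * ∑ i, v i ^ 2 := by
    intro v
    refine (gramForm_le hXc v).trans (mul_le_mul_of_nonneg_right ?_
      (Finset.sum_nonneg fun i _ => sq_nonneg _))
    exact le_add_of_nonneg_left hδ.le
  have key := path_rates (K := K) (h := h n) (θ₁ := θ₁) (σ := σ) (E := E) (ρ := ρ) (ρ' := ρ')
    (Q := Q) (R := R) (Cm := C₂ / c₁) (cN := cσ * B) hXeq
    (fun l => by rw [he]; exact hmemE l ω) hXc (fun l => H.abs_scaled_noise_le hσc s l ω)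
    hδ hδΛ hβ hlow hup hQ
    (fun v w => by
      rw [hX, he]
      exact v8 v w)
    (by positivity) hR hρ0 hρ1.le hρρ' hmassE
    (fun i => by
      rw [hX]
      refine (v6 i).trans ?_
      have h1 : R₃ i ≤ R := by
        have := Finset.single_le_sum (fun j _ => hR₃ ((j : Fin p) : ℕ)) (Finset.mem_univ i)
        linarith
      exact mul_le_mul h1 (le_add_of_nonneg_right hhγ) hr0 hR)
    (fun x hx => by
      have h1 := v4 n le_rfl (Nat.le_succ n) x hx
      rw [oracleError, he]
      refine h1.trans (mul_le_mul_of_nonneg_right ?_ hρ0)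
      linarith)
    (fun x hx => by
      have h1 := v5 (n - 1) (Nat.sub_le n 1) (by omega) x hx
      rw [he]
      rw [NNReal.coe_min] at h1
      refine h1.trans (mul_le_mul_of_nonneg_right ?_ (hρ0.trans hρρ'))
      linarith)
    hA hA₁ hA₂ hA₃
  obtain ⟨k1, k2, k3, k4⟩ := key
  have hβk : ∀ k : ℕ, 0 ≤ β ^ k := fun k => pow_nonneg hβ0.le k
  refine ⟨k1, fun x hx => ⟨(hmassE n le_rfl (Nat.le_succ n) x hx).1.ne',
    (hmassE (n - 1) (Nat.sub_le n 1) (by omega) x hx).1.ne'⟩, fun k hk => ?_, fun k hk x hx => ?_,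
    fun k hk x hx => ?_⟩
  · exact (k2 k hk).trans (mul_le_mul_of_nonneg_right (le_max_left _ _)
      (add_nonneg hρ0 (hβk k)))
  · exact (k3 k hk x hx).trans (mul_le_mul_of_nonneg_right
      ((le_max_left _ _).trans (le_max_right _ _)) (add_nonneg hρ0 (hβk k)))
  · exact (k4 k hk x hx).trans (mul_le_mul_of_nonneg_right
      ((le_max_right _ _).trans (le_max_right _ _)) (add_nonneg (hρ0.trans hρρ') (hβk k)))

end Rates


/-! ### Reduction to a bounded model -/

section Independence

variable {Ω α β ι : Type*} [MeasurableSpace Ω] [MeasurableSpace α] [MeasurableSpace β]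
  {P : Measure Ω} {Y : ι → Ω → α} {Z : ι → Ω → β}

/-- It suffices to treat rectangles, a generating π-system. An intersection of rectangles is an
event on the Y sequence met with one on the Z sequence; factor it into these two, factor each over
the indices, and recombine index by index. -/
lemma iIndepFun_prodMk_of_indepFun [IsProbabilityMeasure P] (hY : ∀ i, Measurable (Y i))
    (hZ : ∀ i, Measurable (Z i)) (hYi : iIndepFun Y P) (hZi : iIndepFun Z P)
    (h : IndepFun (fun ω i => Y i ω) (fun ω i => Z i ω) P) :
    iIndepFun (fun i ω => (Y i ω, Z i ω)) P := by
  set R : Set (Set (α × β)) := Set.image2 (· ×ˢ ·) {s | MeasurableSet s} {t | MeasurableSet t}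
    with hR
  refine iIndepSets.iIndep
    (m := fun i => MeasurableSpace.comap (fun ω => (Y i ω, Z i ω)) inferInstance)
    (fun i => ((hY i).prodMk (hZ i)).comap_le)
    (fun i => {A | ∃ B ∈ R, (fun ω => (Y i ω, Z i ω)) ⁻¹' B = A})
    (fun i => isPiSystem_prod.comap _) (fun i => ?_) ?_
  · rw [← generateFrom_prod, MeasurableSpace.comap_generateFrom]
    rfl
  rw [iIndepSets_iff]
  intro S A hA
  have hA' : ∀ i, ∃ (s : Set α) (t : Set β), MeasurableSet s ∧ MeasurableSet t ∧
      (i ∈ S → A i = Y i ⁻¹' s ∩ Z i ⁻¹' t) := by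
    intro i
    by_cases hi : i ∈ S
    · obtain ⟨_, ⟨s, hs, t, ht, rfl⟩, hst⟩ := hA i hi
      exact ⟨s, t, hs, ht, fun _ => by rw [← hst]; rfl⟩
    · exact ⟨∅, ∅, .empty, .empty, fun h => absurd h hi⟩
  choose s t hs ht hst using hA'
  have hsplit : ⋂ i ∈ S, A i = (fun ω i => Y i ω) ⁻¹' (⋂ i ∈ S, (fun y => y i) ⁻¹' s i)
      ∩ (fun ω i => Z i ω) ⁻¹' (⋂ i ∈ S, (fun z => z i) ⁻¹' t i) := by
    rw [Set.iInter₂_congr hst]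
    ext ω
    simp only [Set.mem_iInter, Set.mem_inter_iff, Set.mem_preimage]
    exact ⟨fun h => ⟨fun i hi => (h i hi).1, fun i hi => (h i hi).2⟩,
      fun h i hi => ⟨h.1 i hi, h.2 i hi⟩⟩
  have hms : MeasurableSet (⋂ i ∈ S, (fun y : ι → α => y i) ⁻¹' s i) :=
    Finset.measurableSet_biInter _ fun i _ => measurable_pi_apply i (hs i)
  have hmt : MeasurableSet (⋂ i ∈ S, (fun z : ι → β => z i) ⁻¹' t i) :=
    Finset.measurableSet_biInter _ fun i _ => measurable_pi_apply i (ht i)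
  have hYS : P ((fun ω i => Y i ω) ⁻¹' (⋂ i ∈ S, (fun y => y i) ⁻¹' s i))
      = ∏ i ∈ S, P (Y i ⁻¹' s i) := by
    rw [← hYi.measure_inter_preimage_eq_mul S fun i _ => hs i]
    simp only [Set.preimage_iInter]
    rfl
  have hZS : P ((fun ω i => Z i ω) ⁻¹' (⋂ i ∈ S, (fun z => z i) ⁻¹' t i))
      = ∏ i ∈ S, P (Z i ⁻¹' t i) := by
    rw [← hZi.measure_inter_preimage_eq_mul S fun i _ => ht i]
    simp only [Set.preimage_iInter]
    rfl
  rw [hsplit, h.measure_inter_preimage_eq_mul _ _ hms hmt, hYS, hZS, ← Finset.prod_mul_distrib]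
  refine Finset.prod_congr rfl fun i hi => ?_
  rw [hst i hi]
  exact ((h.comp (measurable_pi_apply i) (measurable_pi_apply i)).measure_inter_preimage_eq_mul
    _ _ (hs i) (ht i)).symm

end Independence

/-- The truncation of a real number to `[-c, c]`. -/
def clamp (c x : ℝ) : ℝ := max (-c) (min c x)

lemma measurable_clamp (c : ℝ) : Measurable (clamp c) :=
  measurable_const.max (measurable_const.min measurable_id)

lemma clamp_mem {c : ℝ} (hc : 0 ≤ c) (x : ℝ) : clamp c x ∈ Set.Icc (-c) c :=
  ⟨le_max_left _ _, max_le (by linarith) (min_le_left _ _)⟩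

lemma clamp_of_mem {c x : ℝ} (hx : x ∈ Set.Icc (-c) c) : clamp c x = x := by
  rw [clamp, min_eq_right hx.2, max_eq_right hx.1]

section Density

variable {Ω : Type*} [MeasurableSpace Ω] {P : Measure Ω} {Y : Ω → ℝ} {f : ℝ → ℝ}
  {m : ℝ}

lemma HasDensityOn.measurable (hf : HasDensityOn P Y f m)
    (hc : ContinuousOn f (Set.Icc (-m) m)) : Measurable f := by
  classical
  have h1 := hc.measurable_piecewise (g := fun _ => 0) continuousOn_const measurableSet_Icc
  convert h1 using 1
  ext x
  by_cases hx : x ∈ Set.Icc (-m) m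
  · rw [Set.piecewise_eq_of_mem _ _ _ hx]
  · rw [Set.piecewise_eq_of_notMem _ _ _ hx, hf.eq_zero x hx]

lemma HasDensityOn.ae_mem (hY : Measurable Y) (hf : HasDensityOn P Y f m) :
    ∀ᵐ ω ∂P, Y ω ∈ Set.Icc (-m) m := by
  have h1 : P.map Y (Set.Icc (-m) m)ᶜ = 0 := by
    rw [hf.map_eq, withDensity_apply _ measurableSet_Icc.compl,
      setLIntegral_congr_fun (g := fun _ => 0) measurableSet_Icc.compl fun x hx => by
        simp [hf.eq_zero x hx]]
    simp
  rwa [Measure.map_apply hY measurableSet_Icc.compl] at h1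

/-- Positivity of m is forced: for m ≤ 0 the interval is a null set, yet f has total mass one. -/
lemma HasDensityOn.isIntervalDensity [IsProbabilityMeasure P] (hY : Measurable Y) (hf : HasDensityOn P Y f m)
    (hc : ContinuousOn f (Set.Icc (-m) m)) : IsIntervalDensity f m := by
  have hfm := hf.measurable hc
  have hprob : IsProbabilityMeasure (P.map Y) := Measure.isProbabilityMeasure_map hY.aemeasurable
  have h0 : ∀ x, 0 ≤ f x := fun x => by
    by_cases hx : x ∈ Set.Icc (-m) m
    · exact (hf.pos x hx).le
    · exact (hf.eq_zero x hx).ge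
  have h1 : ∫⁻ x, ENNReal.ofReal (f x) = 1 := by
    have := hprob.measure_univ
    rwa [hf.map_eq, withDensity_apply _ .univ, Measure.restrict_univ] at this
  refine ⟨?_, hfm, hf.pos, hf.eq_zero, hc, ?_⟩
  · by_contra! hm
    have h2 : ∫⁻ x, ENNReal.ofReal (f x) = 0 := by
      rw [lintegral_eq_zero_iff hfm.ennreal_ofReal]
      have h3 : ∀ᵐ x : ℝ, x ∉ Set.Icc (-m) m := by
        refine measure_eq_zero_iff_ae_notMem.1 ?_
        rw [Real.volume_Icc, ENNReal.ofReal_eq_zero]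
        linarith
      filter_upwards [h3] with x hx
      simp [hf.eq_zero x hx]
    rw [h2] at h1
    exact zero_ne_one h1
  · rw [integral_eq_lintegral_of_nonneg_ae (ae_of_all _ h0) hfm.aestronglyMeasurable, h1]
    rfl

end Density

section Model

variable {Ω : Type*} [MeasurableSpace Ω] {P : Measure Ω} {η ε : ℤ → Ω → ℝ} {f : ℝ → ℝ}
  {m B : ℝ}

lemma BoundedWhiteNoise.ae_mem (hη : BoundedWhiteNoise P η) (hf : HasDensityOn P (η 1) f m) :
    ∀ᵐ ω ∂P, ∀ n, η n ω ∈ Set.Icc (-m) m :=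
  ae_all_iff.2 fun n =>
    HasDensityOn.ae_mem (f := f) (hη.measurable n)
      ⟨(hη.ident n).map_eq.trans hf.map_eq, hf.pos, hf.eq_zero⟩

/-- The truncated noises form a bounded model. -/
theorem boundedModel_clamp [IsProbabilityMeasure P] (hη : BoundedWhiteNoise P η) (hε : BoundedWhiteNoise P ε)
    (hvar : ∀ n, Var[ε n; P] = 1) (hindep : IndepFun (fun ω n => ε n ω) (fun ω n => η n ω) P)
    (hf : HasDensityOn P (η 1) f m) (hc : ContinuousOn f (Set.Icc (-m) m)) (hB0 : 0 ≤ B)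
    (hB : ∀ᵐ ω ∂P, ∀ n, ε n ω ∈ Set.Icc (-B) B) :
    BoundedModel P (fun n ω => clamp m (η n ω)) (fun n ω => clamp B (ε n ω)) f m B := by
  have hd := hf.isIntervalDensity (hη.measurable 1) hc
  have hηm := hη.measurable
  have hεm := hε.measurable
  have e1 : ∀ n, (fun ω => clamp m (η n ω)) =ᵐ[P] η n := fun n => by
    filter_upwards [hη.ae_mem hf] with ω hω using clamp_of_mem (hω n)
  have e2 : ∀ n, (fun ω => clamp B (ε n ω)) =ᵐ[P] ε n := fun n => by
    filter_upwards [hB] with ω hω using clamp_of_mem (hω n)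
  refine ⟨fun n => (measurable_clamp m).comp (hηm n), fun n => (measurable_clamp B).comp (hεm n),
    ?_, fun n => ?_, hd, fun n => ?_, fun n ω => clamp_mem hd.m_pos.le _, fun n ω => ?_,
    fun n => ?_, fun n => ?_⟩
  · exact (iIndepFun_prodMk_of_indepFun hηm hεm hη.indep hε.indep hindep.symm).comp
      (fun _ y => (clamp m y.1, clamp B y.2)) fun _ =>
        ((measurable_clamp m).comp measurable_fst).prodMk ((measurable_clamp B).comp measurable_snd)
  · exact hindep.symm.comp ((measurable_clamp m).comp (measurable_pi_apply n))
      ((measurable_clamp B).comp (measurable_pi_apply n))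
  · rw [Measure.map_congr (e1 n), (hη.ident n).map_eq, hf.map_eq]
  · exact abs_le.2 (clamp_mem hB0 _)
  · rw [integral_congr_ae (e2 n), hε.centered n]
  · rw [← hvar n, variance_of_integral_eq_zero (hεm n).aemeasurable (hε.centered n)]
    refine integral_congr_ae ?_
    filter_upwards [e2 n] with ω hω
    rw [hω]

end Model

lemma measurable_indicator_of_continuousOn {E : Set ℝ} (hE : IsCompact E) {φ : ℝ → ℝ}
    (hφ : ContinuousOn φ E) : Measurable (E.indicator φ) := by
  classical
  rw [← Set.piecewise_eq_indicator]
  exact hφ.measurable_piecewise continuousOn_const hE.isClosed.measurableSet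

lemma exists_abs_indicator_le {E : Set ℝ} (hE : IsCompact E) {φ : ℝ → ℝ}
    (hφ : ContinuousOn φ E) : ∃ c, ∀ x, |E.indicator φ x| ≤ c := by
  obtain ⟨c, hc⟩ := hE.exists_bound_of_continuousOn hφ
  refine ⟨|c|, fun x => ?_⟩
  by_cases hx : x ∈ E
  · rw [Set.indicator_of_mem hx]
    exact (hc x hx).trans (le_abs_self c)
  · rw [Set.indicator_of_notMem hx, abs_zero]
    exact abs_nonneg c

end PartiallyLinear

/-! ### Transfer of the rates to the original noises and functions. -/

theorem theorem1
    {Ω : Type*} [MeasurableSpace Ω] (P : Measure Ω) [IsProbabilityMeasure P]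
    (p T : ℕ) (hp : 1 ≤ p) (hT : 1 ≤ T)
    (a : Fin p → ℝ) (b σ : ℝ → ℝ) (s : ℤ → ℝ)
    (η ε e X : ℤ → Ω → ℝ)
    (f g : ℝ → ℝ) (mη mε : ℝ) (γ γ' : ℝ≥0)
    (K : ℝ → ℝ) (h : ℕ → ℝ) (β₁ β₂ : ℝ) (θ₁ : Fin p → ℝ)
    -- exogenous sequence: periodic part plus bounded white noise
    (hs : Function.Periodic s (T : ℤ))
    (hη : PartiallyLinear.BoundedWhiteNoise P η)
    (he : ∀ n ω, e n ω = s n + η n ω)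
    -- system noise
    (hε : PartiallyLinear.BoundedWhiteNoise P ε)
    (hε_var : ∀ n, Var[ε n; P] = 1)
    -- stability
    (hstab : ∀ z : ℂ, 1 ≤ ‖z‖ →
      z ^ p - ∑ j : Fin p, (a j : ℂ) * z ^ (p - ((j : ℕ) + 1)) ≠ 0)
    -- independence of the two noise sequences
    (hindep : IndepFun (fun ω n => ε n ω) (fun ω n => η n ω) P)
    -- densities
    (hf : PartiallyLinear.HasDensityOn P (η 1) f mη)
    (hf_cont : ContinuousOn f (Set.Icc (-mη) mη))
    (hg : PartiallyLinear.HasDensityOn P (ε 1) g mε)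
    (hg_smooth : ContDiffOn ℝ 1 g (Set.Icc (-mε) mε))
    -- regularity of the functions
    (hγ : 0 < γ ∧ γ ≤ 1) (hγ' : 0 < γ' ∧ γ' ≤ 1)
    (hb : ∃ C : ℝ≥0, HolderOnWith C γ b (PartiallyLinear.inputSupport T s mη))
    (hσ : ∃ C : ℝ≥0, HolderOnWith C γ' (fun x => σ x ^ 2) (PartiallyLinear.inputSupport T s mη))
    (hσ_pos : ∃ c : ℝ, 0 < c ∧ ∀ x ∈ PartiallyLinear.inputSupport T s mη, c ≤ σ x)
    -- kernel and bandwidth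
    (hK : PartiallyLinear.IsKernel K γ)
    (hβ₁ : -1 < β₁ ∧ β₁ < 0)
    (hh : h ~[atTop] fun n : ℕ => (n : ℝ) ^ β₁ * Real.log n ^ β₂)
    -- the periodically correlated solution of the model
    (hX : ∀ n ω, X n ω = PartiallyLinear.maSolution a b σ (fun m => e m ω) (fun m => ε m ω) n) :
    ∃ β ∈ Set.Ioo (0 : ℝ) 1, ∀ᵐ ω ∂P, ∃ (C : ℝ) (N : ℕ), ∀ n ≥ N,
      -- the estimators are well defined
      IsUnit (PartiallyLinear.gram p (fun m => X m ω) n).det ∧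
      (∀ x ∈ PartiallyLinear.inputSupport T s mη,
        PartiallyLinear.kernelMass p K (h n) (fun m => e m ω) n x ≠ 0 ∧
        PartiallyLinear.kernelMass p K (h n) (fun m => e m ω) (n - 1) x ≠ 0) ∧
      -- the rates
      (∀ k ≥ 1,
        ‖WithLp.toLp 2 (PartiallyLinear.thetaHat K (h n) (fun m => X m ω) (fun m => e m ω)
            n θ₁ k - a)‖
          ≤ C * (√(Real.log n / (n * h n)) + h n ^ (γ : ℝ) + β ^ k)) ∧
      (∀ k ≥ 1, ∀ x ∈ PartiallyLinear.inputSupport T s mη,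
        |PartiallyLinear.bHat K (h n) (fun m => X m ω) (fun m => e m ω) n θ₁ k x - b x|
          ≤ C * (√(Real.log n / (n * h n)) + h n ^ (γ : ℝ) + β ^ k)) ∧
      (∀ k ≥ 2, ∀ x ∈ PartiallyLinear.inputSupport T s mη,
        |PartiallyLinear.sigmaSqHat K (h n) (fun m => X m ω) (fun m => e m ω) n θ₁ k x - σ x ^ 2|
          ≤ C * (√(Real.log n / (n * h n)) + h n ^ (min γ γ' : ℝ) + β ^ k)) := by
  obtain ⟨Cb, hb⟩ := hb
  obtain ⟨Cσ, hσ⟩ := hσ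
  obtain ⟨c₀, hc₀, hσ₀⟩ := hσ_pos
  obtain ⟨B, hB⟩ := hε.bounded
  set E := PartiallyLinear.inputSupport T s mη with hE
  have hEc : IsCompact E := PartiallyLinear.isCompact_inputSupport T s mη
  have hεB : ∀ᵐ ω ∂P, ∀ n, ε n ω ∈ Set.Icc (-|B|) |B| := by
    rw [ae_all_iff]
    intro n
    filter_upwards [hB n] with ω hω
    exact abs_le.1 (hω.trans (le_abs_self B))
  have hηm := hη.ae_mem hf
  -- Truncation turns almost sure bounds into bounds at every outcome, without changing almost any
  -- path.
  have H := PartiallyLinear.boundedModel_clamp hη hε hε_var hindep hf hf_cont (abs_nonneg B) hεB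
  have hbc : ContinuousOn b E := hb.continuousOn hγ.1
  -- The Hölder condition concerns σ²; on E, σ is its positive square root.
  have hσc : ContinuousOn σ E := by
    refine (hσ.continuousOn hγ'.1).sqrt.congr fun x hx => ?_
    exact (Real.sqrt_sq (hc₀.le.trans (hσ₀ x hx))).symm
  -- Off E nothing is assumed on b and σ, not even measurability. Almost surely every e_l lies in E,
  -- so extension by zero leaves the process unchanged.
  obtain ⟨cb, hcb⟩ := PartiallyLinear.exists_abs_indicator_le hEc hbc
  obtain ⟨cσ, hcσ⟩ := PartiallyLinear.exists_abs_indicator_le hEc hσc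
  obtain ⟨β, hβ, C, hC⟩ := H.ae_rates (γ' := γ') hK hγ.1
    (PartiallyLinear.isBandwidth_of_isEquivalent hβ₁ hh) hT hs a θ₁
    (PartiallyLinear.summable_abs_maCoeff a hstab)
    (PartiallyLinear.measurable_indicator_of_continuousOn hEc hbc) hcb
    (PartiallyLinear.measurable_indicator_of_continuousOn hEc hσc) hcσ
    (Cb := Cb) (Cσ := Cσ)
    (fun x hx y hy => by
      rw [Set.indicator_of_mem hx, Set.indicator_of_mem hy]
      exact hb x hx y hy)
    (fun x hx y hy => by
      change edist (E.indicator σ x ^ 2) (E.indicator σ y ^ 2) ≤ _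
      rw [Set.indicator_of_mem hx, Set.indicator_of_mem hy]
      exact hσ x hx y hy)
    (c₀ := c₀ ^ 2) (by positivity)
    (fun x hx => by
      rw [Set.indicator_of_mem hx]
      exact pow_le_pow_left₀ hc₀.le (hσ₀ x hx) 2)
  refine ⟨β, hβ, ?_⟩
  filter_upwards [hC, hεB, hηm] with ω hω w1 w2
  obtain ⟨N, hN⟩ := eventually_atTop.1 hω
  refine ⟨C, N, fun n hn => ?_⟩
  have hcl : ∀ l, PartiallyLinear.clamp mη (η l ω) = η l ω := fun l =>
    PartiallyLinear.clamp_of_mem (w2 l)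
  have hcl' : ∀ l, PartiallyLinear.clamp |B| (ε l ω) = ε l ω := fun l =>
    PartiallyLinear.clamp_of_mem (w1 l)
  have key := hN n hn (fun l => X l ω) (fun l => e l ω)
    (by
      ext l
      rw [hX, PartiallyLinear.maSolution, PartiallyLinear.causalFilter]
      refine tsum_congr fun j => ?_
      have hmem : s (l - j) + η (l - j) ω ∈ E :=
        PartiallyLinear.mem_inputSupport hT hs (w2 (l - j)) (l - j)
      rw [PartiallyLinear.drive, hcl, hcl', he, Set.indicator_of_mem hmem,
        Set.indicator_of_mem hmem])
    (by
      ext l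
      rw [hcl, he])
  obtain ⟨k1, k2, k3, k4, k5⟩ := key
  refine ⟨k1, k2, k3, fun k hk x hx => ?_, fun k hk x hx => ?_⟩
  · have := k4 k hk x hx
    rwa [Set.indicator_of_mem hx] at this
  · have := k5 k hk x hx
    rwa [Set.indicator_of_mem hx] at this
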